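/- **Setting.** For every countable limit ordinal $\alpha$ fix a strictly increasing sequence $c_\alpha:\omega\to\alpha$ cofinal in $\alpha$ (the theorem holds for every choice). For $k<\omega$ let $l^k_n=n$ if $n\le k+1$ and $l^k_{n+1}=l^k_n+(n+1)-k$ if $n\ge k+1$; let $B^k_n=\{l: l^k_n\le l<l^k_{n+1}\}$. For each $\alpha<\omega_1$ and $n<\omega$ define, by recursion on $\alpha$, a set $\mathbb S_\alpha(n)$ of functions $s$ with values in $\mathbb N$ and with domain $\emptyset$ or $[\beta,\alpha]$ for some $\beta\le\alpha$, a set $\mathbb T_\alpha(n)$ of finite sequences of natural numbers, and a map $\psi_\alpha$ from $\mathbb S_\alpha=\bigcup_n\mathbb S_\alpha(n)$ onto $\mathbb T_\alpha=\bigcup_n\mathbb T_\alpha(n)$ with $\psi_\alpha(\emptyset)=\langle\rangle$. Put $\sigma_\gamma(s)=s\restriction[0,\gamma]$. * $\alpha=0$: $\mathbb S_0(n)=\{\emptyset,\{(0,n)\}\}$, $\mathbb T_0(n)=\{\langle\rangle,\langle n\rangle\}$, $\psi_0(\{(0,n)\})=\langle n\rangle$. * $\alpha=\delta+k+1$, with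 $\delta$ zero or a limit and $k<\omega$; put $\eta=\delta+k$. $\mathbb S_\alpha(n)$ consists of $\emptyset$ and all $(g\cup\{(\alpha,n)\})\restriction[\beta,\alpha]$ with $\beta\le\alpha$, $g\in\bigcup_{l\in B^k_n}\mathbb S_\eta(l)$ and $\operatorname{dom}g=[0,\eta]$. $\mathbb T_\alpha(n)=\mathbb T_\eta(n)$ if $n\le k$, and $\mathbb T_\alpha(n)=\{\langle\rangle\}\cup\{\langle n\rangle^\frown t: t\in\bigcup_{l\in B^k_n}\mathbb T_\eta(l)\}$ if $n>k$. For $s\in\mathbb S_\alpha(n)$: $\psi_\alpha(s)=\langle n\rangle$ if $\operatorname{dom}s=\{\alpha\}$; if $\operatorname{dom} s=[\zeta,\alpha]$ with $\zeta<\alpha$, then $\psi_\alpha(s)=\psi_\eta(\sigma_\eta(s))$ if $n\le k$ and $\psi_\alpha(s)=\langle n\rangle^\frown\psi_\eta(\sigma_\eta(s))$ if $n>k$. * $\alpha$ a limit. For $\gamma\le\beta$ say that $\mathbb S_\gamma(q)$ *fits in* $\mathbb S_\beta(m)$ if there is a function $r$ with domain $(\gamma,\beta]$ such that $\mathbb S_\gamma(q)\subseteq\{\sigma_\gamma(s):s\in\mathbb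 S_\beta(m),\ r\subseteq s\}$. Let $a_0=b_0=0$. Given $a_j,b_j$, let $k_j\ge a_j$ be least such that for every $q\ge k_j$ there is $m$ such that $\mathbb S_{c_\alpha(j)}(q)$ fits in $\mathbb S_{c_\alpha(j+1)}(m)$; let $m_j$ be the $m$ for $q=k_j$, let $l_j$ be the largest $l$ such that $\mathbb S_{c_\alpha(j)}(l)$ fits in $\mathbb S_{c_\alpha(j+1)}(m_j)$, and put $a_{j+1}=m_j+1$, $b_{j+1}=b_j+(l_j+1-a_j)$. For $b_j\le i<b_{j+1}$ put $\gamma=c_\alpha(j)$ and $m=a_j+(i-b_j)$. Then $\mathbb S_\alpha(i)$ consists of $\emptyset$ and all $f$ with domain $[\beta,\alpha]$, $\beta\le\alpha$, with $\sigma_\gamma(f)\in\mathbb S_\gamma(m)$ and with $f$ constantly $i$ on $\operatorname{dom}f\cap(\gamma,\alpha]$. $\mathbb T_\alpha(i)$ is obtained from $\mathbb T_\gamma(m)$ by replacing the first entry of each nonempty sequence by $i$. For $s\in\mathbb S_\alpha(i)$, $s\neq\emptyset$: $\psi_\alpha(s)=\langle i\rangle$ if $\sigma_\gamma(s)=\emptyset$,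 and otherwise $\psi_\alpha(s)$ is $\psi_\gamma(\sigma_\gamma(s))$ with its first entry replaced by $i$. On $\mathbb S_\alpha$ let $s<_{\mathrm{lex}}s'$ iff $s\subsetneq s'$, or $s(\xi)<s'(\xi)$ for some $\xi$ in both domains such that $s,s'$ agree above $\xi$. An *isomorphism* between subsets of $\mathbb S_\alpha$ is a bijection that preserves extension and $<_{\mathrm{lex}}$ in both directions and the domain of every node. $\mathcal R_\alpha$ is the set of all $X\subseteq\mathbb T_\alpha$ for which there is a (unique) strictly increasing sequence $(k_n)_{n<\omega}$ such that $X\cap\mathbb T_\alpha(m)$ contains a node other than the root $\langle\rangle$ iff $m=k_n$ for some $n$, and $\psi_\alpha^{-1}(X\cap\mathbb T_\alpha(k_n))\cong\mathbb S_\alpha(n)$ for every $n$. Put $X(n)=X\cap\mathbb T_\alpha(k_n)$, $\mathcal R_\alpha(n)=\{X(n):X\in\mathcal R_\alpha\}$ and $\mathcal R_\alpha(n)|x=\{u\in\mathcal R_\alpha(n):u\subseteq x\}$. A set $S\subseteq\mathbb S_\alpha(n)$ is *downward closed* if $\emptyset\in S$ and $s\restriction[\gamma,\alpha]\in S$ whenever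 $s\in S$, $\operatorname{dom}s=[\beta,\alpha]$ and $\beta\le\gamma\le\alpha$. For $u\in\mathcal R_\alpha(n)$ let $\iota_u$ be the isomorphism from $\mathbb S_\alpha(n)$ onto $\psi_\alpha^{-1}(u)$ and $\pi_S(u)=\psi_\alpha(\iota_u(S))$. Let $\mathfrak S_\alpha(n,k)$ be the set of downward closed $S\subseteq\mathbb S_\alpha(n)$ that are isomorphic to $\psi_\alpha^{-1}(v)$ for some nonempty subtree $v$ (closed under initial segments) of some $u\in\mathcal R_\alpha(n)|\mathbb T_\alpha(k)$. For $y\in\mathcal R_\alpha(k)$, an equivalence relation $E$ is *canonical* on $\mathcal R_\alpha(n)|y$ if there is $S\in\mathfrak S_\alpha(n,k)$ such that for all $u,v\in\mathcal R_\alpha(n)|y$: $u\mathrel E v\iff\pi_S(u)=\pi_S(v)$. **Theorem (Finite Canonization Theorem for $\mathcal R_\alpha(n)$).** Let $1\le\alpha<\omega_1$, $n\le k<\omega$ and $X\in\mathcal R_\alpha$. Then there is $m<\omega$ such that 1. for every equivalence relation $E$ on $\mathcal R_\alpha(n)|X(m)$ there is $y\in\mathcal R_\alpha(k)|X(m)$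 such that $E$ is canonical on $\mathcal R_\alpha(n)|y$; and 2. for every $f:\mathcal R_\alpha(n)|X(m)\to\{0,1\}$ there is $y\in\mathcal R_\alpha(k)|X(m)$ such that $f$ is constant on $\mathcal R_\alpha(n)|y$. -/

import Mathlib

noncomputable section

namespace RamseySpace

open Set

/-! ## Nodes: finite-valued functions on final segments `[β, α]` of an ordinal interval -/

/-- A partial function from ordinals to natural numbers. -/
abbrev Node : Type 1 := Ordinal.{0} → Option ℕ

/-- The domain of a partial function. -/
def Node.dom (s : Node) : Set Ordinal.{0} := {ξ | s ξ ≠ none}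

/-- The empty partial function. -/
def Node.empty : Node := fun _ => none

open Classical in
/-- The restriction of a partial function to a set of ordinals. -/
def Node.restrict (s : Node) (A : Set Ordinal.{0}) : Node := fun ξ => if ξ ∈ A then s ξ else none

/-- Extension of partial functions: `s ⊆ s'` as sets of pairs. -/
def Node.Sub (s s' : Node) : Prop := ∀ ξ n, s ξ = some n → s' ξ = some n

/-- The projection to level `γ`: restriction to `γ + 1 = [0, γ]`. -/
def Node.sigma (γ : Ordinal.{0}) (s : Node) : Node := s.restrict (Iic γ)

/-- The strict lexicographic order: proper extension, or a smaller value at the largest ordinal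
at which the two functions differ. -/
def Node.Lex (s s' : Node) : Prop :=
  (s.Sub s' ∧ s ≠ s') ∨
    ∃ ξ m n, s ξ = some m ∧ s' ξ = some n ∧ m < n ∧ ∀ η, ξ < η → s η = s' η

/-- `ι` restricts to an isomorphism from the structure `A` onto the structure `B`: a bijection
that preserves and reflects extension and the lexicographic order, and preserves the level
(that is, the domain) of every node. -/
structure IsIso (A B : Set Node) (ι : Node → Node) : Prop where
  bijOn : BijOn ι A B
  dom_eq : ∀ s ∈ A, (ι s).dom = s.dom
  sub_iff : ∀ s ∈ A, ∀ s' ∈ A, ((ι s).Sub (ι s') ↔ s.Sub s')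
  lex_iff : ∀ s ∈ A, ∀ s' ∈ A, ((ι s).Lex (ι s') ↔ s.Lex s')

/-- `A` and `B` are isomorphic. -/
def Isomorphic (A B : Set Node) : Prop := ∃ ι, IsIso A B ι

/-! ## The recursive construction of `𝕊_α`, `𝕋_α`, `ψ_α` -/

/-- The number `k < ω` in the decomposition `α = δ + k`, where `δ` is `0` or a limit ordinal. -/
def finPart (α : Ordinal.{0}) : ℕ :=
  Ordinal.limitRecOn (motive := fun _ => ℕ) α 0 (fun _ k => k + 1) (fun _ _ _ => 0)

/-- `blockStart k n = n` for `n ≤ k + 1`, and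
`blockStart k (n + 1) = blockStart k n + (n + 1) - k` for `n ≥ k + 1`. -/
def blockStart (k : ℕ) : ℕ → ℕ
  | 0 => 0
  | n + 1 => if n + 1 ≤ k + 1 then n + 1 else blockStart k n + (n + 1 - k)

/-- The `n`-th block `{l | blockStart k n ≤ l < blockStart k (n + 1)}`. -/
def block (k n : ℕ) : Set ℕ := Ico (blockStart k n) (blockStart k (n + 1))

/-- The data attached to one ordinal `α`: the pieces `𝕊_α(n)` and `𝕋_α(n)`, and the projection
`ψ_α` (only its values on `⋃ n, 𝕊_α(n)` matter). -/
structure Level : Type 1 where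
  /-- the pieces `𝕊_α(n)` -/
  S : ℕ → Set Node
  /-- the pieces `𝕋_α(n)`, sets of finite sequences of natural numbers -/
  T : ℕ → Set (List ℕ)
  /-- the projection `ψ_α` -/
  psi : Node → List ℕ

/-- Level `0`: `𝕊_0(n)` and `𝕋_0(n)` both consist of the empty sequence and `⟨n⟩`. -/
def zeroLevel : Level where
  S n := {s | s = Node.empty ∨ (s.dom = {0} ∧ s 0 = some n)}
  T n := {[], [n]}
  psi s := (s 0).toList

open Classical in
/-- The successor step, from `α` to `α + 1`, with `α = δ + k`. -/
def succLevel (α : Ordinal.{0}) (L : Level) : Level where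
  S n := {f | f = Node.empty ∨
    ∃ β ≤ α + 1, ∃ l ∈ block (finPart α) n, ∃ g ∈ L.S l, g.dom = Icc 0 α ∧
      f = Node.restrict (fun ξ => if ξ = α + 1 then some n else g ξ) (Icc β (α + 1))}
  T n := if n ≤ finPart α then L.T n
    else {t | t = [] ∨ ∃ l ∈ block (finPart α) n, ∃ t' ∈ L.T l, t = n :: t'}
  psi s := match s (α + 1) with
    | none => []
    | some n =>
      if s α = none then [n]
      else if n ≤ finPart α then L.psi (s.sigma α)
      else n :: L.psi (s.sigma α)

/-- `𝕊_γ(q)` sits inside `𝕊_β(m)` (for `γ ≤ β`): it is contained in the image under the projection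
to level `γ` of the part of `𝕊_β(m)` above a single node `r` with domain `(γ, β]`. -/
def Fits (γ : Ordinal.{0}) (K : Level) (q : ℕ) (β : Ordinal.{0}) (L : Level) (m : ℕ) : Prop :=
  ∃ r : Node, r.dom = Ioc γ β ∧ K.S q ⊆ Node.sigma γ '' {s | s ∈ L.S m ∧ r.Sub s}

section limit

/- `d j` is the `j`-th term of the cofinal sequence, `D j` the data attached to it. -/
variable (d : ℕ → Ordinal.{0}) (D : ℕ → Level)

/-- The least `k ≥ a` such that for all `q ≥ k` there is an `m` such that the `q`-th piece at
`d j` sits inside the `m`-th piece at `d (j + 1)`. -/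
def stepK (j a : ℕ) : ℕ :=
  sInf {k | a ≤ k ∧ ∀ q, k ≤ q → ∃ m, Fits (d j) (D j) q (d (j + 1)) (D (j + 1)) m}

/-- The index `m` such that piece number `stepK j a` at `d j` sits inside the `m`-th piece at
`d (j + 1)`. -/
def stepM (j a : ℕ) : ℕ :=
  sInf {m | Fits (d j) (D j) (stepK d D j a) (d (j + 1)) (D (j + 1)) m}

/-- The largest `l` such that the `l`-th piece at `d j` sits inside piece number `stepM j a` at
`d (j + 1)`. -/
def stepL (j a : ℕ) : ℕ :=
  sSup {l | Fits (d j) (D j) l (d (j + 1)) (D (j + 1)) (stepM d D j a)}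

/-- `limStart j = (a, b)`: the pieces of the limit space that are copied from `d j` are those with
index in `[b, b')`, where `b'` belongs to `j + 1`; they are the pieces `a, a + 1, …, stepL j a`
at `d j`. The next copied piece, at `d (j + 1)`, is the one after `stepM j a`. -/
def limStart : ℕ → ℕ × ℕ
  | 0 => (0, 0)
  | j + 1 =>
    let a := (limStart j).1
    let b := (limStart j).2
    (stepM d D j a + 1, b + (stepL d D j a + 1 - a))

/-- The `j` such that the `i`-th piece of the limit space is copied from `d j`. -/
def limStage (i : ℕ) : ℕ := Nat.findGreatest (fun j => (limStart d D j).2 ≤ i) i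

/-- The index at `d (limStage i)` of the piece that is copied to the `i`-th piece. -/
def limIndex (i : ℕ) : ℕ :=
  (limStart d D (limStage d D i)).1 + (i - (limStart d D (limStage d D i)).2)

/-- The limit step. The first entry of the sequences in the copied piece of the tree is relabelled
as `i`, so that different pieces have only the root in common. -/
def limLevel (α : Ordinal.{0}) : Level where
  S i := {f | f = Node.empty ∨
    ((∃ β ≤ α, f.dom = Icc β α) ∧
      f.sigma (d (limStage d D i)) ∈ (D (limStage d D i)).S (limIndex d D i) ∧
      ∀ ξ ∈ f.dom, d (limStage d D i) < ξ → f ξ = some i)}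
  T i := {t | t = [] ∨ ∃ x t', x :: t' ∈ (D (limStage d D i)).T (limIndex d D i) ∧ t = i :: t'}
  psi s := match s α with
    | none => []
    | some i => i :: ((D (limStage d D i)).psi (s.sigma (d (limStage d D i)))).tail

end limit

/-- `c` assigns to every countable limit ordinal `α` a strictly increasing sequence
`c α : ℕ → α` that is cofinal in `α`. -/
structure IsLadderSystem (c : Ordinal.{0} → ℕ → Ordinal.{0}) : Prop where
  lt : ∀ α, Order.IsSuccLimit α → α < Ordinal.omega 1 → ∀ n, c α n < α
  strictMono : ∀ α, Order.IsSuccLimit α → α < Ordinal.omega 1 → StrictMono (c α)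
  cofinal : ∀ α, Order.IsSuccLimit α → α < Ordinal.omega 1 → ∀ β < α, ∃ n, β < c α n

open Classical in
/-- The data `𝕊_α`, `𝕋_α`, `ψ_α`, by recursion on `α`. (The default value in the limit step is
never used when `α` is countable and `c` is a ladder system.) -/
def level (c : Ordinal.{0} → ℕ → Ordinal.{0}) (α : Ordinal.{0}) : Level :=
  Ordinal.limitRecOn (motive := fun _ => Level) α zeroLevel succLevel
    (fun α _ ih => limLevel (c α)
      (fun j => if h : c α j < α then ih (c α j) h else zeroLevel) α)

/-! ## The spaces `R_α` -/

section space

variable (c : Ordinal.{0} → ℕ → Ordinal.{0}) (α : Ordinal.{0})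

/-- `𝕊_α(n)`. -/
def SPiece (n : ℕ) : Set Node := (level c α).S n

/-- `𝕋_α(n)`. -/
def TPiece (n : ℕ) : Set (List ℕ) := (level c α).T n

/-- `𝕋_α`. -/
def TTree : Set (List ℕ) := ⋃ n, TPiece c α n

/-- The preimage `ψ_α⁻¹(u) ⊆ 𝕊_α`. -/
def psiPreimage (u : Set (List ℕ)) : Set Node :=
  {s | (∃ n, s ∈ SPiece c α n) ∧ (level c α).psi s ∈ u}

/-- The members `X` of `R_α`; `idx n` is the number `k_n` such that the `n`-th tree of `X` lies
in `𝕋_α(k_n)`. It is determined by `X`. (All `𝕋_α(m)` contain the root `[]`, so meeting `𝕋_α(m)`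
means containing some node of it other than the root.) -/
structure RSpace where
  /-- the set of nodes of `X` -/
  carrier : Set (List ℕ)
  /-- the sequence `k_n` -/
  idx : ℕ → ℕ
  subset_tree : carrier ⊆ TTree c α
  strictMono : StrictMono idx
  meets_iff : ∀ m, (∃ t ∈ carrier ∩ TPiece c α m, t ≠ []) ↔ ∃ n, m = idx n
  iso : ∀ n, Isomorphic (SPiece c α n) (psiPreimage c α (carrier ∩ TPiece c α (idx n)))

variable {c α}

/-- `X(n)`, the `n`-th tree of `X`. -/
def RSpace.tree (X : RSpace c α) (n : ℕ) : Set (List ℕ) := X.carrier ∩ TPiece c α (X.idx n)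

variable (c α)

/-- `R_α(n) = {X(n) | X ∈ R_α}`. -/
def RTrees (n : ℕ) : Set (Set (List ℕ)) := {u | ∃ X : RSpace c α, u = X.tree n}

/-- `R_α(n)|x`, the members of `R_α(n)` that are contained in `x`. -/
def RTreesIn (n : ℕ) (x : Set (List ℕ)) : Set (Set (List ℕ)) := {u | u ∈ RTrees c α n ∧ u ⊆ x}

/-! ## Canonical equivalence relations -/

/-- A downward closed set of nodes in `𝕊_α`: it contains the empty node, and with `s` of
domain `[β, α]` all the restrictions `s ↾ [γ, α]`, `β ≤ γ ≤ α`. -/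
def IsDownClosed (S : Set Node) : Prop :=
  Node.empty ∈ S ∧ ∀ s ∈ S, ∀ β, s.dom = Icc β α →
    ∀ γ ∈ Icc β α, s.restrict (Icc γ α) ∈ S

/-- The collection of the downward closed subsets of `𝕊_α(n)`. -/
def downSets (n : ℕ) : Set (Set Node) := {S | S ⊆ SPiece c α n ∧ IsDownClosed α S}

/-- The collection of those downward closed `S ⊆ 𝕊_α(n)` that are isomorphic to `ψ_α⁻¹(v)` for a
nonempty subtree `v` of some `u ∈ R_α(n)|𝕋_α(m)`. -/
def downSetsIn (n m : ℕ) : Set (Set Node) :=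
  {S | S ∈ downSets c α n ∧ ∃ u ∈ RTreesIn c α n (TPiece c α m), ∃ v ⊆ u, v.Nonempty ∧
    (∀ t ∈ v, ∀ t', t' <+: t → t' ∈ v) ∧ Isomorphic S (psiPreimage c α v)}

open Classical in
/-- The isomorphism `ι_u` from `𝕊_α(n)` to `ψ_α⁻¹(u)`, for `u ∈ R_α(n)`. -/
def iota (n : ℕ) (u : Set (List ℕ)) : Node → Node :=
  if h : Isomorphic (SPiece c α n) (psiPreimage c α u) then h.choose else id

/-- The projection `π_S(u) = ψ_α(ι_u(S))`, for `u ∈ R_α(n)` and `S ⊆ 𝕊_α(n)`. -/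
def proj (n : ℕ) (S : Set Node) (u : Set (List ℕ)) : Set (List ℕ) :=
  (level c α).psi '' (iota c α n u '' S)

/-- For `y ∈ R_α(k)|x`, an equivalence relation `E` on `R_α(n)|x` is canonical on `R_α(n)|y`:
there it is the relation `π_S(u) = π_S(v)` for some `S` as in `downSetsIn n k`. -/
def IsCanonicalOn (n k : ℕ) {x : Set (List ℕ)} (E : Setoid (RTreesIn c α n x))
    (y : Set (List ℕ)) : Prop :=
  ∃ S ∈ downSetsIn c α n k, ∀ u v : RTreesIn c α n x, u.1 ⊆ y → v.1 ⊆ y →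
    (E u v ↔ proj c α n S u.1 = proj c α n S v.1)

end space

end RamseySpace

end

/-! ### Ramsey theory for increasing tuples of natural numbers -/

noncomputable section

namespace RamseySpace

open Set

/-! ## The finite Erdős–Rado canonization theorem -/

/-! Everything is reduced to maximal nodes, those with domain `[0, α]`. Two distinct maximal nodes
of a piece have a largest ordinal at which they differ, their splitting level. An isomorphism of
trees amounts to a map of maximal nodes that preserves the order and the splitting levels (`IsEmb`,
`extend_isIso`, `IsIso.isEmb`). So if `y` is a copy of `𝕊_α(k)`, the members of `R_α(n)` inside `y`
come from embeddings `w` of the finite set `Full c α n` in `Full c α k` (`exists_factor`).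

Only finitely many splitting levels occur in these two sets. Numbering the nodes on those levels
from the top down, and from left to right on each level, turns `w` into a strictly increasing
`v`-tuple with entries below some `N` (`exists_coding`). Conversely, the complete `t`-branching tree
that splits at those levels embeds in `𝕊_α(m)` for all large `m` (`exists_universal`, which rests on
`level_good_fits`). Hence every increasing `v`-tuple below `t` gives a copy of `𝕊_α(n)` in `X(m)`,
and an increasing `h` gives a copy `y` of `𝕊_α(k)` in which `w` appears as the copy with tuple `h ∘
code w`. Relations and colourings of copies become relations and colourings of tuples. The finite
Erdős–Rado theorem (`finite_erdos_rado`) makes equivalence inside a suitable `y` the same as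
agreement of the codes on a set `I` of coordinates; `finite_ramsey_two` settles the colourings.

It remains to turn `I` into a set `S` of nodes. Take for `S` the nodes at which embeddings agreeing
on `I` are forced to agree (`determined`). Then agreement on `S` is agreement on `I`, and `π_S`
detects exactly this: `ψ` identifies only nodes through which the same maximal nodes pass, and a
leftmost disagreement would be visible in the projection (`agree_of_psi_image_eq`). Finally `S`
belongs to `𝔖_α(n,k)`, as one sees from a generic embedding, which splits wherever any embedding
does (`full_mergeable`, `exists_generic`): under it the image of `S` is a full `ψ`-preimage. -/

theorem exists_eventually_eq_of_finite {C : Type*} [Finite C] (U : Ultrafilter ℕ) (f : ℕ → C) :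
    ∃ c, ∀ᶠ n in U, f n = c := by
  have h : (⋃ c ∈ (univ : Set C), {n | f n = c}) ∈ U := by
    have : (⋃ c ∈ (univ : Set C), {n | f n = c}) = univ := by
      ext n; simp
    rw [this]; exact Filter.univ_mem
  obtain ⟨c, -, hc⟩ := (Ultrafilter.finite_biUnion_mem_iff (finite_univ)).1 h
  exact ⟨c, hc⟩

/-- The infinite Ramsey theorem. -/
theorem exists_homogeneous {C : Type*} [Finite C] (v : ℕ) (χ : Finset ℕ → C) :
    ∃ h : ℕ → ℕ, StrictMono h ∧ ∃ c, ∀ s : Finset ℕ, s.card = v → χ (s.image h) = c := by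
  classical
  choose lim hlim using fun f : ℕ → C =>
    exists_eventually_eq_of_finite (Filter.hyperfilter ℕ) f
  -- The colouring is carried down to smaller sets: for fewer than `v` elements, the colour of `s`
  -- is the one that `insert n s` has for almost all `n` with respect to a nonprincipal ultrafilter.
  -- The homogeneous colour will be that of `∅`.
  let colr : ℕ → Finset ℕ → C := fun k =>
    Nat.rec χ (fun _ g s => lim fun n => g (insert n s)) k
  let col : Finset ℕ → C := fun s => colr (v - s.card) s
  have hcol : ∀ s : Finset ℕ, s.card < v →
      ∀ᶠ n in (Filter.hyperfilter ℕ : Filter ℕ), col (insert n s) = col s := by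
    intro s hs
    obtain ⟨k, hk⟩ : ∃ k, v - s.card = k + 1 := ⟨v - s.card - 1, by omega⟩
    have h1 := hlim fun n => colr k (insert n s)
    have h2 : ∀ᶠ n in (Filter.hyperfilter ℕ : Filter ℕ), n ∉ s :=
      Filter.compl_mem_hyperfilter_of_finite s.finite_toSet
    filter_upwards [h1, h2] with n hn hns
    have : v - (insert n s).card = k := by rw [Finset.card_insert_of_notMem hns]; omega
    simp only [col, this, hk]
    exact hn
  -- Finitely many subsets of `A` each exclude only a null set of `n`, so some new point beyond `A`
  -- keeps the colours of all of them.
  have hnext : ∀ A : Finset ℕ, ∃ n, (∀ x ∈ A, x < n) ∧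
      ∀ s ⊆ A, s.card < v → col (insert n s) = col s := by
    intro A
    have h1 : ∀ᶠ n in (Filter.hyperfilter ℕ : Filter ℕ), ∀ s ∈ A.powerset, s.card < v →
        col (insert n s) = col s := by
      rw [Filter.eventually_all_finset]
      intro s _
      by_cases hs : s.card < v
      · filter_upwards [hcol s hs] with n hn _ using hn
      · exact Filter.Eventually.of_forall fun n h => absurd h hs
    have h2 : ∀ᶠ n in (Filter.hyperfilter ℕ : Filter ℕ), ∀ x ∈ A, x < n := by
      rw [Filter.eventually_all_finset]
      intro x _
      exact Nat.hyperfilter_le_atTop (Filter.eventually_gt_atTop x)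
    obtain ⟨n, hn1, hn2⟩ := (h1.and h2).exists
    exact ⟨n, hn2, fun s hs => hn1 s (Finset.mem_powerset.2 hs)⟩
  choose next hlt hext using hnext
  let A : ℕ → Finset ℕ := fun i => Nat.rec ∅ (fun _ B => insert (next B) B) i
  have hA : ∀ i j, i < j → next (A i) ∈ A j := by
    intro i j hij
    induction j, hij using Nat.le_induction with
    | base => exact Finset.mem_insert_self _ _
    | succ j _ ih => exact Finset.mem_insert_of_mem ih
  refine ⟨fun i => next (A i), fun i j hij => hlt _ _ (hA i j hij), col ∅, ?_⟩
  have key : ∀ s : Finset ℕ, s.card ≤ v → col (s.image fun i => next (A i)) = col ∅ := by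
    intro s
    induction s using Finset.induction_on_max with
    | empty => simp
    | insert i s hi ih =>
      intro hs
      have his : i ∉ s := fun h => lt_irrefl _ (hi i h)
      rw [Finset.card_insert_of_notMem his] at hs
      rw [Finset.image_insert, hext, ih (by omega)]
      · intro x hx
        obtain ⟨j, hj, rfl⟩ := Finset.mem_image.1 hx
        exact hA j i (hi j hj)
      · exact lt_of_le_of_lt Finset.card_image_le (by omega)
  intro s hs
  have hinj : Function.Injective fun i => next (A i) :=
    (show StrictMono fun i => next (A i) from fun i j hij => hlt _ _ (hA i j hij)).injective
  have := key s hs.le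
  have hc : (s.image fun i => next (A i)).card = v := by
    rw [Finset.card_image_of_injective _ hinj, hs]
  simp only [col, hc, Nat.sub_self] at this
  exact this

/-- Colour a `2v`-set by the pattern of `E` between all `v`-tuples of its elements, monotone or not.
Two `v`-tuples use at most `2v` values, so on a homogeneous set `E` depends only on their relative
position. -/
theorem exists_invariant_subsequence {v : ℕ} (E : Setoid (Fin v → ℕ)) :
    ∃ h : ℕ → ℕ, StrictMono h ∧ ∀ φ : ℕ → ℕ, StrictMono φ → ∀ a b : Fin v → ℕ,
      E (h ∘ a) (h ∘ b) ↔ E (h ∘ φ ∘ a) (h ∘ φ ∘ b) := by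
  classical
  let χ : Finset ℕ → ((Fin v → Fin (2 * v)) → (Fin v → Fin (2 * v)) → Prop) := fun Z p q =>
    if hZ : Z.card = 2 * v then
      E (fun i => Z.orderEmbOfFin hZ (p i)) (fun i => Z.orderEmbOfFin hZ (q i))
    else True
  obtain ⟨h, hh, c, hc⟩ := exists_homogeneous (2 * v) χ
  have hχ : ∀ (W : Finset ℕ) (hW : W.card = 2 * v) (φ : ℕ → ℕ), StrictMono φ → ∀ p q,
      (c p q ↔ E (fun i => h (φ (W.orderEmbOfFin hW (p i))))
        (fun i => h (φ (W.orderEmbOfFin hW (q i))))) := by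
    intro W hW φ hφ p q
    have hW' : (W.image φ).card = 2 * v := by rw [Finset.card_image_of_injective _ hφ.injective, hW]
    have h2 : ((W.image φ).image h).card = 2 * v := by
      rw [Finset.card_image_of_injective _ hh.injective, hW']
    have he : (fun x => h (φ (W.orderEmbOfFin hW x))) =
        ((W.image φ).image h).orderEmbOfFin h2 := by
      apply Finset.orderEmbOfFin_unique
      · intro x
        exact Finset.mem_image_of_mem _ (Finset.mem_image_of_mem _ (Finset.orderEmbOfFin_mem ..))
      · exact hh.comp (hφ.comp (OrderEmbedding.strictMono _))
    have he' := fun x => congrFun he x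
    simp only [he']
    rw [← hc _ hW']
    simp only [χ, dif_pos h2]
  refine ⟨h, hh, fun φ hφ a b => ?_⟩
  obtain ⟨W, hRW, hW⟩ := Infinite.exists_superset_card_eq
    (Finset.univ.image a ∪ Finset.univ.image b) (2 * v) (by
      refine (Finset.card_union_le _ _).trans ?_
      have h1 := Finset.card_image_le (s := (Finset.univ : Finset (Fin v))) (f := a)
      have h2 := Finset.card_image_le (s := (Finset.univ : Finset (Fin v))) (f := b)
      simp only [Finset.card_univ, Fintype.card_fin] at h1 h2
      omega)
  have hrange : ∀ x ∈ W, ∃ i, W.orderEmbOfFin hW i = x := by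
    intro x hx
    have : x ∈ Set.range (W.orderEmbOfFin hW) := by
      rw [Finset.range_orderEmbOfFin]; exact hx
    exact this
  have ha : ∀ i, ∃ p, W.orderEmbOfFin hW p = a i := fun i =>
    hrange _ (hRW (Finset.mem_union_left _ (Finset.mem_image_of_mem _ (Finset.mem_univ i))))
  have hb : ∀ i, ∃ p, W.orderEmbOfFin hW p = b i := fun i =>
    hrange _ (hRW (Finset.mem_union_right _ (Finset.mem_image_of_mem _ (Finset.mem_univ i))))
  choose p hp using ha
  choose q hq using hb
  have h1 := hχ W hW id strictMono_id p q
  have h2 := hχ W hW φ hφ p q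
  simp only [hp, hq, id] at h1 h2
  exact h1.symm.trans h2

theorem exists_strictMono_extension {w : ℕ} (c : Fin w → ℕ) (hc : StrictMono c) :
    ∃ φ : ℕ → ℕ, StrictMono φ ∧ ∀ i : Fin w, φ i = c i := by
  refine ⟨fun x => if h : x < w then c ⟨x, h⟩ else x + ∑ i, c i, ?_, fun i => by simp⟩
  intro x y hxy
  by_cases hy : y < w
  · have hx : x < w := hxy.trans hy
    simp only [hx, hy, dif_pos]
    exact hc hxy
  · by_cases hx : x < w
    · simp only [hx, hy, dif_pos, dif_neg, not_false_iff]
      have := Finset.single_le_sum (f := c) (fun i _ => Nat.zero_le _) (Finset.mem_univ ⟨x, hx⟩)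
      omega
    · simp only [hx, hy, dif_neg, not_false_iff]
      omega

/-- The `v + 1` values `a 0 < … < a i < b i < b (i+1) < …` form an increasing sequence; an
increasing map of `ℕ` extending it carries the standard pair to `(a, b)`. So for an invariant
relation all pairs that differ only at `i` behave alike. -/
theorem invariant_iff_standard_pair {v : ℕ} (E : Setoid (Fin v → ℕ))
    (inv : ∀ φ : ℕ → ℕ, StrictMono φ → ∀ a b : Fin v → ℕ, E a b ↔ E (φ ∘ a) (φ ∘ b))
    (i : Fin v) {a b : Fin v → ℕ} (ha : StrictMono a) (hb : StrictMono b)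
    (hab : ∀ j ≠ i, a j = b j) (hi : a i < b i) :
    E a b ↔ E (fun j => if j ≤ i then j else j + 1) (fun j => if j < i then j else j + 1) := by
  have hi' := i.2
  let c : Fin (v + 1) → ℕ := fun x => if h : x.1 ≤ i.1 then a ⟨x, by omega⟩
    else b ⟨x.1 - 1, by omega⟩
  have hc : StrictMono c := by
    intro x y hxy
    have hxy' : x.1 < y.1 := hxy
    by_cases hx : x.1 ≤ i.1 <;> by_cases hy : y.1 ≤ i.1
    · simp only [c, hx, hy, dif_pos]; exact ha hxy'
    · simp only [c, hx, hy, dif_pos, dif_neg, not_false_iff]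
      calc a ⟨x, _⟩ ≤ a i := ha.monotone hx
        _ < b i := hi
        _ ≤ _ := hb.monotone (by rw [Fin.le_def]; simp; omega)
    · omega
    · simp only [c, hx, hy, dif_neg, not_false_iff]
      exact hb (by rw [Fin.lt_def]; simp; omega)
  obtain ⟨φ, hφ, hφc⟩ := exists_strictMono_extension c hc
  rw [inv φ hφ (fun j => if j ≤ i then (j : ℕ) else j + 1)]
  have h1 : φ ∘ (fun j : Fin v => if j ≤ i then (j : ℕ) else j + 1) = a := by
    funext j
    simp only [Function.comp]
    by_cases hj : j ≤ i
    · have := hφc ⟨j.1, by omega⟩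
      simp only [hj, if_true]
      rw [this]; simp only [c]; rw [dif_pos (show j.1 ≤ i.1 from hj)]
    · have := hφc ⟨j.1 + 1, by omega⟩
      simp only [hj, if_false]
      rw [this]; simp only [c]
      have hj' : ¬ j.1 ≤ i.1 := hj
      rw [dif_neg (by omega)]
      simp only [Nat.add_sub_cancel]
      exact (hab j (by rintro rfl; exact hj le_rfl)).symm
  have h2 : φ ∘ (fun j : Fin v => if j < i then (j : ℕ) else j + 1) = b := by
    funext j
    simp only [Function.comp]
    by_cases hj : j < i
    · have := hφc ⟨j.1, by omega⟩
      simp only [hj, if_true]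
      rw [this]; simp only [c]; rw [dif_pos (show j.1 ≤ i.1 from hj.le)]
      exact hab j hj.ne
    · have := hφc ⟨j.1 + 1, by omega⟩
      simp only [hj, if_false]
      rw [this]; simp only [c]
      have hj' : ¬ j.1 < i.1 := hj
      rw [dif_neg (by omega)]
      simp only [Nat.add_sub_cancel]
  rw [h1, h2]

/-- A coordinate is free (`std`) if changing it alone does not leave the class. Changing free
coordinates one at a time shows that they never matter; the remaining ones are shown to be
determined by the class. -/
theorem canonical_of_invariant {v : ℕ} (E : Setoid (Fin v → ℕ))
    (inv : ∀ φ : ℕ → ℕ, StrictMono φ → ∀ a b : Fin v → ℕ, E a b ↔ E (φ ∘ a) (φ ∘ b)) :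
    ∃ I : Set (Fin v), ∀ a b : Fin v → ℕ, StrictMono a → StrictMono b →
      (E a b ↔ ∀ i ∈ I, a i = b i) := by
  classical
  let std : Fin v → Prop := fun i =>
    E (fun j => if j ≤ i then (j : ℕ) else j + 1) (fun j => if j < i then (j : ℕ) else j + 1)
  have hstd : ∀ (i : Fin v) (a b : Fin v → ℕ), StrictMono a → StrictMono b →
      (∀ j ≠ i, a j = b j) → a i ≠ b i → (E a b ↔ std i) := by
    intro i a b ha hb hab hi
    rcases lt_or_gt_of_ne hi with h | h
    · exact invariant_iff_standard_pair E inv i ha hb hab h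
    · exact (show E a b ↔ E b a from ⟨fun h => E.symm' h, fun h => E.symm' h⟩).trans
        (invariant_iff_standard_pair E inv i hb ha (fun j hj => (hab j hj).symm) h)
  have hle : ∀ a b : Fin v → ℕ, StrictMono a → StrictMono b → (∀ i, a i ≤ b i) →
      (∀ i, ¬ std i → a i = b i) → E a b := by
    intro a b ha hb hab hI
    -- Because `a ≤ b`, the mixed tuple with its first `j` entries from `a` is still increasing, and
    -- passing from `j` to `j + 1` changes only one coordinate.
    have key : ∀ j ≤ v, E (fun x => if x.1 < j then a x else b x) b := by
      intro j
      induction j with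
      | zero => simp
      | succ j ih =>
        intro hj
        refine E.trans' ?_ (ih (by omega))
        have hm : ∀ j : ℕ, StrictMono (fun x : Fin v => if x.1 < j then a x else b x) := by
          intro j x y hxy
          have hxy' : x.1 < y.1 := hxy
          by_cases hx : x.1 < j <;> by_cases hy : y.1 < j <;> simp only [hx, hy, if_true, if_false]
          · exact ha hxy
          · exact (hab x).trans_lt (hb hxy)
          · omega
          · exact hb hxy
        by_cases he : a ⟨j, by omega⟩ = b ⟨j, by omega⟩
        · convert E.refl' _ using 1
          funext x
          by_cases hx : x.1 < j
          · simp [hx, Nat.lt_succ_of_lt hx]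
          · by_cases hx' : x.1 = j
            · subst hx'
              simpa using he.symm
            · simp [hx, show ¬ x.1 < j + 1 by omega]
        · refine (hstd ⟨j, by omega⟩ _ _ (hm _) (hm _) ?_ ?_).2 (by_contra fun h => he (hI _ h))
          · intro x hx
            have hx' : x.1 ≠ j := fun h => hx (Fin.ext h)
            by_cases h : x.1 < j
            · simp [h, Nat.lt_succ_of_lt h]
            · simp [h, show ¬ x.1 < j + 1 by omega]
          · simpa using he
    have := key v le_rfl
    convert this using 1
    funext x
    simp
  have hfree : ∀ a b : Fin v → ℕ, StrictMono a → StrictMono b →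
      (∀ i, ¬ std i → a i = b i) → E a b := by
    intro a b ha hb hI
    have hm : StrictMono (fun i => max (a i) (b i)) := fun i j hij =>
      max_lt_max (ha hij) (hb hij)
    refine E.trans' (hle a _ ha hm (fun i => le_max_left _ _) fun i hi => ?_)
      (E.symm' (hle b _ hb hm (fun i => le_max_right _ _) fun i hi => ?_))
    · simp [hI i hi]
    · simp [hI i hi]
  refine ⟨{i | ¬ std i}, fun a b ha hb => ⟨fun hE => ?_, hfree a b ha hb⟩⟩
  have main : ∀ a b : Fin v → ℕ, StrictMono a → StrictMono b → E a b →
      ∀ i, ¬ std i → b i ≤ a i := by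
    intro a b ha hb hE i
    induction i using WellFoundedLT.induction with
    | ind i ih =>
    intro hi
    by_contra! hlt
    have hdbl : StrictMono fun x : ℕ => 2 * x := fun x y h => by simp only; omega
    -- After doubling there is room to move the free coordinates of `b` to odd numbers. By induction
    -- the non-free ones cannot hit `2 * a i` either, so `b'` omits that value.
    let b' : Fin v → ℕ := fun j => 2 * b j + if std j then 1 else 0
    have hb' : StrictMono b' := by
      intro x y hxy
      have := hb hxy
      simp only [b']
      split_ifs <;> omega
    have hEb : E (fun j => 2 * a j) b' := by
      refine E.trans' ((inv _ hdbl a b).1 hE) (hfree _ _ (hdbl.comp hb) hb' fun j hj => ?_)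
      simp [b', hj]
    have hne : ∀ j, b' j ≠ 2 * a i := by
      intro j hj
      have hjs : ¬ std j := by
        intro h
        simp only [b', h, if_true] at hj
        omega
      simp only [b', hjs, if_false] at hj
      have hji : j < i := hb.lt_iff_lt.1 (by omega)
      have := ih j hji hjs
      have := ha hji
      omega
    -- This map and plain doubling agree on `b'` but separate the images of `2 * a` at coordinate
    -- `i` alone. Both images are equivalent to the same tuple, which makes `i` free, a
    -- contradiction.
    have hφ : StrictMono fun x : ℕ => 2 * x + if x = 2 * a i then 1 else 0 := by
      intro x y h
      simp only
      split_ifs <;> omega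
    have h1 := (inv _ hφ _ _).1 hEb
    have h2 := (inv _ hdbl _ _).1 hEb
    have h3 : (fun x : ℕ => 2 * x + if x = 2 * a i then 1 else 0) ∘ b' = (fun x => 2 * x) ∘ b' := by
      funext j
      simp [hne j]
    rw [h3] at h1
    refine hi ((hstd i _ _ ?_ ?_ ?_ ?_).1 (E.trans' h1 (E.symm' h2)))
    · exact hφ.comp (hdbl.comp ha)
    · exact hdbl.comp (hdbl.comp ha)
    · intro j hj
      have : a j ≠ a i := fun h => hj (ha.injective h)
      simp [this]
    · simp
  intro i hi
  exact le_antisymm (main b a hb ha (E.symm' hE) i hi) (main a b ha hb hE i hi)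

/-- The finite Erdős–Rado canonization theorem, for increasing `v`-tuples. -/
theorem finite_erdos_rado (v N : ℕ) : ∃ t : ℕ, ∀ E : Setoid (Fin v → ℕ), ∃ h : ℕ → ℕ,
    StrictMono h ∧ (∀ x < N, h x < t) ∧ ∃ I : Set (Fin v), ∀ a b : Fin v → ℕ,
      StrictMono a → StrictMono b → (∀ i, a i < N) → (∀ i, b i < N) →
        (E (h ∘ a) (h ∘ b) ↔ ∀ i ∈ I, a i = b i) := by
  by_contra! hcon
  choose E hE using hcon
  -- Compactness: counterexamples for all `t` are replaced by their ultrafilter limit. The infinite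
  -- theorem applies to it, and only finitely many tuples below `N` have to be compared with some
  -- single `E t`.
  let F : Setoid (Fin v → ℕ) :=
    { r := fun a b => ∀ᶠ t in (Filter.hyperfilter ℕ : Filter ℕ), E t a b
      iseqv :=
        { refl := fun a => Filter.Eventually.of_forall fun t => (E t).refl' a
          symm := fun h => h.mono fun t ht => (E t).symm' ht
          trans := fun h h' => (h.and h').mono fun t ht => (E t).trans' ht.1 ht.2 } }
  obtain ⟨g, hg, hinv⟩ := exists_invariant_subsequence F
  let F' : Setoid (Fin v → ℕ) := F.comap fun a => g ∘ a
  obtain ⟨I, hI⟩ := canonical_of_invariant F' fun φ hφ a b => hinv φ hφ a b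
  have h1 : ∀ᶠ t in (Filter.hyperfilter ℕ : Filter ℕ), ∀ a b : Fin v → Fin N,
      (E t (g ∘ fun i => (a i : ℕ)) (g ∘ fun i => (b i : ℕ)) ↔
        F (g ∘ fun i => (a i : ℕ)) (g ∘ fun i => (b i : ℕ))) := by
    rw [Filter.eventually_all]
    intro a
    rw [Filter.eventually_all]
    intro b
    by_cases h : F (g ∘ fun i => (a i : ℕ)) (g ∘ fun i => (b i : ℕ))
    · have h' : ∀ᶠ t in (Filter.hyperfilter ℕ : Filter ℕ),
        E t (g ∘ fun i => (a i : ℕ)) (g ∘ fun i => (b i : ℕ)) := h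
      filter_upwards [h'] with t ht
      exact iff_of_true ht h
    · have h' : ∀ᶠ t in (Filter.hyperfilter ℕ : Filter ℕ),
        ¬ E t (g ∘ fun i => (a i : ℕ)) (g ∘ fun i => (b i : ℕ)) :=
        Ultrafilter.eventually_not.2 h
      filter_upwards [h'] with t ht
      exact iff_of_false ht h
  have h2 : ∀ᶠ t in (Filter.hyperfilter ℕ : Filter ℕ), g N < t :=
    Nat.hyperfilter_le_atTop (Filter.eventually_gt_atTop _)
  obtain ⟨t, ht1, ht2⟩ := (h1.and h2).exists
  obtain ⟨a, b, ha, hb, haN, hbN, hab⟩ := hE t g hg (fun x hx => (hg hx).trans ht2) I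
  have h3 := ht1 (fun i => ⟨a i, haN i⟩) (fun i => ⟨b i, hbN i⟩)
  have h4 := hI a b ha hb
  have h5 : E t (g ∘ a) (g ∘ b) ↔ F (g ∘ a) (g ∘ b) := h3
  have h6 : F (g ∘ a) (g ∘ b) ↔ ∀ i ∈ I, a i = b i := h4
  have h7 := h5.trans h6
  rcases hab with ⟨x, i, hi, y⟩ | ⟨x, y⟩
  · exact y (h7.1 x i hi)
  · exact x (h7.2 y)

/-- The finite Ramsey theorem for two colours, for increasing `v`-tuples. -/
theorem finite_ramsey_two (v N : ℕ) : ∃ t : ℕ, ∀ f : (Fin v → ℕ) → Fin 2, ∃ h : ℕ → ℕ,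
    StrictMono h ∧ (∀ x < N, h x < t) ∧ ∀ a b : Fin v → ℕ,
      StrictMono a → StrictMono b → (∀ i, a i < N) → (∀ i, b i < N) → f (h ∘ a) = f (h ∘ b) := by
  obtain ⟨t, ht⟩ := finite_erdos_rado v (max N (v + 2))
  refine ⟨t, fun f => ?_⟩
  obtain ⟨h, hh, hN, I, hI⟩ := ht (Setoid.ker f)
  refine ⟨h, hh, fun x hx => hN x (lt_max_of_lt_left hx), fun a b ha hb haN hbN => ?_⟩
  refine (hI a b ha hb (fun i => lt_max_of_lt_left (haN i)) fun i => lt_max_of_lt_left (hbN i)).2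
    fun i hi => ?_
  exfalso
  -- If some coordinate `i` mattered, shifting the entries from `i` on by `0`, `1`, `2` would give
  -- three colours. These tuples have entries below `v + 2`, whence the bound above.
  let s : ℕ → Fin v → ℕ := fun x j => if j < i then j else j + x
  have hs : ∀ x, StrictMono (s x) := by
    intro x j l hjl
    have : j.1 < l.1 := hjl
    simp only [s]
    split_ifs with h1 h2 h2
    · exact hjl
    · omega
    · exact absurd (hjl.trans h2) h1
    · omega
  have hb : ∀ x ≤ 2, ∀ j, s x j < max N (v + 2) := by
    intro x hx j
    have := j.2
    apply lt_max_of_lt_right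
    simp only [s]
    split_ifs <;> omega
  have hne : ∀ x ≤ 2, ∀ y ≤ 2, x ≠ y → f (h ∘ s x) ≠ f (h ∘ s y) := by
    intro x hx y hy hxy he
    have := (hI (s x) (s y) (hs x) (hs y) (hb x hx) (hb y hy)).1 he i hi
    simp [s] at this
    exact hxy this
  have h01 := hne 0 (by omega) 1 (by omega) (by omega)
  have h02 := hne 0 (by omega) 2 (by omega) (by omega)
  have h12 := hne 1 (by omega) 2 (by omega) (by omega)
  omega

end RamseySpace

end

/-! ### Maximal nodes, splitting levels and abstract pieces -/

noncomputable section

namespace RamseySpace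

open Set

/-! ## Nodes with full domain -/

/-- `f` and `g` agree from `β` on. -/
def Agree (β : Ordinal.{0}) (f g : Node) : Prop := ∀ ξ, β ≤ ξ → f ξ = g ξ

/-- `δ` is the largest ordinal at which `f` and `g` differ, and `f δ < g δ`. -/
def LtAt (δ : Ordinal.{0}) (f g : Node) : Prop :=
  ∃ m n, f δ = some m ∧ g δ = some n ∧ m < n ∧ ∀ η, δ < η → f η = g η

/-- The restriction of `f` to `[β, ∞)`. -/
def Node.cut (β : Ordinal.{0}) (f : Node) : Node := f.restrict (Ici β)

/-- The function `g` on `[0, γ]`, continued by the constant `n` on `(γ, α]`. -/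
def glue (γ α : Ordinal.{0}) (n : ℕ) (g : Node) : Node := fun ξ =>
  if ξ ≤ γ then g ξ else if ξ ≤ α then some n else none

/-- The members of `S` with domain `[0, α]`. -/
def fullOf (α : Ordinal.{0}) (S : Set Node) : Set Node := {f | f ∈ S ∧ f.dom = Iic α}

theorem Agree.symm {β : Ordinal.{0}} {f g : Node} (h : Agree β f g) : Agree β g f :=
  fun ξ hξ => (h ξ hξ).symm

theorem Agree.trans {β : Ordinal.{0}} {f g h : Node} (h₁ : Agree β f g) (h₂ : Agree β g h) :
    Agree β f h := fun ξ hξ => (h₁ ξ hξ).trans (h₂ ξ hξ)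

theorem Agree.refl (β : Ordinal.{0}) (f : Node) : Agree β f f := fun _ _ => rfl

theorem Agree.mono {β β' : Ordinal.{0}} {f g : Node} (h : Agree β f g) (hβ : β ≤ β') :
    Agree β' f g := fun ξ hξ => h ξ (hβ.trans hξ)

theorem agree_zero_iff {f g : Node} : Agree 0 f g ↔ f = g :=
  ⟨fun h => funext fun ξ => h ξ zero_le, fun h => h ▸ Agree.refl _ _⟩

theorem LtAt.ne {δ : Ordinal.{0}} {f g : Node} (h : LtAt δ f g) : f δ ≠ g δ := by
  obtain ⟨m, n, hm, hn, hlt, -⟩ := h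
  rw [hm, hn]
  simpa using hlt.ne

theorem LtAt.agree {δ β : Ordinal.{0}} {f g : Node} (h : LtAt δ f g) (hβ : δ < β) :
    Agree β f g := by
  obtain ⟨m, n, hm, hn, hlt, h⟩ := h
  exact fun ξ hξ => h ξ (hβ.trans_le hξ)

theorem LtAt.not_agree {δ β : Ordinal.{0}} {f g : Node} (h : LtAt δ f g) (hβ : β ≤ δ) :
    ¬ Agree β f g := fun h' => h.ne (h' δ hβ)

theorem LtAt.irrefl {δ : Ordinal.{0}} {f : Node} : ¬ LtAt δ f f := fun h => h.ne rfl

theorem LtAt.agree_iff {δ β : Ordinal.{0}} {f g : Node} (h : LtAt δ f g) :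
    Agree β f g ↔ δ < β :=
  ⟨fun h' => not_le.1 fun hβ => h.not_agree hβ h', h.agree⟩

theorem LtAt.level_unique {δ ε : Ordinal.{0}} {f g : Node} (h : LtAt δ f g) (h' : LtAt ε f g) :
    δ = ε := by
  refine le_antisymm (not_lt.1 fun hlt => ?_) (not_lt.1 fun hlt => ?_)
  · exact h.ne (h'.agree hlt δ le_rfl)
  · exact h'.ne (h.agree hlt ε le_rfl)

theorem LtAt.level_unique' {δ ε : Ordinal.{0}} {f g : Node} (h : LtAt δ f g) (h' : LtAt ε g f) :
    δ = ε := by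
  refine le_antisymm (not_lt.1 fun hlt => ?_) (not_lt.1 fun hlt => ?_)
  · exact h.ne (h'.agree hlt δ le_rfl).symm
  · exact h'.ne (h.agree hlt ε le_rfl).symm

theorem LtAt.asymm {δ ε : Ordinal.{0}} {f g : Node} (h : LtAt δ f g) : ¬ LtAt ε g f := by
  intro h'
  obtain rfl := h.level_unique' h'
  obtain ⟨m, n, hm, hn, hlt, -⟩ := h
  obtain ⟨m', n', hm', hn', hlt', -⟩ := h'
  rw [hm] at hn'; rw [hn] at hm'
  simp only [Option.some.injEq] at hm' hn'
  omega

theorem LtAt.trans {δ ε : Ordinal.{0}} {f g h : Node} (h₁ : LtAt δ f g) (h₂ : LtAt ε g h) :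
    LtAt (max δ ε) f h := by
  obtain ⟨m, n, hm, hn, hlt, ha⟩ := h₁
  obtain ⟨m', n', hm', hn', hlt', ha'⟩ := h₂
  rcases lt_trichotomy δ ε with h | rfl | h
  · rw [max_eq_right h.le]
    exact ⟨m', n', by rw [ha _ h, hm'], hn', hlt', fun η hη => (ha η (h.trans hη)).trans (ha' η hη)⟩
  · rw [max_self]
    rw [hn] at hm'
    simp only [Option.some.injEq] at hm'
    exact ⟨m, n', hm, hn', by omega, fun η hη => (ha η hη).trans (ha' η hη)⟩
  · rw [max_eq_left h.le]
    exact ⟨m, n, hm, by rw [← ha' _ h, hn], hlt, fun η hη => (ha η hη).trans (ha' η (h.trans hη))⟩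

theorem mem_dom {s : Node} {ξ : Ordinal.{0}} : ξ ∈ s.dom ↔ s ξ ≠ none := Iff.rfl

theorem dom_empty : Node.empty.dom = ∅ := by
  ext ξ; simp [mem_dom, Node.empty]

theorem eq_empty_iff {s : Node} : s = Node.empty ↔ s.dom = ∅ := by
  refine ⟨fun h => h ▸ dom_empty, fun h => funext fun ξ => ?_⟩
  by_contra hne
  have : ξ ∈ s.dom := hne
  rw [h] at this
  exact this

theorem eq_none_of_dom {s : Node} {A : Set Ordinal.{0}} (hs : s.dom = A) {ξ : Ordinal.{0}}
    (h : ξ ∉ A) : s ξ = none := by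
  rw [← hs, mem_dom, not_not] at h; exact h

theorem ne_none_of_dom {s : Node} {A : Set Ordinal.{0}} (hs : s.dom = A) {ξ : Ordinal.{0}}
    (h : ξ ∈ A) : s ξ ≠ none := by
  rw [← hs, mem_dom] at h; exact h

theorem cut_apply_of_le {β ξ : Ordinal.{0}} (h : β ≤ ξ) (f : Node) : f.cut β ξ = f ξ := by
  simp [Node.cut, Node.restrict, h]

theorem cut_apply_of_lt {β ξ : Ordinal.{0}} (h : ξ < β) (f : Node) : f.cut β ξ = none := by
  simp [Node.cut, Node.restrict, h]

theorem sigma_apply_of_le {γ ξ : Ordinal.{0}} (h : ξ ≤ γ) (f : Node) : f.sigma γ ξ = f ξ := by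
  simp [Node.sigma, Node.restrict, h]

theorem sigma_apply_of_lt {γ ξ : Ordinal.{0}} (h : γ < ξ) (f : Node) : f.sigma γ ξ = none := by
  simp [Node.sigma, Node.restrict, h]

theorem dom_cut {α β : Ordinal.{0}} {f : Node} (hf : f.dom = Iic α) : (f.cut β).dom = Icc β α := by
  ext ξ
  rcases le_or_gt β ξ with h | h
  · rw [mem_dom, cut_apply_of_le h, ← mem_dom, hf]; simp [h]
  · rw [mem_dom, cut_apply_of_lt h]; simp [h]

theorem restrict_Icc {α β : Ordinal.{0}} {f : Node} (hf : f.dom = Iic α) :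
    f.restrict (Icc β α) = f.cut β := by
  funext ξ
  rcases le_or_gt β ξ with h | h
  · rw [cut_apply_of_le h]
    by_cases hξ : ξ ≤ α
    · simp [Node.restrict, h, hξ]
    · simp [Node.restrict, hξ, eq_none_of_dom hf hξ]
  · rw [cut_apply_of_lt h]; simp [Node.restrict, h]

theorem cut_zero (f : Node) : f.cut 0 = f := funext fun _ => cut_apply_of_le zero_le f

theorem cut_eq_iff {β : Ordinal.{0}} {f g : Node} : f.cut β = g.cut β ↔ Agree β f g := by
  refine ⟨fun h ξ hξ => ?_, fun h => funext fun ξ => ?_⟩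
  · rw [← cut_apply_of_le hξ f, h, cut_apply_of_le hξ]
  · rcases le_or_gt β ξ with h' | h'
    · rw [cut_apply_of_le h', cut_apply_of_le h', h ξ h']
    · rw [cut_apply_of_lt h', cut_apply_of_lt h']

theorem Icc_left_injective {α β β' : Ordinal.{0}} (hβ : β ≤ α) (hβ' : β' ≤ α)
    (h : Icc β α = Icc β' α) : β = β' := by
  have h1 : β ∈ Icc β' α := h ▸ left_mem_Icc.2 hβ
  have h2 : β' ∈ Icc β α := h ▸ left_mem_Icc.2 hβ'
  exact le_antisymm h2.1 h1.1

theorem cut_eq_cut_iff {α β β' : Ordinal.{0}} {f g : Node} (hf : f.dom = Iic α)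
    (hg : g.dom = Iic α) (hβ : β ≤ α) (hβ' : β' ≤ α) :
    f.cut β = g.cut β' ↔ β = β' ∧ Agree β f g := by
  refine ⟨fun h => ?_, ?_⟩
  · have : β = β' := Icc_left_injective hβ hβ' (by rw [← dom_cut hf, h, dom_cut hg])
    subst this
    exact ⟨rfl, cut_eq_iff.1 h⟩
  · rintro ⟨rfl, h⟩
    exact cut_eq_iff.2 h

theorem cut_ne_empty {α β : Ordinal.{0}} {f : Node} (hf : f.dom = Iic α) (hβ : β ≤ α) :
    f.cut β ≠ Node.empty := by
  rw [Ne, eq_empty_iff, dom_cut hf]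
  exact (nonempty_Icc.2 hβ).ne_empty

section glue

variable {γ α : Ordinal.{0}} {n : ℕ} {g h : Node}

theorem glue_apply_le {ξ : Ordinal.{0}} (hξ : ξ ≤ γ) : glue γ α n g ξ = g ξ := by
  simp [glue, hξ]

theorem glue_apply_mid {ξ : Ordinal.{0}} (h1 : γ < ξ) (h2 : ξ ≤ α) : glue γ α n g ξ = some n := by
  simp [glue, not_le.2 h1, h2]

theorem glue_apply_gt {ξ : Ordinal.{0}} (hγ : γ ≤ α) (hξ : α < ξ) : glue γ α n g ξ = none := by
  simp [glue, not_le.2 hξ, not_le.2 (hγ.trans_lt hξ)]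

theorem dom_glue (hγ : γ ≤ α) (hg : g.dom = Iic γ) : (glue γ α n g).dom = Iic α := by
  ext ξ
  rw [mem_dom]
  rcases le_or_gt ξ γ with h1 | h1
  · rw [glue_apply_le h1]
    exact iff_of_true (ne_none_of_dom hg h1) (h1.trans hγ)
  · rcases le_or_gt ξ α with h2 | h2
    · rw [glue_apply_mid h1 h2]; simp [h2]
    · rw [glue_apply_gt hγ h2]; simp [h2]

theorem sigma_cut_glue {β : Ordinal.{0}} (hg : g.dom = Iic γ) :
    ((glue γ α n g).cut β).sigma γ = g.cut β := by
  funext ξ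
  rcases le_or_gt ξ γ with h1 | h1
  · rw [sigma_apply_of_le h1]
    rcases le_or_gt β ξ with h2 | h2
    · rw [cut_apply_of_le h2, cut_apply_of_le h2, glue_apply_le h1]
    · rw [cut_apply_of_lt h2, cut_apply_of_lt h2]
  · rw [sigma_apply_of_lt h1]
    rcases le_or_gt β ξ with h2 | h2
    · rw [cut_apply_of_le h2, eq_none_of_dom hg (by simpa using h1)]
    · rw [cut_apply_of_lt h2]

theorem sigma_glue (hg : g.dom = Iic γ) : (glue γ α n g).sigma γ = g := by
  have := sigma_cut_glue (α := α) (n := n) (β := 0) hg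
  rwa [cut_zero, cut_zero] at this

theorem cut_of_gt {β : Ordinal.{0}} (hg : g.dom = Iic γ) (hβ : γ < β) :
    g.cut β = Node.empty := by
  rw [eq_empty_iff, dom_cut hg, Icc_eq_empty (not_le.2 hβ)]

theorem agree_glue_iff {β : Ordinal.{0}} (hg : g.dom = Iic γ) (hh : h.dom = Iic γ) :
    Agree β (glue γ α n g) (glue γ α n h) ↔ Agree β g h := by
  refine forall₂_congr fun ξ _ => ?_
  rcases le_or_gt ξ γ with h1 | h1
  · rw [glue_apply_le h1, glue_apply_le h1]
  · rw [eq_none_of_dom hg (by simpa using h1), eq_none_of_dom hh (by simpa using h1)]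
    simp [glue, not_le.2 h1]

theorem ltAt_glue_iff {δ : Ordinal.{0}} (hg : g.dom = Iic γ) (hh : h.dom = Iic γ) {n : ℕ} :
    LtAt δ (glue γ α n g) (glue γ α n h) ↔ LtAt δ g h := by
  have key : ∀ ξ, δ < ξ → (glue γ α n g ξ = glue γ α n h ξ ↔ g ξ = h ξ) := by
    intro ξ _
    rcases le_or_gt ξ γ with h1 | h1
    · rw [glue_apply_le h1, glue_apply_le h1]
    · rw [eq_none_of_dom hg (by simpa using h1), eq_none_of_dom hh (by simpa using h1)]
      simp [glue, not_le.2 h1]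
  rcases le_or_gt δ γ with h1 | h1
  · unfold LtAt
    rw [glue_apply_le h1, glue_apply_le h1]
    simp only [forall₂_congr key]
  · refine iff_of_false (fun h' => h'.ne ?_) (fun h' => h'.ne ?_)
    · simp [glue, not_le.2 h1]
    · rw [eq_none_of_dom hg (by simpa using h1), eq_none_of_dom hh (by simpa using h1)]

end glue

/-! ## The pieces of a level -/

/-- The properties of one piece `𝕊_α(n)` that concern its maximal nodes. -/
structure FullPiece (α : Ordinal.{0}) (n : ℕ) (S : Set Node) : Prop where
  mem_iff : ∀ s, s ∈ S ↔ s = Node.empty ∨ ∃ f ∈ fullOf α S, ∃ β ≤ α, s = f.cut β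
  nonempty : (fullOf α S).Nonempty
  finite : (fullOf α S).Finite
  top : ∀ f ∈ fullOf α S, f α = some n
  tri : ∀ f ∈ fullOf α S, ∀ g ∈ fullOf α S, f = g ∨ ∃ δ, LtAt δ f g ∨ LtAt δ g f

/-- The properties of the projection on one piece. -/
structure PsiPiece (α : Ordinal.{0}) (n : ℕ) (S : Set Node) (T : Set (List ℕ))
    (ψ : Node → List ℕ) : Prop where
  psi_empty : ψ Node.empty = []
  psi_head : ∀ f ∈ fullOf α S, ∀ β ≤ α, ∃ t, ψ (f.cut β) = n :: t
  psi_top : ∀ f ∈ fullOf α S, ψ (f.cut α) = [n]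
  -- The value of `ψ` at a nonempty node determines, and is determined by, the set of maximal nodes
  -- through it. All later arguments about `ψ` use this property instead of the recursion.
  psi_eq : ∀ f ∈ fullOf α S, ∀ g ∈ fullOf α S, ∀ β ≤ α, ∀ β' ≤ α,
    (ψ (f.cut β) = ψ (g.cut β') ↔ ∀ h ∈ fullOf α S, (Agree β h f ↔ Agree β' h g))
  psi_prefix : ∀ f ∈ fullOf α S, ∀ β ≤ α, ∀ t, t <+: ψ (f.cut β) → t ≠ [] →
    ∃ β', β ≤ β' ∧ β' ≤ α ∧ t = ψ (f.cut β')
  tree_eq : T = ψ '' S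

/-- A piece built from the pieces with index in `B` of a lower level. -/
structure StepPiece (γ α : Ordinal.{0}) (n : ℕ) (B : Set ℕ) (K : ℕ → Set Node) (S : Set Node) :
    Prop where
  lt : γ < α
  nonempty : B.Nonempty
  finite : B.Finite
  mem_iff : ∀ s, s ∈ S ↔ s = Node.empty ∨
    ∃ l ∈ B, ∃ g ∈ fullOf γ (K l), ∃ β ≤ α, s = (glue γ α n g).cut β

theorem StepPiece.mem_full_iff {γ α : Ordinal.{0}} {n : ℕ} {B : Set ℕ} {K : ℕ → Set Node}
    {S : Set Node} (h : StepPiece γ α n B K S) {f : Node} :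
    f ∈ fullOf α S ↔ ∃ l ∈ B, ∃ g ∈ fullOf γ (K l), f = glue γ α n g := by
  constructor
  · rintro ⟨hS, hd⟩
    rcases (h.mem_iff f).1 hS with rfl | ⟨l, hl, g, hg, β, hβ, rfl⟩
    · rw [dom_empty] at hd
      exact absurd hd.symm nonempty_Iic.ne_empty
    · refine ⟨l, hl, g, hg, ?_⟩
      have hb : β = 0 := by
        rw [dom_cut (dom_glue h.lt.le hg.2)] at hd
        have : (0 : Ordinal) ∈ Icc β α := hd ▸ mem_Iic.2 zero_le
        exact le_antisymm this.1 zero_le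
      rw [hb, cut_zero]
  · rintro ⟨l, hl, g, hg, rfl⟩
    exact ⟨(h.mem_iff _).2 (Or.inr ⟨l, hl, g, hg, 0, zero_le, (cut_zero _).symm⟩),
      dom_glue h.lt.le hg.2⟩

theorem ltAt_of_top_lt {γ : Ordinal.{0}} {l l' : ℕ} {g g' : Node} (hg : g.dom = Iic γ)
    (hg' : g'.dom = Iic γ) (h : g γ = some l) (h' : g' γ = some l') (hlt : l < l') :
    LtAt γ g g' :=
  ⟨l, l', h, h', hlt, fun η hη => by
    rw [eq_none_of_dom hg (by simpa using hη), eq_none_of_dom hg' (by simpa using hη)]⟩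

/-- The value at `γ` is the index of the lower piece. So nodes from different pieces split at `γ`,
while nodes from the same piece split where they did before gluing. -/
theorem StepPiece.fullPiece {γ α : Ordinal.{0}} {n : ℕ} {B : Set ℕ} {K : ℕ → Set Node}
    {S : Set Node} (h : StepPiece γ α n B K S) (hK : ∀ l ∈ B, FullPiece γ l (K l)) :
    FullPiece α n S where
  mem_iff s := by
    rw [h.mem_iff]
    refine or_congr Iff.rfl ⟨?_, ?_⟩
    · rintro ⟨l, hl, g, hg, β, hβ, rfl⟩
      exact ⟨_, h.mem_full_iff.2 ⟨l, hl, g, hg, rfl⟩, β, hβ, rfl⟩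
    · rintro ⟨f, hf, β, hβ, rfl⟩
      obtain ⟨l, hl, g, hg, rfl⟩ := h.mem_full_iff.1 hf
      exact ⟨l, hl, g, hg, β, hβ, rfl⟩
  nonempty := by
    obtain ⟨l, hl⟩ := h.nonempty
    obtain ⟨g, hg⟩ := (hK l hl).nonempty
    exact ⟨_, h.mem_full_iff.2 ⟨l, hl, g, hg, rfl⟩⟩
  finite := by
    have : fullOf α S = ⋃ l ∈ B, glue γ α n '' fullOf γ (K l) := by
      ext f
      rw [h.mem_full_iff]
      simp only [mem_iUnion, mem_image, exists_prop, eq_comm]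
    rw [this]
    exact h.finite.biUnion fun l hl => (hK l hl).finite.image _
  top f hf := by
    obtain ⟨l, hl, g, hg, rfl⟩ := h.mem_full_iff.1 hf
    exact glue_apply_mid h.lt le_rfl
  tri f hf f' hf' := by
    obtain ⟨l, hl, g, hg, rfl⟩ := h.mem_full_iff.1 hf
    obtain ⟨l', hl', g', hg', rfl⟩ := h.mem_full_iff.1 hf'
    have h1 := (hK l hl).top g hg
    have h2 := (hK l' hl').top g' hg'
    rcases lt_trichotomy l l' with hll | rfl | hll
    · exact Or.inr ⟨γ, Or.inl ((ltAt_glue_iff hg.2 hg'.2).2 (ltAt_of_top_lt hg.2 hg'.2 h1 h2 hll))⟩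
    · rcases (hK l hl).tri g hg g' hg' with rfl | ⟨δ, h | h⟩
      · exact Or.inl rfl
      · exact Or.inr ⟨δ, Or.inl ((ltAt_glue_iff hg.2 hg'.2).2 h)⟩
      · exact Or.inr ⟨δ, Or.inr ((ltAt_glue_iff hg'.2 hg.2).2 h)⟩
    · exact Or.inr ⟨γ, Or.inr ((ltAt_glue_iff hg'.2 hg.2).2 (ltAt_of_top_lt hg'.2 hg.2 h2 h1 hll))⟩

theorem agree_of_top {γ : Ordinal.{0}} {f g : Node} (hf : f.dom = Iic γ) (hg : g.dom = Iic γ)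
    (h : f γ = g γ) {β : Ordinal.{0}} (hβ : γ ≤ β) : Agree β f g := by
  intro ξ hξ
  rcases (hβ.trans hξ).eq_or_lt with rfl | hlt
  · exact h
  · rw [eq_none_of_dom hf (by simpa using hlt), eq_none_of_dom hg (by simpa using hlt)]

/-- The projection on a piece that is copied from a single piece of a lower level. -/
theorem StepPiece.psiPiece_relabel {γ α : Ordinal.{0}} {n p : ℕ} {K : ℕ → Set Node}
    {S : Set Node} {T' T : Set (List ℕ)} {ψ' ψ : Node → List ℕ}
    (h : StepPiece γ α n {p} K S) (hK : FullPiece γ p (K p)) (hψ' : PsiPiece γ p (K p) T' ψ')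
    (h0 : ψ Node.empty = [])
    (hψ : ∀ g ∈ fullOf γ (K p), ∀ β ≤ α, ψ ((glue γ α n g).cut β) = n :: (ψ' (g.cut β)).tail)
    (hT : T = {t | t = [] ∨ ∃ x t', x :: t' ∈ T' ∧ t = n :: t'}) :
    PsiPiece α n S T ψ := by
  have hfull : ∀ f, f ∈ fullOf α S ↔ ∃ g ∈ fullOf γ (K p), f = glue γ α n g := by
    intro f; rw [h.mem_full_iff]; simp
  -- A piece copied from a single one does not branch above `γ`, so cutting above `γ` has the same
  -- projection as cutting at `γ`. Replacing `β` by `min β γ` reduces everything to the lower level.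
  have hmin : ∀ g ∈ fullOf γ (K p), ∀ β ≤ α, ψ ((glue γ α n g).cut β) =
      n :: (ψ' (g.cut (min β γ))).tail := by
    intro g hg β hβ
    rw [hψ g hg β hβ]
    rcases le_or_gt β γ with hβγ | hβγ
    · rw [min_eq_left hβγ]
    · rw [min_eq_right hβγ.le, hψ'.psi_top g hg, cut_of_gt hg.2 hβγ, hψ'.psi_empty]
      rfl
  have hagr : ∀ g ∈ fullOf γ (K p), ∀ g' ∈ fullOf γ (K p), ∀ β,
      (Agree β (glue γ α n g) (glue γ α n g') ↔ Agree (min β γ) g g') := by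
    intro g hg g' hg' β
    rw [agree_glue_iff hg.2 hg'.2]
    rcases le_or_gt β γ with hβγ | hβγ
    · rw [min_eq_left hβγ]
    · have ht : g γ = g' γ := by rw [hK.top g hg, hK.top g' hg']
      rw [min_eq_right hβγ.le]
      exact iff_of_true (agree_of_top hg.2 hg'.2 ht hβγ.le) (agree_of_top hg.2 hg'.2 ht le_rfl)
  refine ⟨h0, ?_, ?_, ?_, ?_, ?_⟩
  · intro f hf β hβ
    obtain ⟨g, hg, rfl⟩ := (hfull f).1 hf
    exact ⟨_, hψ g hg β hβ⟩
  · intro f hf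
    obtain ⟨g, hg, rfl⟩ := (hfull f).1 hf
    rw [hψ g hg α le_rfl, cut_of_gt hg.2 h.lt, hψ'.psi_empty]; rfl
  · intro f hf f' hf' β hβ β' hβ'
    obtain ⟨g, hg, rfl⟩ := (hfull f).1 hf
    obtain ⟨g', hg', rfl⟩ := (hfull f').1 hf'
    rw [hmin g hg β hβ, hmin g' hg' β' hβ']
    have e1 : (n :: (ψ' (g.cut (min β γ))).tail = n :: (ψ' (g'.cut (min β' γ))).tail) ↔
        ψ' (g.cut (min β γ)) = ψ' (g'.cut (min β' γ)) := by
      obtain ⟨t, ht⟩ := hψ'.psi_head g hg _ (min_le_right β γ)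
      obtain ⟨t', ht'⟩ := hψ'.psi_head g' hg' _ (min_le_right β' γ)
      rw [ht, ht']; simp
    rw [e1, hψ'.psi_eq g hg g' hg' _ (min_le_right _ _) _ (min_le_right _ _)]
    constructor
    · intro hh f hf
      obtain ⟨k, hk, rfl⟩ := (hfull f).1 hf
      rw [hagr k hk g hg, hagr k hk g' hg']
      exact hh k hk
    · intro hh k hk
      rw [← hagr k hk g hg, ← hagr k hk g' hg']
      exact hh _ ((hfull _).2 ⟨k, hk, rfl⟩)
  · intro f hf β hβ t ht hne
    obtain ⟨g, hg, rfl⟩ := (hfull f).1 hf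
    rw [hmin g hg β hβ] at ht
    obtain ⟨x, t', rfl⟩ := List.exists_cons_of_ne_nil hne
    rw [List.cons_prefix_cons] at ht
    obtain ⟨rfl, ht⟩ := ht
    obtain ⟨t₁, ht₁⟩ := hψ'.psi_head g hg _ (min_le_right β γ)
    obtain ⟨β', h1, h2, h3⟩ := hψ'.psi_prefix g hg (min β γ) (min_le_right _ _) (p :: t')
      (by rw [ht₁] at ht ⊢; simpa using ht) (by simp)
    rcases le_or_gt β γ with hβγ | hβγ
    · rw [min_eq_left hβγ] at h1
      refine ⟨β', h1, h2.trans h.lt.le, ?_⟩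
      rw [hψ g hg β' (h2.trans h.lt.le), ← h3]; rfl
    · refine ⟨β, le_rfl, hβ, ?_⟩
      rw [min_eq_right hβγ.le] at h1
      rw [hψ g hg β hβ, cut_of_gt hg.2 hβγ, hψ'.psi_empty]
      rw [le_antisymm h2 h1, hψ'.psi_top g hg] at h3
      simpa using h3
  · rw [hT, hψ'.tree_eq]
    ext t
    simp only [mem_ofPred_eq, mem_image]
    constructor
    · rintro (rfl | ⟨x, t', ⟨s, hs, hst⟩, rfl⟩)
      · exact ⟨Node.empty, (h.mem_iff _).2 (Or.inl rfl), h0⟩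
      · rcases (hK.mem_iff s).1 hs with rfl | ⟨g, hg, β, hβ, rfl⟩
        · rw [hψ'.psi_empty] at hst; cases hst
        · refine ⟨(glue γ α n g).cut β, (h.mem_iff _).2 (Or.inr
            ⟨p, rfl, g, hg, β, hβ.trans h.lt.le, rfl⟩), ?_⟩
          rw [hψ g hg β (hβ.trans h.lt.le), hst]; rfl
    · rintro ⟨s, hs, rfl⟩
      rcases (h.mem_iff s).1 hs with rfl | ⟨l, hl, g, hg, β, hβ, rfl⟩
      · exact Or.inl h0
      · rw [mem_singleton_iff] at hl; subst hl
        right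
        obtain ⟨t, ht⟩ := hψ'.psi_head g hg _ (min_le_right β γ)
        exact ⟨l, t, ⟨g.cut (min β γ), (hK.mem_iff _).2 (Or.inr ⟨g, hg, _, min_le_right _ _, rfl⟩),
          ht⟩, by rw [hmin g hg β hβ, ht]; rfl⟩

/-- The projection on a piece that branches at `γ`. -/
theorem StepPiece.psiPiece_branch {γ α : Ordinal.{0}} {n : ℕ} {B : Set ℕ} {K : ℕ → Set Node}
    {S : Set Node} {T' : ℕ → Set (List ℕ)} {T : Set (List ℕ)} {ψ' ψ : Node → List ℕ}
    (h : StepPiece γ α n B K S) (hB : B.Nontrivial)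
    (hK : ∀ l ∈ B, FullPiece γ l (K l))
    (hψ' : ∀ l ∈ B, PsiPiece γ l (K l) (T' l) ψ') (h0 : ψ Node.empty = [])
    (hψ : ∀ l ∈ B, ∀ g ∈ fullOf γ (K l), ∀ β ≤ α,
      ψ ((glue γ α n g).cut β) = n :: ψ' (g.cut β))
    (hT : T = {t | t = [] ∨ ∃ l ∈ B, ∃ t' ∈ T' l, t = n :: t'}) :
    PsiPiece α n S T ψ := by
  have he : ψ' Node.empty = [] := by
    obtain ⟨l, hl⟩ := h.nonempty
    exact (hψ' l hl).psi_empty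
  refine ⟨h0, ?_, ?_, ?_, ?_, ?_⟩
  · intro f hf β hβ
    obtain ⟨l, hl, g, hg, rfl⟩ := h.mem_full_iff.1 hf
    exact ⟨_, hψ l hl g hg β hβ⟩
  · intro f hf
    obtain ⟨l, hl, g, hg, rfl⟩ := h.mem_full_iff.1 hf
    rw [hψ l hl g hg α le_rfl, cut_of_gt hg.2 h.lt, he]
  · intro f hf f' hf' β hβ β' hβ'
    obtain ⟨l, hl, g, hg, rfl⟩ := h.mem_full_iff.1 hf
    obtain ⟨l', hl', g', hg', rfl⟩ := h.mem_full_iff.1 hf'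
    rw [hψ l hl g hg β hβ, hψ l' hl' g' hg' β' hβ', List.cons_inj_right]
    have hall : ∀ l ∈ B, ∀ g ∈ fullOf γ (K l), ∀ l' ∈ B, ∀ g' ∈ fullOf γ (K l'), ∀ β, γ < β →
        Agree β (glue γ α n g) (glue γ α n g') := by
      intro l _ g hg l' _ g' hg' β hβ
      rw [agree_glue_iff hg.2 hg'.2]
      intro ξ hξ
      rw [eq_none_of_dom hg.2 (by simpa using hβ.trans_le hξ),
        eq_none_of_dom hg'.2 (by simpa using hβ.trans_le hξ)]
    have hnall : ∀ l ∈ B, ∀ g ∈ fullOf γ (K l), ∀ l' ∈ B, ∀ g' ∈ fullOf γ (K l'), ∀ β, β ≤ γ →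
        l ≠ l' → ¬ Agree β (glue γ α n g) (glue γ α n g') := by
      intro l hl g hg l' hl' g' hg' β hβ hne hagr
      have := hagr γ hβ
      rw [glue_apply_le le_rfl, glue_apply_le le_rfl, (hK l hl).top g hg,
        (hK l' hl').top g' hg'] at this
      exact hne (Option.some_injective _ this)
    -- Here `B` must have two elements: every maximal node passes through a cut above `γ`, but those
    -- with another value at `γ` miss a cut at or below `γ`.
    have hmixed : ∀ l ∈ B, ∀ g ∈ fullOf γ (K l), ∀ l' ∈ B, ∀ g' ∈ fullOf γ (K l'), ∀ β β',
        γ < β → β' ≤ γ → ¬ ∀ f ∈ fullOf α S,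
          (Agree β f (glue γ α n g) ↔ Agree β' f (glue γ α n g')) := by
      intro l hl g hg l' hl' g' hg' β β' hβ hβ' hh
      obtain ⟨l₂, hl₂, hne⟩ := hB.exists_ne l'
      obtain ⟨g₂, hg₂⟩ := (hK l₂ hl₂).nonempty
      exact hnall l₂ hl₂ g₂ hg₂ l' hl' g' hg' β' hβ' hne
        ((hh _ (h.mem_full_iff.2 ⟨l₂, hl₂, g₂, hg₂, rfl⟩)).1
          (hall l₂ hl₂ g₂ hg₂ l hl g hg β hβ))
    rcases le_or_gt β γ with hβγ | hβγ <;> rcases le_or_gt β' γ with hβγ' | hβγ'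
    · by_cases hll : l = l'
      · subst hll
        rw [(hψ' l hl).psi_eq g hg g' hg' β hβγ β' hβγ']
        constructor
        · intro hh f hf
          obtain ⟨l₂, hl₂, g₂, hg₂, rfl⟩ := h.mem_full_iff.1 hf
          by_cases hll : l₂ = l
          · subst hll
            rw [agree_glue_iff hg₂.2 hg.2, agree_glue_iff hg₂.2 hg'.2]
            exact hh g₂ hg₂
          · exact iff_of_false (hnall l₂ hl₂ g₂ hg₂ l hl g hg β hβγ hll)
              (hnall l₂ hl₂ g₂ hg₂ l hl g' hg' β' hβγ' hll)
        · intro hh k hk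
          have := hh _ (h.mem_full_iff.2 ⟨l, hl, k, hk, rfl⟩)
          rwa [agree_glue_iff hk.2 hg.2, agree_glue_iff hk.2 hg'.2] at this
      · refine iff_of_false (fun heq => ?_) fun hh => ?_
        · obtain ⟨t, ht⟩ := (hψ' l hl).psi_head g hg β hβγ
          obtain ⟨t', ht'⟩ := (hψ' l' hl').psi_head g' hg' β' hβγ'
          rw [ht, ht'] at heq
          exact hll (List.cons.inj heq).1
        · exact hnall l hl g hg l' hl' g' hg' β' hβγ' hll
            ((hh _ (h.mem_full_iff.2 ⟨l, hl, g, hg, rfl⟩)).1 (Agree.refl _ _))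
    · refine iff_of_false (fun heq => ?_) fun hh => ?_
      · obtain ⟨t, ht⟩ := (hψ' l hl).psi_head g hg β hβγ
        rw [ht, cut_of_gt hg'.2 hβγ', he] at heq
        cases heq
      · exact hmixed l' hl' g' hg' l hl g hg β' β hβγ' hβγ fun f hf => (hh f hf).symm
    · refine iff_of_false (fun heq => ?_) fun hh => ?_
      · obtain ⟨t, ht⟩ := (hψ' l' hl').psi_head g' hg' β' hβγ'
        rw [ht, cut_of_gt hg.2 hβγ, he] at heq
        cases heq
      · exact hmixed l hl g hg l' hl' g' hg' β β' hβγ hβγ' hh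
    · rw [cut_of_gt hg.2 hβγ, cut_of_gt hg'.2 hβγ']
      refine iff_of_true rfl fun f hf => ?_
      obtain ⟨l₂, hl₂, g₂, hg₂, rfl⟩ := h.mem_full_iff.1 hf
      exact iff_of_true (hall l₂ hl₂ g₂ hg₂ l hl g hg β hβγ)
        (hall l₂ hl₂ g₂ hg₂ l' hl' g' hg' β' hβγ')
  · intro f hf β hβ t ht hne
    obtain ⟨l, hl, g, hg, rfl⟩ := h.mem_full_iff.1 hf
    rw [hψ l hl g hg β hβ] at ht
    obtain ⟨x, t', rfl⟩ := List.exists_cons_of_ne_nil hne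
    rw [List.cons_prefix_cons] at ht
    obtain ⟨rfl, ht⟩ := ht
    by_cases ht' : t' = []
    · subst ht'
      exact ⟨α, hβ, le_rfl, by rw [hψ l hl g hg α le_rfl, cut_of_gt hg.2 h.lt, he]⟩
    · have hβγ : β ≤ γ := by
        by_contra hlt
        rw [cut_of_gt hg.2 (not_le.1 hlt), he] at ht
        exact ht' (List.prefix_nil.1 ht)
      obtain ⟨β', h1, h2, h3⟩ := (hψ' l hl).psi_prefix g hg β hβγ t' ht ht'
      exact ⟨β', h1, h2.trans h.lt.le, by rw [hψ l hl g hg β' (h2.trans h.lt.le), h3]⟩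
  · rw [hT]
    ext t
    simp only [mem_ofPred_eq, mem_image]
    constructor
    · rintro (rfl | ⟨l, hl, t', ht', rfl⟩)
      · exact ⟨Node.empty, (h.mem_iff _).2 (Or.inl rfl), h0⟩
      · rw [(hψ' l hl).tree_eq] at ht'
        obtain ⟨s, hs, rfl⟩ := ht'
        rcases ((hK l hl).mem_iff s).1 hs with rfl | ⟨g, hg, β, hβ, rfl⟩
        · obtain ⟨g, hg⟩ := (hK l hl).nonempty
          refine ⟨(glue γ α n g).cut α, (h.mem_iff _).2 (Or.inr
            ⟨l, hl, g, hg, α, le_rfl, rfl⟩), ?_⟩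
          rw [hψ l hl g hg α le_rfl, cut_of_gt hg.2 h.lt]
        · exact ⟨(glue γ α n g).cut β, (h.mem_iff _).2 (Or.inr
            ⟨l, hl, g, hg, β, hβ.trans h.lt.le, rfl⟩), hψ l hl g hg β (hβ.trans h.lt.le)⟩
    · rintro ⟨s, hs, rfl⟩
      rcases (h.mem_iff s).1 hs with rfl | ⟨l, hl, g, hg, β, hβ, rfl⟩
      · exact Or.inl h0
      · refine Or.inr ⟨l, hl, ψ' (g.cut β), ?_, hψ l hl g hg β hβ⟩
        rw [(hψ' l hl).tree_eq]
        rcases le_or_gt β γ with hβγ | hβγ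
        · exact ⟨_, ((hK l hl).mem_iff _).2 (Or.inr ⟨g, hg, β, hβγ, rfl⟩), rfl⟩
        · exact ⟨Node.empty, ((hK l hl).mem_iff _).2 (Or.inl rfl), by rw [cut_of_gt hg.2 hβγ]⟩

end RamseySpace

end

/-! ### The recursively defined levels consist of such pieces -/

noncomputable section

namespace RamseySpace

open Set

/-! ## Blocks -/

theorem blockStart_of_le {k n : ℕ} (h : n ≤ k + 1) : blockStart k n = n := by
  cases n with
  | zero => rfl
  | succ n => simp [blockStart, h]

theorem blockStart_succ_of_lt {k n : ℕ} (h : k < n) :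
    blockStart k (n + 1) = blockStart k n + (n + 1 - k) := by
  simp [blockStart, show ¬ n + 1 ≤ k + 1 by omega]

theorem block_of_le {k n : ℕ} (h : n ≤ k) : block k n = {n} := by
  ext l
  rw [block, blockStart_of_le (by omega), blockStart_of_le (by omega)]
  simp; omega

theorem blockStart_lt_succ (k n : ℕ) : blockStart k n < blockStart k (n + 1) := by
  rcases le_or_gt n k with h | h
  · rw [blockStart_of_le (by omega), blockStart_of_le (by omega)]; omega
  · rw [blockStart_succ_of_lt h]; omega

theorem strictMono_blockStart (k : ℕ) : StrictMono (blockStart k) :=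
  strictMono_nat_of_lt_succ (blockStart_lt_succ k)

theorem block_nonempty (k n : ℕ) : (block k n).Nonempty :=
  ⟨blockStart k n, le_rfl, blockStart_lt_succ k n⟩

theorem block_finite (k n : ℕ) : (block k n).Finite := Set.finite_Ico _ _

theorem block_nontrivial {k n : ℕ} (h : k < n) : (block k n).Nontrivial := by
  have := blockStart_succ_of_lt h
  refine ⟨blockStart k n, ⟨le_rfl, by omega⟩, blockStart k n + 1, ⟨by omega, by omega⟩, by omega⟩

/-- Since block sizes do not decrease, a block can be translated into the next one; this gives the
embeddings of consecutive pieces at successor levels. -/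
theorem block_size_mono {k n n' : ℕ} (h : n ≤ n') :
    blockStart k (n + 1) - blockStart k n ≤ blockStart k (n' + 1) - blockStart k n' := by
  rcases le_or_gt n k with h1 | h1
  · rw [blockStart_of_le (k := k) (n := n) (by omega), blockStart_of_le (by omega)]
    have := blockStart_lt_succ k n'
    omega
  · rw [blockStart_succ_of_lt h1, blockStart_succ_of_lt (h1.trans_le h)]
    omega

theorem exists_mem_block (k l : ℕ) : ∃ n, l ∈ block k n := by
  have hex : ∃ n, l < blockStart k (n + 1) :=
    ⟨l, lt_of_lt_of_le (Nat.lt_succ_self l) ((strictMono_blockStart k).le_apply)⟩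
  classical
  refine ⟨Nat.find hex, ?_, Nat.find_spec hex⟩
  by_contra! h
  rcases hn : Nat.find hex with _ | m
  · rw [hn] at h; simp [blockStart] at h
  · rw [hn] at h
    exact Nat.find_min hex (by omega : m < Nat.find hex) h

/-! ## The recursion -/

variable {c : Ordinal.{0} → ℕ → Ordinal.{0}}

theorem level_zero (c : Ordinal.{0} → ℕ → Ordinal.{0}) : level c 0 = zeroLevel := by
  rw [level, Ordinal.limitRecOn_zero]

theorem level_succ (c : Ordinal.{0} → ℕ → Ordinal.{0}) (α : Ordinal.{0}) :
    level c (α + 1) = succLevel α (level c α) := by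
  rw [level, Ordinal.limitRecOn_add_one]; rfl

theorem level_limit (hc : IsLadderSystem c) {α : Ordinal.{0}} (hl : Order.IsSuccLimit α)
    (hα : α < Ordinal.omega 1) :
    level c α = limLevel (c α) (fun j => level c (c α j)) α := by
  rw [level, Ordinal.limitRecOn_limit _ _ _ _ hl]
  congr 1
  funext j
  rw [dif_pos (hc.lt α hl hα j)]; rfl

theorem Icc_zero_eq_Iic (α : Ordinal.{0}) : Icc 0 α = Iic α := by
  ext ξ; simp

theorem succ_stepPiece (α : Ordinal.{0}) (L : Level) (n : ℕ) :
    StepPiece α (α + 1) n (block (finPart α) n) L.S ((succLevel α L).S n) where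
  lt := lt_add_one α
  nonempty := block_nonempty _ _
  finite := block_finite _ _
  mem_iff s := by
    have key : ∀ g : Node, ∀ β, g.dom = Iic α →
        Node.restrict (fun ξ => if ξ = α + 1 then some n else g ξ) (Icc β (α + 1)) =
          (glue α (α + 1) n g).cut β := by
      intro g β hg
      funext ξ
      rcases le_or_gt β ξ with h1 | h1
      · rw [cut_apply_of_le h1]
        rcases le_or_gt ξ α with h2 | h2
        · have h3 : ξ < α + 1 := h2.trans_lt (lt_add_one α)
          rw [glue_apply_le h2]
          simp [Node.restrict, h1, h3.le, h3.ne]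
        · rcases (Order.add_one_le_of_lt h2).eq_or_lt with h3 | h3
          · subst h3
            rw [glue_apply_mid h2 le_rfl]
            simp [Node.restrict, h1]
          · rw [glue_apply_gt (lt_add_one α).le h3]
            simp [Node.restrict, not_le.2 h3]
      · rw [cut_apply_of_lt h1]
        simp [Node.restrict, not_le.2 h1]
    simp only [succLevel, mem_ofPred_eq, Icc_zero_eq_Iic]
    refine or_congr Iff.rfl ⟨?_, ?_⟩
    · rintro ⟨β, hβ, l, hl, g, hg, hd, rfl⟩
      exact ⟨l, hl, g, ⟨hg, hd⟩, β, hβ, key g β hd⟩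
    · rintro ⟨l, hl, g, ⟨hg, hd⟩, β, hβ, rfl⟩
      exact ⟨β, hβ, l, hl, g, hg, hd, (key g β hd).symm⟩

theorem succ_psi (α : Ordinal.{0}) (L : Level) (n : ℕ) {g : Node} (hg : g.dom = Iic α)
    (hL : L.psi Node.empty = []) {β : Ordinal.{0}} (hβ : β ≤ α + 1) :
    (succLevel α L).psi ((glue α (α + 1) n g).cut β) =
      if n ≤ finPart α ∧ β ≤ α then L.psi (g.cut β) else n :: L.psi (g.cut β) := by
  simp only [succLevel]
  rw [cut_apply_of_le hβ, glue_apply_mid (lt_add_one α) le_rfl, sigma_cut_glue hg]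
  simp only
  rcases le_or_gt β α with h | h
  · rw [cut_apply_of_le h, glue_apply_le le_rfl]
    have := ne_none_of_dom hg (mem_Iic.2 le_rfl)
    simp [this, h]
  · rw [cut_apply_of_lt h, cut_of_gt hg h, hL]
    simp [not_le.2 h]

/-- For `n ≤ finPart α` the block is `{n}`: the piece is copied and its sequences already begin with
`n`, so the relabelling changes nothing. For larger `n` the block has at least two elements and `α`
becomes a branching level. -/
theorem succ_psiPiece {α : Ordinal.{0}} {L : Level} (hF : ∀ l, FullPiece α l (L.S l))
    (hP : ∀ l, PsiPiece α l (L.S l) (L.T l) L.psi) (n : ℕ) :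
    PsiPiece (α + 1) n ((succLevel α L).S n) ((succLevel α L).T n) (succLevel α L).psi := by
  have hstep := succ_stepPiece α L n
  have h0 : (succLevel α L).psi Node.empty = [] := by simp [succLevel, Node.empty]
  rcases le_or_gt n (finPart α) with hn | hn
  · rw [block_of_le hn] at hstep
    refine hstep.psiPiece_relabel (hF n) (hP n) h0 (fun g hg β hβ => ?_) ?_
    · rw [succ_psi α L n hg.2 (hP n).psi_empty hβ]
      rcases le_or_gt β α with h | h
      · rw [if_pos ⟨hn, h⟩]
        obtain ⟨t, ht⟩ := (hP n).psi_head g hg β h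
        rw [ht]; rfl
      · rw [if_neg (fun h' => not_le.2 h h'.2), cut_of_gt hg.2 h, (hP n).psi_empty]; rfl
    · simp only [succLevel, hn, if_true]
      ext t
      simp only [mem_ofPred_eq, (hP n).tree_eq, mem_image]
      constructor
      · rintro ⟨s, hs, rfl⟩
        rcases ((hF n).mem_iff s).1 hs with rfl | ⟨f, hf, β, hβ, rfl⟩
        · exact Or.inl (hP n).psi_empty
        · obtain ⟨t, ht⟩ := (hP n).psi_head f hf β hβ
          exact Or.inr ⟨n, t, ⟨_, hs, ht⟩, ht⟩
      · rintro (rfl | ⟨x, t', ⟨s, hs, hst⟩, rfl⟩)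
        · exact ⟨_, ((hF n).mem_iff _).2 (Or.inl rfl), (hP n).psi_empty⟩
        · refine ⟨s, hs, ?_⟩
          rcases ((hF n).mem_iff s).1 hs with rfl | ⟨f, hf, β, hβ, rfl⟩
          · rw [(hP n).psi_empty] at hst; cases hst
          · obtain ⟨t, ht⟩ := (hP n).psi_head f hf β hβ
            rw [ht] at hst ⊢
            rw [(List.cons.inj hst).2]
  · refine hstep.psiPiece_branch (block_nontrivial hn) (fun l _ => hF l) (fun l _ => hP l) h0
      (fun l _ g hg β hβ => ?_) ?_
    · rw [succ_psi α L n hg.2 (hP l).psi_empty hβ, if_neg (fun h => not_le.2 hn h.1)]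
    · simp only [succLevel, not_le.2 hn, if_false]

theorem lim_stepPiece {α γ : Ordinal.{0}} {p i : ℕ} {d : ℕ → Ordinal.{0}} {D : ℕ → Level}
    (hγ : d (limStage d D i) = γ) (hp : limIndex d D i = p) (hlt : γ < α)
    (hF : FullPiece γ p ((D (limStage d D i)).S p)) :
    StepPiece γ α i {p} (D (limStage d D i)).S ((limLevel d D α).S i) where
  lt := hlt
  nonempty := singleton_nonempty p
  finite := finite_singleton p
  mem_iff s := by
    simp only [limLevel, mem_ofPred_eq, hγ, hp, mem_singleton_iff, exists_eq_left]
    refine or_congr Iff.rfl ⟨?_, ?_⟩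
    · rintro ⟨⟨β, hβ, hd⟩, hs, hv⟩
      have hout : ∀ ξ, β ≤ ξ → γ < ξ → ξ ≤ α → s ξ = some i := fun ξ h1 h2 h3 =>
        hv ξ (by rw [hd]; exact ⟨h1, h3⟩) h2
      have hnone : ∀ ξ, (ξ < β ∨ α < ξ) → s ξ = none := by
        intro ξ h
        refine eq_none_of_dom hd fun h' => ?_
        rcases h with h | h
        · exact not_le.2 h h'.1
        · exact not_le.2 h h'.2
      have main : ∀ g : Node, (∀ ξ, β ≤ ξ → ξ ≤ γ → s ξ = g ξ) → s = (glue γ α i g).cut β := by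
        intro g hg
        funext ξ
        rcases le_or_gt β ξ with h1 | h1
        · rw [cut_apply_of_le h1]
          rcases le_or_gt ξ γ with h2 | h2
          · rw [glue_apply_le h2, hg ξ h1 h2]
          · rcases le_or_gt ξ α with h3 | h3
            · rw [glue_apply_mid h2 h3, hout ξ h1 h2 h3]
            · rw [glue_apply_gt hlt.le h3, hnone ξ (Or.inr h3)]
        · rw [cut_apply_of_lt h1, hnone ξ (Or.inl h1)]
      -- If the domain of `s` reaches down to `γ`, a maximal node below `s` is supplied by the trace
      -- of `s` on `[0, γ]`; otherwise `s` is constant and any maximal node of the lower piece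
      -- serves.
      rcases le_or_gt β γ with hβγ | hβγ
      · rcases (hF.mem_iff _).1 hs with he | ⟨g, hg, β', hβ', he⟩
        · have := congrFun he β
          rw [sigma_apply_of_le hβγ] at this
          exact absurd this (ne_none_of_dom hd ⟨le_rfl, hβ⟩)
        · refine ⟨g, hg, β, hβ, main g fun ξ h1 h2 => ?_⟩
          have h3 := congrFun he ξ
          rw [sigma_apply_of_le h2] at h3
          have h4 : β' ≤ ξ := by
            by_contra h
            rw [cut_apply_of_lt (not_le.1 h)] at h3
            exact ne_none_of_dom hd ⟨h1, h2.trans hlt.le⟩ h3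
          rw [h3, cut_apply_of_le h4]
      · obtain ⟨g, hg⟩ := hF.nonempty
        exact ⟨g, hg, β, hβ, main g fun ξ h1 h2 => absurd (h1.trans h2) (not_le.2 hβγ)⟩
    · rintro ⟨g, hg, β, hβ, rfl⟩
      have hd := dom_glue (n := i) hlt.le hg.2
      refine ⟨⟨β, hβ, dom_cut hd⟩, ?_, fun ξ hξ hγξ => ?_⟩
      · rw [sigma_cut_glue hg.2]
        rcases le_or_gt β γ with hβγ | hβγ
        · exact (hF.mem_iff _).2 (Or.inr ⟨g, hg, β, hβγ, rfl⟩)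
        · exact (hF.mem_iff _).2 (Or.inl (cut_of_gt hg.2 hβγ))
      · rw [dom_cut hd] at hξ
        rw [cut_apply_of_le hξ.1, glue_apply_mid hγξ hξ.2]

theorem lim_psiPiece {α γ : Ordinal.{0}} {p i : ℕ} {d : ℕ → Ordinal.{0}} {D : ℕ → Level}
    (hγ : d (limStage d D i) = γ) (hp : limIndex d D i = p) (hlt : γ < α)
    (hF : FullPiece γ p ((D (limStage d D i)).S p))
    (hP : PsiPiece γ p ((D (limStage d D i)).S p) ((D (limStage d D i)).T p)
      (D (limStage d D i)).psi) :
    PsiPiece α i ((limLevel d D α).S i) ((limLevel d D α).T i) (limLevel d D α).psi := by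
  refine (lim_stepPiece hγ hp hlt hF).psiPiece_relabel hF hP ?_ (fun g hg β hβ => ?_) ?_
  · simp [limLevel, Node.empty]
  · simp only [limLevel]
    rw [cut_apply_of_le hβ, glue_apply_mid hlt le_rfl]
    simp only
    rw [hγ, sigma_cut_glue hg.2]
  · simp only [limLevel, hp]

theorem zero_fullOf (n : ℕ) (f : Node) :
    f ∈ fullOf 0 (zeroLevel.S n) ↔ f.dom = Iic 0 ∧ f 0 = some n := by
  have h0 : Iic (0 : Ordinal.{0}) = {0} := by ext; simp
  simp only [fullOf, zeroLevel, mem_ofPred_eq, h0]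
  constructor
  · rintro ⟨rfl | h, hd⟩
    · rw [dom_empty] at hd
      exact absurd hd.symm (singleton_nonempty _).ne_empty
    · exact h
  · rintro ⟨h1, h2⟩
    exact ⟨Or.inr ⟨h1, h2⟩, h1⟩

theorem zero_unique {n : ℕ} {f g : Node} (hf : f ∈ fullOf 0 (zeroLevel.S n))
    (hg : g ∈ fullOf 0 (zeroLevel.S n)) : f = g := by
  rw [zero_fullOf] at hf hg
  exact agree_zero_iff.1 (agree_of_top hf.1 hg.1 (hf.2.trans hg.2.symm) le_rfl)

theorem zero_exists (n : ℕ) : ∃ f, f ∈ fullOf 0 (zeroLevel.S n) := by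
  refine ⟨fun ξ => if ξ = 0 then some n else none, (zero_fullOf _ _).2 ⟨?_, by simp⟩⟩
  ext ξ
  simp [mem_dom]

theorem zero_fullPiece (n : ℕ) : FullPiece 0 n (zeroLevel.S n) where
  mem_iff s := by
    constructor
    · rintro (h | h)
      · exact Or.inl h
      · refine Or.inr ⟨s, (zero_fullOf n s).2 ⟨?_, h.2⟩, 0, le_rfl, (cut_zero s).symm⟩
        rw [h.1]; ext; simp
    · rintro (h | ⟨f, hf, β, hβ, rfl⟩)
      · exact Or.inl h
      · obtain rfl : β = 0 := le_antisymm hβ zero_le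
        rw [cut_zero]; exact hf.1
  nonempty := zero_exists n
  finite := Set.Subsingleton.finite fun f hf g hg => zero_unique hf hg
  top f hf := ((zero_fullOf n f).1 hf).2
  tri f hf g hg := Or.inl (zero_unique hf hg)

theorem zero_psiPiece (n : ℕ) : PsiPiece 0 n (zeroLevel.S n) (zeroLevel.T n) zeroLevel.psi := by
  have hpsi : ∀ f ∈ fullOf 0 (zeroLevel.S n), ∀ β ≤ (0 : Ordinal.{0}),
      zeroLevel.psi (f.cut β) = [n] := by
    intro f hf β hβ
    obtain rfl : β = 0 := le_antisymm hβ zero_le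
    rw [cut_zero]
    simp [zeroLevel, ((zero_fullOf n f).1 hf).2]
  refine ⟨by simp [zeroLevel, Node.empty], fun f hf β hβ => ⟨[], hpsi f hf β hβ⟩,
    fun f hf => hpsi f hf 0 le_rfl, ?_, ?_, ?_⟩
  · intro f hf g hg β hβ β' hβ'
    rw [hpsi f hf β hβ, hpsi g hg β' hβ']
    refine iff_of_true rfl fun h hh => ?_
    rw [zero_unique hh hf, zero_unique hg hf]
    exact iff_of_true (Agree.refl _ _) (Agree.refl _ _)
  · intro f hf β hβ t ht hne
    rw [hpsi f hf β hβ] at ht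
    refine ⟨β, le_rfl, hβ, ?_⟩
    rw [hpsi f hf β hβ]
    obtain ⟨x, t', rfl⟩ := List.exists_cons_of_ne_nil hne
    rw [List.cons_prefix_cons, List.prefix_nil] at ht
    rw [ht.1, ht.2]
  · ext t
    simp only [mem_image]
    constructor
    · rintro (rfl | rfl)
      · exact ⟨Node.empty, Or.inl rfl, by simp [zeroLevel, Node.empty]⟩
      · obtain ⟨f, hf⟩ := zero_exists n
        exact ⟨f, hf.1, by simpa [cut_zero] using hpsi f hf 0 le_rfl⟩
    · rintro ⟨s, hs, rfl⟩
      rcases ((zero_fullPiece n).mem_iff s).1 hs with rfl | ⟨f, hf, β, hβ, rfl⟩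
      · left; simp [zeroLevel, Node.empty]
      · right; exact hpsi f hf β hβ

theorem countable_induction {P : Ordinal.{0} → Prop} (zero : P 0)
    (succ : ∀ α, α + 1 < Ordinal.omega 1 → P α → P (α + 1))
    (limit : ∀ α, Order.IsSuccLimit α → α < Ordinal.omega 1 → (∀ β < α, P β) → P α) :
    ∀ α, α < Ordinal.omega 1 → P α := by
  intro α
  induction α using Ordinal.limitRecOn with
  | zero => exact fun _ => zero
  | add_one α ih => exact fun h => succ α h (ih ((lt_add_one α).trans h))
  | limit α hl ih => exact fun h => limit α hl h fun β hβ => ih β hβ (hβ.trans h)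

/-- A successor piece is built from a block of pieces one level down. A limit piece is a copy of one
piece of one earlier level, so the limit case needs nothing about how that index was chosen. -/
theorem level_pieces (hc : IsLadderSystem c) : ∀ α, α < Ordinal.omega 1 → ∀ n,
    FullPiece α n (SPiece c α n) ∧
      PsiPiece α n (SPiece c α n) (TPiece c α n) (level c α).psi := by
  apply countable_induction
  · intro n
    simp only [SPiece, TPiece, level_zero]
    exact ⟨zero_fullPiece n, zero_psiPiece n⟩
  · intro α _ ih n
    simp only [SPiece, TPiece, level_succ] at ih ⊢
    exact ⟨(succ_stepPiece α _ n).fullPiece fun l _ => (ih l).1,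
      succ_psiPiece (fun l => (ih l).1) (fun l => (ih l).2) n⟩
  · intro α hl hα ih n
    simp only [SPiece, TPiece, level_limit hc hl hα] at ih ⊢
    have hlt := hc.lt α hl hα (limStage (c α) (fun j => level c (c α j)) n)
    have := ih _ hlt (limIndex (c α) (fun j => level c (c α j)) n)
    exact ⟨(lim_stepPiece rfl rfl hlt this.1).fullPiece fun l hl => by
        rw [mem_singleton_iff.1 hl]; exact this.1, lim_psiPiece rfl rfl hlt this.1 this.2⟩

end RamseySpace

end

/-! ### Embeddings between pieces, and lower levels fitting into higher ones -/

noncomputable section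

namespace RamseySpace

open Set

/-! ## Embeddings of sets of maximal nodes -/

/-- `u` maps `A` to `B` and preserves the order and the splitting levels. -/
structure IsEmb (A B : Set Node) (u : Node → Node) : Prop where
  mapsTo : ∀ f ∈ A, u f ∈ B
  ltAt : ∀ f ∈ A, ∀ g ∈ A, ∀ δ, LtAt δ f g → LtAt δ (u f) (u g)

theorem IsEmb.comp {A B C : Set Node} {u v : Node → Node} (hv : IsEmb B C v) (hu : IsEmb A B u) :
    IsEmb A C (v ∘ u) where
  mapsTo f hf := hv.mapsTo _ (hu.mapsTo f hf)
  ltAt f hf g hg δ h := hv.ltAt _ (hu.mapsTo f hf) _ (hu.mapsTo g hg) δ (hu.ltAt f hf g hg δ h)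

theorem IsEmb.id (A : Set Node) : IsEmb A A _root_.id := ⟨fun _ h => h, fun _ _ _ _ _ h => h⟩

/-- The embeddings `e l` are patched together, reading off `l` as the value at `γ`; the default of
`getD` is never used. The hypothesis `hlt` keeps nodes from different pieces splitting at `γ`. -/
theorem StepPiece.exists_isEmb {γ γ' α : Ordinal.{0}} {n n' : ℕ} {B B' : Set ℕ}
    {K K' : ℕ → Set Node} {S S' : Set Node} (h : StepPiece γ α n B K S)
    (h' : StepPiece γ' α n' B' K' S') (hK : ∀ l ∈ B, FullPiece γ l (K l))
    (τ : ℕ → ℕ) (hτ : ∀ l ∈ B, τ l ∈ B') (e : ℕ → Node → Node)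
    (he : ∀ l ∈ B, IsEmb (fullOf γ (K l)) (fullOf γ' (K' (τ l))) (e l))
    (hlt : ∀ l ∈ B, ∀ l' ∈ B, l < l' → ∀ g ∈ fullOf γ (K l), ∀ g' ∈ fullOf γ (K l'),
      LtAt γ (e l g) (e l' g')) :
    ∃ u, IsEmb (fullOf α S) (fullOf α S') u := by
  have hu : ∀ l ∈ B, ∀ g ∈ fullOf γ (K l), glue γ' α n' (e (((glue γ α n g) γ).getD 0)
      ((glue γ α n g).sigma γ)) = glue γ' α n' (e l g) := by
    intro l hl g hg
    rw [sigma_glue hg.2, glue_apply_le le_rfl, (hK l hl).top g hg]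
    rfl
  refine ⟨fun f => glue γ' α n' (e ((f γ).getD 0) (f.sigma γ)), ?_, ?_⟩
  · intro f hf
    obtain ⟨l, hl, g, hg, rfl⟩ := h.mem_full_iff.1 hf
    rw [hu l hl g hg]
    exact h'.mem_full_iff.2 ⟨τ l, hτ l hl, e l g, (he l hl).mapsTo g hg, rfl⟩
  · intro f hf f' hf' δ hδ
    obtain ⟨l, hl, g, hg, rfl⟩ := h.mem_full_iff.1 hf
    obtain ⟨l', hl', g', hg', rfl⟩ := h.mem_full_iff.1 hf'
    rw [hu l hl g hg, hu l' hl' g' hg',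
      ltAt_glue_iff ((he l hl).mapsTo g hg).2 ((he l' hl').mapsTo g' hg').2]
    rw [ltAt_glue_iff hg.2 hg'.2] at hδ
    rcases lt_trichotomy l l' with hll | rfl | hll
    · have := ltAt_of_top_lt hg.2 hg'.2 ((hK l hl).top g hg) ((hK l' hl').top g' hg') hll
      rw [hδ.level_unique this]
      exact hlt l hl l' hl' hll g hg g' hg'
    · exact (he l hl).ltAt g hg g' hg' δ hδ
    · have := ltAt_of_top_lt hg'.2 hg.2 ((hK l' hl').top g' hg') ((hK l hl).top g hg) hll
      exact absurd this hδ.asymm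

/-- The values at `0` of the members of `A`. -/
def vals (A : Set Node) : Set ℕ := {x | ∃ f ∈ A, f 0 = some x}

theorem FullPiece.vals_nonempty {α : Ordinal.{0}} {n : ℕ} {S : Set Node} (h : FullPiece α n S) :
    (vals (fullOf α S)).Nonempty := by
  obtain ⟨f, hf⟩ := h.nonempty
  obtain ⟨x, hx⟩ := Option.ne_none_iff_exists'.1 (ne_none_of_dom hf.2 (mem_Iic.2 zero_le))
  exact ⟨x, f, hf, hx⟩

theorem StepPiece.vals_eq {γ α : Ordinal.{0}} {n : ℕ} {B : Set ℕ} {K : ℕ → Set Node}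
    {S : Set Node} (h : StepPiece γ α n B K S) {x : ℕ} :
    x ∈ vals (fullOf α S) ↔ ∃ l ∈ B, x ∈ vals (fullOf γ (K l)) := by
  constructor
  · rintro ⟨f, hf, hx⟩
    obtain ⟨l, hl, g, hg, rfl⟩ := h.mem_full_iff.1 hf
    rw [glue_apply_le zero_le] at hx
    exact ⟨l, hl, g, hg, hx⟩
  · rintro ⟨l, hl, g, hg, hx⟩
    exact ⟨_, h.mem_full_iff.2 ⟨l, hl, g, hg, rfl⟩, by rwa [glue_apply_le zero_le]⟩

/-! ## `Fits` -/

/-- All lifts extend the same `r` and so agree on `(γ, β]`; hence they split exactly where the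
original nodes do. A lift of a maximal node is defined at `0` and is therefore maximal. -/
theorem Fits.exists_isEmb {γ β : Ordinal.{0}} {K L : Level} {q m : ℕ}
    (h : Fits γ K q β L m) (hL : FullPiece β m (L.S m)) :
    ∃ u, IsEmb (fullOf γ (K.S q)) (fullOf β (L.S m)) u ∧
      ∀ f ∈ fullOf γ (K.S q), (u f).sigma γ = f := by
  obtain ⟨r, hr, hsub⟩ := h
  have hex : ∀ f, ∃ s, f ∈ fullOf γ (K.S q) → s ∈ fullOf β (L.S m) ∧ s.sigma γ = f ∧ r.Sub s := by
    intro f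
    by_cases hf : f ∈ fullOf γ (K.S q)
    · obtain ⟨s, ⟨hs, hrs⟩, rfl⟩ := hsub hf.1
      refine ⟨s, fun _ => ⟨?_, rfl, hrs⟩⟩
      have h0 : s 0 ≠ none := by
        have := ne_none_of_dom hf.2 (mem_Iic.2 (zero_le (a := γ)))
        rwa [sigma_apply_of_le zero_le] at this
      rcases (hL.mem_iff s).1 hs with rfl | ⟨f, hf', b, hb, rfl⟩
      · exact absurd rfl h0
      · have : b = 0 := by
          by_contra hb0
          exact h0 (cut_apply_of_lt (pos_iff_ne_zero.2 hb0) f)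
        rw [this, cut_zero]; exact hf'
    · exact ⟨f, fun h => absurd h hf⟩
  choose u hu using hex
  refine ⟨u, ⟨fun f hf => (hu f hf).1, fun f hf g hg δ hδ => ?_⟩, fun f hf => (hu f hf).2.1⟩
  have key : ∀ ξ, (f ξ = g ξ → u f ξ = u g ξ) := by
    intro ξ hξ
    rcases le_or_gt ξ γ with h1 | h1
    · rwa [← (hu f hf).2.1, ← (hu g hg).2.1, sigma_apply_of_le h1, sigma_apply_of_le h1] at hξ
    · rcases le_or_gt ξ β with h2 | h2
      · obtain ⟨x, hx⟩ := Option.ne_none_iff_exists'.1 (ne_none_of_dom hr ⟨h1, h2⟩)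
        rw [(hu f hf).2.2 ξ x hx, (hu g hg).2.2 ξ x hx]
      · rw [eq_none_of_dom (hu f hf).1.2 (by simpa using h2),
          eq_none_of_dom (hu g hg).1.2 (by simpa using h2)]
  have hδγ : δ ≤ γ := by
    by_contra h
    exact hδ.ne (by rw [eq_none_of_dom hf.2 (by simpa using h),
      eq_none_of_dom hg.2 (by simpa using h)])
  obtain ⟨x, y, hx, hy, hxy, ha⟩ := hδ
  refine ⟨x, y, ?_, ?_, hxy, fun η hη => key η (ha η hη)⟩
  · rwa [← (hu f hf).2.1, sigma_apply_of_le hδγ] at hx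
  · rwa [← (hu g hg).2.1, sigma_apply_of_le hδγ] at hy

/-- Values at `0` survive fitting. As the sets of values increase with the index on each level, they
make pieces of different levels comparable and control the indices chosen in the limit step. -/
theorem Fits.vals_subset {γ β : Ordinal.{0}} {K L : Level} {q m : ℕ}
    (h : Fits γ K q β L m) (hL : FullPiece β m (L.S m)) :
    vals (fullOf γ (K.S q)) ⊆ vals (fullOf β (L.S m)) := by
  obtain ⟨u, hu, hs⟩ := h.exists_isEmb hL
  rintro x ⟨f, hf, hx⟩
  refine ⟨u f, hu.mapsTo f hf, ?_⟩
  rwa [← hs f hf, sigma_apply_of_le zero_le] at hx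

theorem Fits.trans {γ β ε : Ordinal.{0}} {K L M : Level} {q m i : ℕ} (h : Fits γ K q β L m)
    (h' : Fits β L m ε M i) (hγ : γ ≤ β) (hβ : β ≤ ε) : Fits γ K q ε M i := by
  obtain ⟨r, hr, hsub⟩ := h
  obtain ⟨r', hr', hsub'⟩ := h'
  refine ⟨fun ξ => if ξ ≤ β then r ξ else r' ξ, ?_, ?_⟩
  · ext ξ
    rw [mem_dom]
    rcases le_or_gt ξ β with h1 | h1
    · simp only [h1, if_true]
      rw [← mem_dom, hr]
      simp [h1, h1.trans hβ]
    · simp only [not_le.2 h1, if_false]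
      rw [← mem_dom, hr']
      simp [h1, hγ.trans_lt h1]
  · intro s hs
    obtain ⟨t, ⟨ht, hrt⟩, rfl⟩ := hsub hs
    obtain ⟨t', ⟨ht', hrt'⟩, rfl⟩ := hsub' ht
    refine ⟨t', ⟨ht', fun ξ x hx => ?_⟩, ?_⟩
    · rcases le_or_gt ξ β with h1 | h1
      · simp only [h1, if_true] at hx
        have := hrt ξ x hx
        rwa [sigma_apply_of_le h1] at this
      · simp only [not_le.2 h1, if_false] at hx
        exact hrt' ξ x hx
    · funext ξ
      rcases le_or_gt ξ γ with h1 | h1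
      · rw [sigma_apply_of_le h1, sigma_apply_of_le h1, sigma_apply_of_le (h1.trans hγ)]
      · rw [sigma_apply_of_lt h1, sigma_apply_of_lt h1]

theorem StepPiece.fits {γ α : Ordinal.{0}} {n : ℕ} {B : Set ℕ} {K L : Level}
    (h : StepPiece γ α n B K.S (L.S n)) {l : ℕ} (hl : l ∈ B) (hK : FullPiece γ l (K.S l)) :
    Fits γ K l α L n := by
  have hsub : ∀ g ∈ fullOf γ (K.S l), ∀ β ≤ α, β ≤ Order.succ γ → ∀ ξ x,
      (if γ < ξ ∧ ξ ≤ α then some n else none) = some x →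
        (glue γ α n g).cut β ξ = some x := by
    intro g _ β _ hβ' ξ x hx
    split_ifs at hx with hξ
    rw [cut_apply_of_le (hβ'.trans (Order.succ_le_of_lt hξ.1)), glue_apply_mid hξ.1 hξ.2, hx]
  refine ⟨fun ξ => if γ < ξ ∧ ξ ≤ α then some n else none, ?_, fun s hs => ?_⟩
  · ext ξ
    simp [mem_dom]
  · rcases (hK.mem_iff s).1 hs with rfl | ⟨g, hg, β, hβ, rfl⟩
    · obtain ⟨g, hg⟩ := hK.nonempty
      have hs := Order.succ_le_of_lt h.lt
      -- The empty node below `γ` has to come from the node with domain `(γ, α]`: the empty node of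
      -- the larger piece does not extend `r`.
      refine ⟨(glue γ α n g).cut (Order.succ γ), ⟨(h.mem_iff _).2 (Or.inr
        ⟨l, hl, g, hg, _, hs, rfl⟩), hsub g hg _ hs le_rfl⟩, ?_⟩
      rw [sigma_cut_glue hg.2, cut_of_gt hg.2 (Order.lt_succ γ)]
    · refine ⟨(glue γ α n g).cut β, ⟨(h.mem_iff _).2 (Or.inr
        ⟨l, hl, g, hg, _, hβ.trans h.lt.le, rfl⟩), hsub g hg _ (hβ.trans h.lt.le)
          (hβ.trans (Order.le_succ γ))⟩, ?_⟩
      rw [sigma_cut_glue hg.2]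

/-! ## Increasing sequences of sets of natural numbers -/

theorem lt_of_forall_succ {V : ℕ → Set ℕ} (hne : ∀ i, (V i).Nonempty)
    (h : ∀ i, ∀ x ∈ V i, ∀ y ∈ V (i + 1), x < y) {i j : ℕ} (hij : i < j) :
    ∀ x ∈ V i, ∀ y ∈ V j, x < y := by
  induction j, hij using Nat.le_induction with
  | base => exact h i
  | succ j _ ih =>
    intro x hx y hy
    obtain ⟨z, hz⟩ := hne j
    exact (ih x hx z hz).trans (h j z hz y hy)

theorem le_of_forall_succ {V : ℕ → Set ℕ} (hne : ∀ i, (V i).Nonempty)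
    (h : ∀ i, ∀ x ∈ V i, ∀ y ∈ V (i + 1), x < y) (i : ℕ) : ∀ x ∈ V i, i ≤ x := by
  induction i with
  | zero => exact fun x _ => Nat.zero_le x
  | succ i ih =>
    intro x hx
    obtain ⟨z, hz⟩ := hne i
    exact lt_of_le_of_lt (ih z hz) (h i z hz x hx)

/-! ## The limit step -/

/-- The relations between the pieces of one level, and between this level and lower ones. -/
structure LevelGood (α : Ordinal.{0}) (L : Level) : Prop where
  full : ∀ n, FullPiece α n (L.S n)
  emb_succ : ∀ n, ∃ u, IsEmb (fullOf α (L.S n)) (fullOf α (L.S (n + 1))) u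
  vals_succ : ∀ n, ∀ x ∈ vals (fullOf α (L.S n)), ∀ y ∈ vals (fullOf α (L.S (n + 1))), x < y

namespace LevelGood

variable {α : Ordinal.{0}} {L : Level}

theorem vals_lt (h : LevelGood α L) {m m' : ℕ} (hm : m < m') :
    ∀ x ∈ vals (fullOf α (L.S m)), ∀ y ∈ vals (fullOf α (L.S m')), x < y :=
  lt_of_forall_succ (V := fun n => vals (fullOf α (L.S n))) (fun n => (h.full n).vals_nonempty)
    h.vals_succ hm

theorem le_vals (h : LevelGood α L) (m : ℕ) : ∀ x ∈ vals (fullOf α (L.S m)), m ≤ x :=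
  le_of_forall_succ (V := fun n => vals (fullOf α (L.S n))) (fun n => (h.full n).vals_nonempty)
    h.vals_succ m

theorem emb (h : LevelGood α L) {n n' : ℕ} (hn : n ≤ n') :
    ∃ u, IsEmb (fullOf α (L.S n)) (fullOf α (L.S n')) u := by
  induction n', hn using Nat.le_induction with
  | base => exact ⟨_, IsEmb.id _⟩
  | succ n' _ ih =>
    obtain ⟨u, hu⟩ := ih
    obtain ⟨v, hv⟩ := h.emb_succ n'
    exact ⟨_, hv.comp hu⟩

/-- Values at `0` increase with the index on both levels and are kept by `Fits`, so a later piece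
cannot fit in an earlier one. -/
theorem le_of_fits {γ : Ordinal.{0}} {K : Level} (hK : LevelGood γ K) (hL : LevelGood α L)
    {q q' m m' : ℕ} (hq : q ≤ q') (h : Fits γ K q α L m) (h' : Fits γ K q' α L m') :
    m ≤ m' := by
  by_contra! hlt
  obtain ⟨x, hx⟩ := (hK.full q).vals_nonempty
  have hx' := h.vals_subset (hL.full m) hx
  rcases hq.eq_or_lt with rfl | hq
  · exact lt_irrefl _ (hL.vals_lt hlt x (h'.vals_subset (hL.full m') hx) x hx')
  · obtain ⟨y, hy⟩ := (hK.full q').vals_nonempty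
    exact lt_asymm (hL.vals_lt hlt y (h'.vals_subset (hL.full m') hy) x hx')
      (hK.vals_lt hq x hx y hy)

end LevelGood

section limit

variable {d : ℕ → Ordinal.{0}} {D : ℕ → Level}
  (hd : StrictMono d) (hD : ∀ j, LevelGood (d j) (D j))
  (hfit : ∀ j, ∃ q₀, ∀ q ≥ q₀, ∃ m, Fits (d j) (D j) q (d (j + 1)) (D (j + 1)) m)

include hfit in
theorem stepK_spec (j a : ℕ) : a ≤ stepK d D j a ∧ ∀ q, stepK d D j a ≤ q →
    ∃ m, Fits (d j) (D j) q (d (j + 1)) (D (j + 1)) m := by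
  obtain ⟨q₀, hq₀⟩ := hfit j
  have : {k | a ≤ k ∧ ∀ q, k ≤ q → ∃ m, Fits (d j) (D j) q (d (j + 1)) (D (j + 1)) m}.Nonempty :=
    ⟨max a q₀, le_max_left _ _, fun q hq => hq₀ q (le_of_max_le_right hq)⟩
  exact Nat.sInf_mem this

include hfit in
theorem stepM_spec (j a : ℕ) :
    Fits (d j) (D j) (stepK d D j a) (d (j + 1)) (D (j + 1)) (stepM d D j a) :=
  Nat.sInf_mem (s := {m | Fits (d j) (D j) (stepK d D j a) (d (j + 1)) (D (j + 1)) m})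
    ((stepK_spec hfit j a).2 _ le_rfl)

include hD in
-- Values in piece `l` are at least `l`, and if it fits they lie below every value in piece `stepM +
-- 1`. So the supremum defining `stepL` is a genuine maximum.
theorem stepL_bddAbove (j a : ℕ) :
    BddAbove {l | Fits (d j) (D j) l (d (j + 1)) (D (j + 1)) (stepM d D j a)} := by
  obtain ⟨z, hz⟩ := ((hD (j + 1)).full (stepM d D j a + 1)).vals_nonempty
  refine ⟨z, fun l hl => ?_⟩
  obtain ⟨x, hx⟩ := ((hD j).full l).vals_nonempty
  have h1 := (hD j).le_vals l x hx
  have h2 := (hD (j + 1)).vals_succ _ x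
    (hl.vals_subset ((hD (j + 1)).full _) hx) z hz
  omega

include hD hfit in
theorem stepL_spec (j a : ℕ) :
    Fits (d j) (D j) (stepL d D j a) (d (j + 1)) (D (j + 1)) (stepM d D j a) :=
  Nat.sSup_mem (s := {l | Fits (d j) (D j) l (d (j + 1)) (D (j + 1)) (stepM d D j a)})
    ⟨_, stepM_spec hfit j a⟩ (stepL_bddAbove hD j a)

include hD hfit in
theorem stepK_le_stepL (j a : ℕ) : stepK d D j a ≤ stepL d D j a :=
  le_csSup (stepL_bddAbove hD j a) (stepM_spec hfit j a)

theorem limStart_succ (j : ℕ) : limStart d D (j + 1) =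
    (stepM d D j (limStart d D j).1 + 1,
      (limStart d D j).2 + (stepL d D j (limStart d D j).1 + 1 - (limStart d D j).1)) := rfl

include hD hfit in
theorem limStart_le_stepL (j : ℕ) : (limStart d D j).1 ≤ stepL d D j (limStart d D j).1 :=
  (stepK_spec hfit j _).1.trans (stepK_le_stepL hD hfit j _)

include hD hfit in
theorem strictMono_limStart : StrictMono fun j => (limStart d D j).2 := by
  refine strictMono_nat_of_lt_succ fun j => ?_
  have := limStart_le_stepL hD hfit j
  rw [limStart_succ]
  simp only
  omega

include hD hfit in
-- The search in `limStage` stops at `i`. This loses nothing, since the starting indices are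
-- strictly increasing and stage `j` begins at `j` or later.
theorem limStage_eq_iff (i j : ℕ) :
    limStage d D i = j ↔ (limStart d D j).2 ≤ i ∧ i < (limStart d D (j + 1)).2 := by
  have hb := strictMono_limStart hD hfit
  have hspec : (limStart d D (limStage d D i)).2 ≤ i :=
    Nat.findGreatest_spec (P := fun j => (limStart d D j).2 ≤ i) (Nat.zero_le i) (Nat.zero_le i)
  constructor
  · rintro rfl
    refine ⟨hspec, not_le.1 fun h => ?_⟩
    have h1 : limStage d D i + 1 ≤ i := (hb.le_apply).trans h
    have h2 := Nat.le_findGreatest (P := fun j => (limStart d D j).2 ≤ i) h1 h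
    simp only [limStage] at h2
    omega
  · rintro ⟨h1, h2⟩
    apply le_antisymm
    · exact Nat.lt_succ_iff.1 (hb.lt_iff_lt.1 (hspec.trans_lt h2))
    · exact Nat.le_findGreatest (P := fun j => (limStart d D j).2 ≤ i) ((hb.le_apply).trans h1) h1

include hD hfit in
theorem exists_limIndex_eq (j p : ℕ) (h1 : (limStart d D j).1 ≤ p)
    (h2 : p ≤ stepL d D j (limStart d D j).1) : ∃ i, limStage d D i = j ∧ limIndex d D i = p := by
  have h3 : limStage d D ((limStart d D j).2 + (p - (limStart d D j).1)) = j := by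
    rw [limStage_eq_iff hD hfit, limStart_succ]
    simp only
    omega
  refine ⟨_, h3, ?_⟩
  simp only [limIndex, h3]
  omega

include hD hfit in
theorem lim_succ_cases (i : ℕ) :
    (limStage d D (i + 1) = limStage d D i ∧ limIndex d D (i + 1) = limIndex d D i + 1) ∨
    (limStage d D (i + 1) = limStage d D i + 1 ∧
      limIndex d D i = stepL d D (limStage d D i) (limStart d D (limStage d D i)).1 ∧
      limIndex d D (i + 1) = stepM d D (limStage d D i) (limStart d D (limStage d D i)).1 + 1) := by
  obtain ⟨h1, h2⟩ := (limStage_eq_iff hD hfit i _).1 rfl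
  have h3 := limStart_le_stepL hD hfit (limStage d D i)
  rcases lt_or_ge (i + 1) (limStart d D (limStage d D i + 1)).2 with h | h
  · have h4 : limStage d D (i + 1) = limStage d D i :=
      (limStage_eq_iff hD hfit _ _).2 ⟨by omega, h⟩
    refine Or.inl ⟨h4, ?_⟩
    simp only [limIndex, h4]
    omega
  · have h5 := strictMono_limStart hD hfit (Nat.lt_succ_self (limStage d D i + 1))
    simp only [Nat.succ_eq_add_one] at h5
    have h4 : limStage d D (i + 1) = limStage d D i + 1 :=
      (limStage_eq_iff hD hfit _ _).2 ⟨by omega, by omega⟩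
    have h6 : i + 1 = (limStart d D (limStage d D i + 1)).2 := by omega
    refine Or.inr ⟨h4, ?_, ?_⟩
    · rw [limStart_succ] at h6
      simp only [limIndex]
      simp only at h6
      omega
    · conv_lhs => rw [limIndex, h4, h6]
      simp [limStart_succ]

include hD hfit in
/-- The passage from one piece of the limit level to the next one. -/
theorem lim_succ_piece (i : ℕ) :
    (∃ u, IsEmb (fullOf (d (limStage d D i)) ((D (limStage d D i)).S (limIndex d D i)))
      (fullOf (d (limStage d D (i + 1))) ((D (limStage d D (i + 1))).S (limIndex d D (i + 1)))) u) ∧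
    ∀ x ∈ vals (fullOf (d (limStage d D i)) ((D (limStage d D i)).S (limIndex d D i))),
      ∀ y ∈ vals (fullOf (d (limStage d D (i + 1)))
        ((D (limStage d D (i + 1))).S (limIndex d D (i + 1)))), x < y := by
  rcases lim_succ_cases hD hfit i with ⟨h1, h2⟩ | ⟨h1, h2, h3⟩
  · rw [h1, h2]
    exact ⟨(hD _).emb_succ _, (hD _).vals_succ _⟩
  · rw [h1, h2, h3]
    -- At a change of stage, the last piece copied fits in piece `stepM` of the next level, and the
    -- next piece copied is the successor of that one.
    have hf := stepL_spec hD hfit (limStage d D i) (limStart d D (limStage d D i)).1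
    obtain ⟨u, hu, -⟩ := hf.exists_isEmb ((hD _).full _)
    obtain ⟨v, hv⟩ := (hD (limStage d D i + 1)).emb_succ
      (stepM d D (limStage d D i) (limStart d D (limStage d D i)).1)
    exact ⟨⟨_, hv.comp hu⟩, fun x hx => (hD _).vals_succ _ x (hf.vals_subset ((hD _).full _) hx)⟩

include hD hfit in
-- Values in the last copied piece grow with the stage. This bounds how long a piece can escape
-- being copied.
theorem le_vals_stepL (j : ℕ) :
    ∀ x ∈ vals (fullOf (d j) ((D j).S (stepL d D j (limStart d D j).1))), j ≤ x := by
  refine le_of_forall_succ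
    (V := fun j => vals (fullOf (d j) ((D j).S (stepL d D j (limStart d D j).1))))
    (fun j => ((hD j).full _).vals_nonempty) (fun j x hx y hy => ?_) j
  have h1 := (stepL_spec hD hfit j (limStart d D j).1).vals_subset
    ((hD _).full _) hx
  refine (hD (j + 1)).vals_lt ?_ x h1 y hy
  have := limStart_le_stepL hD hfit (j + 1)
  rw [limStart_succ] at this ⊢
  simp only at this ⊢
  omega

include hd hD hfit in
-- A piece beyond those copied at stage `j` fits in a piece at stage `j + 1` that again is not among
-- the skipped ones, and it keeps its value `w` at `0`. Escaping stage `j` forces `j < w`, so this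
-- happens only finitely often; `N` bounds the number of stages left.
theorem exists_fits_limit {α : Ordinal.{0}} (hα : ∀ j, d j < α) (N : ℕ) :
    ∀ j p w, w + 1 ≤ N + j → (limStart d D j).1 ≤ p → w ∈ vals (fullOf (d j) ((D j).S p)) →
      ∃ i, Fits (d j) (D j) p α (limLevel d D α) i := by
  have hdirect : ∀ j p, (limStart d D j).1 ≤ p → p ≤ stepL d D j (limStart d D j).1 →
      ∃ i, Fits (d j) (D j) p α (limLevel d D α) i := by
    intro j p h1 h2
    obtain ⟨i, rfl, rfl⟩ := exists_limIndex_eq hD hfit j p h1 h2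
    exact ⟨i, (lim_stepPiece rfl rfl (hα _) ((hD _).full _)).fits rfl ((hD _).full _)⟩
  have hgt : ∀ j p w, w ∈ vals (fullOf (d j) ((D j).S p)) →
      stepL d D j (limStart d D j).1 < p → j < w := by
    intro j p w hw hp
    obtain ⟨x, hx⟩ := ((hD j).full (stepL d D j (limStart d D j).1)).vals_nonempty
    exact (le_vals_stepL hD hfit j x hx).trans_lt ((hD j).vals_lt hp x hx w hw)
  induction N with
  | zero =>
    intro j p w hwj hp hw
    refine hdirect j p hp (not_lt.1 fun h => ?_)
    have := hgt j p w hw h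
    omega
  | succ N ih =>
    intro j p w hwj hp hw
    rcases le_or_gt p (stepL d D j (limStart d D j).1) with h | h
    · exact hdirect j p hp h
    · have hk := stepK_le_stepL hD hfit j (limStart d D j).1
      have hle := (hd (Nat.lt_succ_self j)).le
      obtain ⟨m, hm⟩ := (stepK_spec hfit j (limStart d D j).1).2 p (by omega)
      have h1 := (hD j).le_of_fits (hD (j + 1)) (by omega)
        (stepM_spec hfit j (limStart d D j).1) hm
      -- By maximality of `stepL`, a later piece does not fit in piece `stepM`, so it lands at or
      -- after the start of the next stage.
      have h2 : stepM d D j (limStart d D j).1 ≠ m := by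
        intro he
        have : p ≤ stepL d D j (limStart d D j).1 :=
          le_csSup (stepL_bddAbove hD j _) (by rw [mem_ofPred_eq, he]; exact hm)
        omega
      have h3 : (limStart d D (j + 1)).1 ≤ m := by
        rw [limStart_succ]; simp only; omega
      obtain ⟨i, hi⟩ := ih (j + 1) m w (by omega) h3 (hm.vals_subset ((hD _).full _) hw)
      exact ⟨i, hm.trans hi hle (hα _).le⟩

end limit

/-! ## All levels -/

variable {c : Ordinal.{0} → ℕ → Ordinal.{0}}

theorem level_good_fits (hc : IsLadderSystem c) : ∀ α, α < Ordinal.omega 1 →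
    LevelGood α (level c α) ∧
      ∀ γ < α, ∃ q₀, ∀ q ≥ q₀, ∃ m, Fits γ (level c γ) q α (level c α) m := by
  intro α
  induction α using WellFoundedLT.induction with
  | ind α ih =>
  intro hα
  have hfull : ∀ n, FullPiece α n ((level c α).S n) := fun n => (level_pieces hc α hα n).1
  rcases Ordinal.zero_or_succ_or_isSuccLimit α with rfl | ⟨η, rfl⟩ | hl
  · refine ⟨⟨hfull, fun n => ?_, fun n => ?_⟩, fun γ hγ => absurd hγ not_lt_zero⟩
    · rw [level_zero]
      obtain ⟨g, hg⟩ := zero_exists (n + 1)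
      refine ⟨fun _ => g, fun _ _ => hg, fun f hf f' hf' δ hδ => ?_⟩
      rw [zero_unique hf hf'] at hδ
      exact absurd hδ LtAt.irrefl
    · rw [level_zero]
      rintro x ⟨f, hf, hx⟩ y ⟨g, hg, hy⟩
      rw [((zero_fullOf _ _).1 hf).2] at hx
      rw [((zero_fullOf _ _).1 hg).2] at hy
      simp only [Option.some.injEq] at hx hy
      omega
  · simp only [Order.succ_eq_add_one] at ih hα hfull ⊢
    have hη : η < η + 1 := lt_add_one η
    obtain ⟨hG, hF⟩ := ih η hη (hη.trans hα)
    rw [level_succ] at hfull ⊢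
    have hstep := succ_stepPiece η (level c η)
    refine ⟨⟨hfull, fun n => ?_, fun n x hx y hy => ?_⟩, fun γ hγ => ?_⟩
    · set k := finPart η
      have hsz := block_size_mono (k := k) (Nat.le_succ n)
      -- Block `n` is translated to the beginning of block `n + 1`. Indices do not decrease, so the
      -- embeddings already known at level `η` apply.
      have hle : ∀ l ∈ block k n, l ≤ l - blockStart k n + blockStart k (n + 1) := by
        intro l hl
        have := blockStart_lt_succ k n
        have := hl.1
        omega
      choose! e he using fun l (hl : l ∈ block k n) => hG.emb (hle l hl)
      refine (hstep n).exists_isEmb (hstep (n + 1)) (fun l _ => hG.full l)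
        (fun l => l - blockStart k n + blockStart k (n + 1)) (fun l hl => ?_) e he ?_
      · have h1 := hl.1
        have h2 := hl.2
        simp only [Nat.succ_eq_add_one] at hsz
        exact ⟨by omega, by omega⟩
      · intro l hl l' hl' hll g hg g' hg'
        have h1 := (he l hl).mapsTo g hg
        have h2 := (he l' hl').mapsTo g' hg'
        refine ltAt_of_top_lt h1.2 h2.2 ((hG.full _).top _ h1) ((hG.full _).top _ h2) ?_
        have := hl.1
        omega
    · obtain ⟨l, hl, hx⟩ := (hstep n).vals_eq.1 hx
      obtain ⟨l', hl', hy⟩ := (hstep (n + 1)).vals_eq.1 hy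
      exact hG.vals_lt (hl.2.trans_le hl'.1) x hx y hy
    · have hsf : ∀ q, ∃ m, Fits η (level c η) q (η + 1) (succLevel η (level c η)) m := by
        intro q
        obtain ⟨m, hm⟩ := exists_mem_block (finPart η) q
        exact ⟨m, (hstep m).fits hm (hG.full q)⟩
      rcases (Order.lt_add_one_iff.1 hγ).eq_or_lt with rfl | hlt
      · exact ⟨0, fun q _ => hsf q⟩
      · obtain ⟨q₀, hq₀⟩ := hF γ hlt
        refine ⟨q₀, fun q hq => ?_⟩
        obtain ⟨m, hm⟩ := hq₀ q hq
        obtain ⟨m', hm'⟩ := hsf m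
        exact ⟨m', hm.trans hm' hlt.le hη.le⟩
  · have hdα := hc.lt α hl hα
    have hd := hc.strictMono α hl hα
    rw [level_limit hc hl hα] at hfull ⊢
    set D : ℕ → Level := fun j => level c (c α j)
    have hD : ∀ j, LevelGood (c α j) (D j) := fun j => (ih _ (hdα j) ((hdα j).trans hα)).1
    have hfit : ∀ j, ∃ q₀, ∀ q ≥ q₀, ∃ m,
        Fits (c α j) (D j) q (c α (j + 1)) (D (j + 1)) m := fun j =>
      (ih _ (hdα (j + 1)) ((hdα (j + 1)).trans hα)).2 _ (hd (Nat.lt_succ_self j))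
    have hstep := fun i => lim_stepPiece (i := i) (D := D) rfl rfl (hdα _) ((hD _).full _)
    refine ⟨⟨hfull, fun i => ?_, fun i x hx y hy => ?_⟩, fun γ hγ => ?_⟩
    · obtain ⟨⟨u, hu⟩, -⟩ := lim_succ_piece hD hfit i
      refine (hstep i).exists_isEmb (hstep (i + 1)) (fun l hl => ?_)
        (fun _ => limIndex (c α) D (i + 1)) (fun _ _ => rfl) (fun _ => u) (fun l hl => ?_) ?_
      · rw [mem_singleton_iff.1 hl]; exact (hD _).full _
      · rw [mem_singleton_iff.1 hl]; exact hu
      · intro l hl l' hl' hll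
        rw [mem_singleton_iff.1 hl, mem_singleton_iff.1 hl'] at hll
        exact absurd hll (lt_irrefl _)
    · obtain ⟨l, hl, hx⟩ := (hstep i).vals_eq.1 hx
      obtain ⟨l', hl', hy⟩ := (hstep (i + 1)).vals_eq.1 hy
      rw [mem_singleton_iff.1 hl] at hx
      rw [mem_singleton_iff.1 hl'] at hy
      exact (lim_succ_piece hD hfit i).2 x hx y hy
    · obtain ⟨j, hj⟩ := hc.cofinal α hl hα γ hγ
      obtain ⟨q₀, hq₀⟩ := (ih _ (hdα j) ((hdα j).trans hα)).2 γ hj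
      have hγG := (ih γ hγ (hγ.trans hα)).1
      -- A value `z` in the first piece copied at stage `j` turns `q ≥ z` into a lower bound for the
      -- index `p`: all values of piece `q` are at least `q`, hence at least `z`, so `p` does not
      -- precede that first piece.
      obtain ⟨z, hz⟩ := ((hD j).full (limStart (c α) D j).1).vals_nonempty
      refine ⟨max q₀ z, fun q hq => ?_⟩
      obtain ⟨p, hp⟩ := hq₀ q (le_of_max_le_left hq)
      obtain ⟨w, hw⟩ := (hγG.full q).vals_nonempty
      have hwp := hp.vals_subset ((hD j).full p) hw
      have hzw : z ≤ w := (le_of_max_le_right hq).trans (hγG.le_vals q w hw)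
      have hap : (limStart (c α) D j).1 ≤ p := by
        by_contra! hlt
        have := (hD j).vals_lt hlt w hwp z hz
        omega
      obtain ⟨i, hi⟩ := exists_fits_limit hd hD hfit hdα (w + 1) j p w (by omega) hap hwp
      exact ⟨i, hp.trans hi hj.le (hdα j).le⟩

end RamseySpace

end

/-! ### Universality of large pieces and merging of embeddings -/

noncomputable section

namespace RamseySpace

open Set

/-! ## Splitting levels and universality -/

/-- The maximal nodes of `𝕊_α(n)`. -/
def Full (c : Ordinal.{0} → ℕ → Ordinal.{0}) (α : Ordinal.{0}) (n : ℕ) : Set Node :=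
  fullOf α (SPiece c α n)

/-- The ordinals at which two members of `F` split. -/
def splitLevels (F : Set Node) : Set Ordinal.{0} := {δ | ∃ f ∈ F, ∃ g ∈ F, LtAt δ f g}

/-- `f` splits from a member of `F` at `δ`. -/
def SplitsIn (F : Set Node) (δ : Ordinal.{0}) (f : Node) : Prop :=
  ∃ g ∈ F, LtAt δ f g ∨ LtAt δ g f

theorem splitLevels_finite {F : Set Node} (hF : F.Finite) : (splitLevels F).Finite := by
  have : splitLevels F = ⋃ f ∈ F, ⋃ g ∈ F, {δ | LtAt δ f g} := by
    ext δ; simp [splitLevels]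
  rw [this]
  exact hF.biUnion fun f _ => hF.biUnion fun g _ =>
    Set.Subsingleton.finite fun δ hδ ε hε => LtAt.level_unique hδ hε

variable {c : Ordinal.{0} → ℕ → Ordinal.{0}}

theorem full_good (hc : IsLadderSystem c) {α : Ordinal.{0}} (hα : α < Ordinal.omega 1) :
    LevelGood α (level c α) := (level_good_fits hc α hα).1

theorem full_piece (hc : IsLadderSystem c) {α : Ordinal.{0}} (hα : α < Ordinal.omega 1) (n : ℕ) :
    FullPiece α n (SPiece c α n) := (level_pieces hc α hα n).1

theorem psi_piece (hc : IsLadderSystem c) {α : Ordinal.{0}} (hα : α < Ordinal.omega 1) (n : ℕ) :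
    PsiPiece α n (SPiece c α n) (TPiece c α n) (level c α).psi := (level_pieces hc α hα n).2

theorem exists_isEmb_full (hc : IsLadderSystem c) {α : Ordinal.{0}} (hα : α < Ordinal.omega 1)
    {n n' : ℕ} (hn : n ≤ n') : ∃ u, IsEmb (Full c α n) (Full c α n') u :=
  (full_good hc hα).emb hn

theorem exists_isEmb_full_of_le (hc : IsLadderSystem c) {γ α : Ordinal.{0}} (hγ : γ ≤ α)
    (hα : α < Ordinal.omega 1) (q : ℕ) :
    ∃ m₀, ∀ m ≥ m₀, ∃ u, IsEmb (Full c γ q) (Full c α m) u := by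
  rcases hγ.eq_or_lt with rfl | hlt
  · exact ⟨q, fun m hm => exists_isEmb_full hc hα hm⟩
  · obtain ⟨q₀, hq₀⟩ := (level_good_fits hc α hα).2 γ hlt
    obtain ⟨m₀, hm₀⟩ := hq₀ (max q q₀) (le_max_right _ _)
    refine ⟨m₀, fun m hm => ?_⟩
    obtain ⟨u, hu⟩ := exists_isEmb_full hc (hlt.trans hα) (le_max_left q q₀)
    obtain ⟨v, hv, -⟩ := hm₀.exists_isEmb ((full_good hc hα).full m₀)
    obtain ⟨w, hw⟩ := exists_isEmb_full hc hα hm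
    exact ⟨_, hw.comp (IsEmb.comp hv hu)⟩

/-- For a finite set `D` of levels, the complete `t`-branching tree that splits at the levels in
`D` embeds in `𝕊_α(m)` for all large `m`. -/
theorem exists_universal (hc : IsLadderSystem c) (D : Finset Ordinal.{0}) : ∀ α,
    α < Ordinal.omega 1 → (∀ d ∈ D, d < α) → ∀ t : ℕ, ∃ m₀, ∀ m ≥ m₀,
      ∃ θ : (Ordinal.{0} → ℕ) → Node, (∀ x, θ x ∈ Full c α m) ∧
        ∀ x y, ∀ δ ∈ D, x δ < y δ → y δ < t → (∀ d ∈ D, δ < d → x d = y d) →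
          LtAt δ (θ x) (θ y) := by
  classical
  induction D using Finset.induction_on_max with
  | empty =>
    intro α hα _ t
    refine ⟨0, fun m _ => ?_⟩
    obtain ⟨f, hf⟩ := (full_piece hc hα m).nonempty
    exact ⟨fun _ => f, fun _ => hf, fun x y δ hδ => absurd hδ (Finset.notMem_empty δ)⟩
  | insert β D hβD ih =>
    intro α hα hD t
    have hβα : β < α := hD β (Finset.mem_insert_self _ _)
    have hβ : β < Ordinal.omega 1 := hβα.trans hα
    obtain ⟨M₀, hM₀⟩ := ih β hβ hβD t
    choose! θ hθ hθlt using hM₀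
    set k := finPart β with hk
    -- With `β` the largest splitting level, block `n` at `β` is taken late enough that all its
    -- pieces are universal for the lower levels, and long enough to have at least `t` members.
    obtain ⟨n, hnM, hnk⟩ : ∃ n, M₀ ≤ n ∧ k + t + 1 ≤ n :=
      ⟨max M₀ (k + t + 1), le_max_left _ _, le_max_right _ _⟩
    have hsize := blockStart_succ_of_lt (k := k) (n := n) (by omega)
    have hstart : M₀ ≤ blockStart k n := hnM.trans (strictMono_blockStart k).le_apply
    obtain ⟨m₀, hm₀⟩ := exists_isEmb_full_of_le hc (Order.add_one_le_of_lt hβα) hα n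
    refine ⟨m₀, fun m hm => ?_⟩
    obtain ⟨u, hu⟩ := hm₀ m hm
    -- The label at `β` selects the piece inside the block; capping it at `t - 1` keeps the index in
    -- the block for arbitrary labels.
    let l : (Ordinal.{0} → ℕ) → ℕ := fun x => blockStart k n + min (x β) (t - 1)
    have hl : ∀ x, M₀ ≤ l x := fun x => hstart.trans (Nat.le_add_right _ _)
    have hstep := succ_stepPiece β (level c β) n
    have hmem : ∀ x, glue β (β + 1) n (θ (l x) x) ∈ Full c (β + 1) n := by
      intro x
      rw [Full, SPiece, level_succ]
      refine hstep.mem_full_iff.2 ⟨l x, ⟨Nat.le_add_right _ _, ?_⟩, _, hθ _ (hl x) x, rfl⟩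
      have := min_le_right (x β) (t - 1)
      change l x < blockStart k (n + 1)
      simp only [l]
      omega
    refine ⟨fun x => u (glue β (β + 1) n (θ (l x) x)), fun x => hu.mapsTo _ (hmem x), ?_⟩
    intro x y δ hδ hxy hyt hagr
    refine hu.ltAt _ (hmem x) _ (hmem y) δ ?_
    have hx := hθ _ (hl x) x
    have hy := hθ _ (hl y) y
    rw [ltAt_glue_iff hx.2 hy.2]
    rcases Finset.mem_insert.1 hδ with rfl | hδ
    · refine ltAt_of_top_lt hx.2 hy.2 ((full_piece hc hβ _).top _ hx)
        ((full_piece hc hβ _).top _ hy) ?_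
      simp only [l]
      omega
    · have hll : l x = l y := by
        simp only [l]
        rw [hagr β (Finset.mem_insert_self _ _) (hβD δ hδ)]
      rw [hll]
      exact hθlt _ (hl y) x y δ hδ hxy hyt fun d hd => hagr d (Finset.mem_insert_of_mem hd)

/-! ## Embeddings with as much splitting as possible -/

theorem ltAt_cases {γ : Ordinal.{0}} {l l' : ℕ} {K : ℕ → Set Node} {g g' : Node}
    (hl : FullPiece γ l (K l)) (hl' : FullPiece γ l' (K l')) (hg : g ∈ fullOf γ (K l))
    (hg' : g' ∈ fullOf γ (K l')) {δ : Ordinal.{0}} (h : LtAt δ g g') :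
    (l = l' ∧ δ < γ) ∨ (l < l' ∧ δ = γ) := by
  have h1 := hl.top g hg
  have h2 := hl'.top g' hg'
  rcases lt_trichotomy l l' with hll | rfl | hll
  · exact Or.inr ⟨hll, h.level_unique (ltAt_of_top_lt hg.2 hg'.2 h1 h2 hll)⟩
  · refine Or.inl ⟨rfl, not_le.1 fun hle => h.ne ?_⟩
    exact agree_of_top hg.2 hg'.2 (h1.trans h2.symm) le_rfl δ hle
  · exact absurd (ltAt_of_top_lt hg'.2 hg.2 h2 h1 hll) h.asymm

/-- Two embeddings in `F` can be merged into one that splits wherever one of them does. -/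
def Mergeable (F : Set Node) : Prop :=
  ∀ (P : Set Node) (u u' : Node → Node), IsEmb P F u → IsEmb P F u' →
    ∃ w, IsEmb P F w ∧ ∀ f ∈ P, ∀ δ, SplitsIn F δ (u f) ∨ SplitsIn F δ (u' f) → SplitsIn F δ (w f)

/-- Where `u` goes to piece `a` and `u'` to piece `b`, both are moved into piece `max a b` and
merged there. A split of the source at `γ` raises both indices and any other split raises neither,
so the maximum behaves as an index of an embedding should. Splitting at `γ` itself is automatic as
soon as `B` has two elements. -/
theorem StepPiece.mergeable {γ α : Ordinal.{0}} {n : ℕ} {B : Set ℕ} {K : ℕ → Set Node}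
    {S : Set Node} (h : StepPiece γ α n B K S) (hK : ∀ l ∈ B, FullPiece γ l (K l))
    (he : ∀ l ∈ B, ∀ l' ∈ B, l ≤ l' → ∃ e, IsEmb (fullOf γ (K l)) (fullOf γ (K l')) e)
    (hM : ∀ l ∈ B, Mergeable (fullOf γ (K l))) : Mergeable (fullOf α S) := by
  intro P u u' hu hu'
  choose! e he using he
  have hdec : ∀ v : Node → Node, IsEmb P (fullOf α S) v → ∃ (j : Node → ℕ) (s : Node → Node),
      ∀ f ∈ P, j f ∈ B ∧ s f ∈ fullOf γ (K (j f)) ∧ v f = glue γ α n (s f) := by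
    intro v hv
    have := fun f (hf : f ∈ P) => h.mem_full_iff.1 (hv.mapsTo f hf)
    choose! j hj s hs hvs using this
    exact ⟨j, s, fun f hf => ⟨hj f hf, hs f hf, hvs f hf⟩⟩
  obtain ⟨j, s, hs⟩ := hdec u hu
  obtain ⟨j', s', hs'⟩ := hdec u' hu'
  have hmax : ∀ a ∈ B, ∀ b ∈ B, max a b ∈ B := fun a ha b hb => by
    rcases max_choice a b with h | h <;> rw [h] <;> assumption
  have hcls : ∀ a ∈ B, ∀ b ∈ B, ∃ w, IsEmb {f | f ∈ P ∧ j f = a ∧ j' f = b}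
      (fullOf γ (K (max a b))) w ∧ ∀ f ∈ {f | f ∈ P ∧ j f = a ∧ j' f = b}, ∀ δ,
        SplitsIn (fullOf γ (K (max a b))) δ (e a (max a b) (s f)) ∨
        SplitsIn (fullOf γ (K (max a b))) δ (e b (max a b) (s' f)) →
        SplitsIn (fullOf γ (K (max a b))) δ (w f) := by
    intro a ha b hb
    have h1 := he a ha _ (hmax a ha b hb) (le_max_left a b)
    have h2 := he b hb _ (hmax a ha b hb) (le_max_right a b)
    refine hM _ (hmax a ha b hb) _ (fun f => e a (max a b) (s f)) (fun f => e b (max a b) (s' f))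
      ⟨?_, ?_⟩ ⟨?_, ?_⟩
    · rintro f ⟨hf, rfl, rfl⟩
      exact h1.mapsTo _ (hs f hf).2.1
    · rintro f ⟨hf, rfl, rfl⟩ g ⟨hg, hjg, hjg'⟩ δ hδ
      have hsg := (hs g hg).2.1
      rw [hjg] at hsg
      refine h1.ltAt _ (hs f hf).2.1 _ hsg δ ?_
      have := hu.ltAt f hf g hg δ hδ
      rwa [(hs f hf).2.2, (hs g hg).2.2, ltAt_glue_iff (hs f hf).2.1.2 hsg.2] at this
    · rintro f ⟨hf, rfl, rfl⟩
      exact h2.mapsTo _ (hs' f hf).2.1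
    · rintro f ⟨hf, rfl, rfl⟩ g ⟨hg, hjg, hjg'⟩ δ hδ
      have hsg := (hs' g hg).2.1
      rw [hjg'] at hsg
      refine h2.ltAt _ (hs' f hf).2.1 _ hsg δ ?_
      have := hu'.ltAt f hf g hg δ hδ
      rwa [(hs' f hf).2.2, (hs' g hg).2.2, ltAt_glue_iff (hs' f hf).2.1.2 hsg.2] at this
  choose! w hw hwsplit using hcls
  have hwmem : ∀ f ∈ P, w (j f) (j' f) f ∈ fullOf γ (K (max (j f) (j' f))) := fun f hf =>
    (hw _ (hs f hf).1 _ (hs' f hf).1).mapsTo f ⟨hf, rfl, rfl⟩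
  refine ⟨fun f => glue γ α n (w (j f) (j' f) f), ⟨?_, ?_⟩, ?_⟩
  · intro f hf
    exact h.mem_full_iff.2 ⟨_, hmax _ (hs f hf).1 _ (hs' f hf).1, _, hwmem f hf, rfl⟩
  · intro f hf g hg δ hδ
    obtain ⟨hjf, hsf, huf⟩ := hs f hf
    obtain ⟨hjg, hsg, hug⟩ := hs g hg
    obtain ⟨hjf', hsf', huf'⟩ := hs' f hf
    obtain ⟨hjg', hsg', hug'⟩ := hs' g hg
    have h1 := hu.ltAt f hf g hg δ hδ
    have h2 := hu'.ltAt f hf g hg δ hδ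
    rw [huf, hug, ltAt_glue_iff hsf.2 hsg.2] at h1
    rw [huf', hug', ltAt_glue_iff hsf'.2 hsg'.2] at h2
    rw [ltAt_glue_iff (hwmem f hf).2 (hwmem g hg).2]
    rcases ltAt_cases (hK _ hjf) (hK _ hjg) hsf hsg h1 with ⟨hj1, hδ1⟩ | ⟨hj1, hδ1⟩ <;>
      rcases ltAt_cases (hK _ hjf') (hK _ hjg') hsf' hsg' h2 with ⟨hj2, hδ2⟩ | ⟨hj2, hδ2⟩
    · rw [hj1, hj2]
      exact (hw _ hjg _ hjg').ltAt f ⟨hf, hj1, hj2⟩ g ⟨hg, rfl, rfl⟩ δ hδ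
    · exact absurd hδ2 hδ1.ne
    · exact absurd hδ1 hδ2.ne
    · rw [hδ1]
      exact ltAt_of_top_lt (hwmem f hf).2 (hwmem g hg).2
        ((hK _ (hmax _ hjf _ hjf')).top _ (hwmem f hf))
        ((hK _ (hmax _ hjg _ hjg')).top _ (hwmem g hg)) (max_lt_max hj1 hj2)
  · intro f hf δ hδ
    obtain ⟨hjf, hsf, huf⟩ := hs f hf
    obtain ⟨hjf', hsf', huf'⟩ := hs' f hf
    have hm := hmax _ hjf _ hjf'
    have hsplit : ∀ l ∈ B, ∀ g ∈ fullOf γ (K l), SplitsIn (fullOf α S) δ (glue γ α n g) →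
        (δ = γ ∧ B.Nontrivial) ∨ SplitsIn (fullOf γ (K l)) δ g := by
      rintro l hl g hg ⟨k, hk, hlt⟩
      obtain ⟨l', hl', g', hg', rfl⟩ := h.mem_full_iff.1 hk
      rw [ltAt_glue_iff hg.2 hg'.2, ltAt_glue_iff hg'.2 hg.2] at hlt
      have hor : l = l' ∨ (l ≠ l' ∧ δ = γ) := by
        rcases hlt with hlt | hlt
        · rcases ltAt_cases (hK l hl) (hK l' hl') hg hg' hlt with h | h
          · exact Or.inl h.1
          · exact Or.inr ⟨h.1.ne, h.2⟩
        · rcases ltAt_cases (hK l' hl') (hK l hl) hg' hg hlt with h | h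
          · exact Or.inl h.1.symm
          · exact Or.inr ⟨h.1.ne', h.2⟩
      rcases hor with rfl | ⟨hne, hδ⟩
      · exact Or.inr ⟨g', hg', hlt⟩
      · exact Or.inl ⟨hδ, l, hl, l', hl', hne⟩
    have hemb : ∀ a ∈ B, a ≤ max (j f) (j' f) → ∀ g ∈ fullOf γ (K a),
        SplitsIn (fullOf γ (K a)) δ g →
        SplitsIn (fullOf γ (K (max (j f) (j' f)))) δ (e a (max (j f) (j' f)) g) := by
      rintro a ha hle g hg ⟨g', hg', hlt⟩
      have := he a ha _ hm hle
      exact ⟨_, this.mapsTo g' hg', hlt.imp (this.ltAt g hg g' hg' δ) (this.ltAt g' hg' g hg δ)⟩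
    have main : (δ = γ ∧ B.Nontrivial) ∨
        SplitsIn (fullOf γ (K (max (j f) (j' f)))) δ (w (j f) (j' f) f) := by
      rw [huf, huf'] at hδ
      rcases hδ with hδ | hδ
      · refine (hsplit _ hjf _ hsf hδ).imp_right fun hδ => ?_
        exact hwsplit _ hjf _ hjf' f ⟨hf, rfl, rfl⟩ δ
          (Or.inl (hemb _ hjf (le_max_left _ _) _ hsf hδ))
      · refine (hsplit _ hjf' _ hsf' hδ).imp_right fun hδ => ?_
        exact hwsplit _ hjf _ hjf' f ⟨hf, rfl, rfl⟩ δ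
          (Or.inr (hemb _ hjf' (le_max_right _ _) _ hsf' hδ))
    have hwf := hwmem f hf
    rcases main with ⟨rfl, hB⟩ | ⟨g, hg, hlt⟩
    · obtain ⟨l, hl, hne⟩ := hB.exists_ne (max (j f) (j' f))
      obtain ⟨g, hg⟩ := (hK l hl).nonempty
      refine ⟨_, h.mem_full_iff.2 ⟨l, hl, g, hg, rfl⟩, ?_⟩
      simp only
      rw [ltAt_glue_iff hwf.2 hg.2, ltAt_glue_iff hg.2 hwf.2]
      have h1 := (hK _ hm).top _ hwf
      have h2 := (hK l hl).top g hg
      rcases lt_or_gt_of_ne hne with hlt | hlt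
      · exact Or.inr (ltAt_of_top_lt hg.2 hwf.2 h2 h1 hlt)
      · exact Or.inl (ltAt_of_top_lt hwf.2 hg.2 h1 h2 hlt)
    · refine ⟨_, h.mem_full_iff.2 ⟨_, hm, g, hg, rfl⟩, ?_⟩
      simp only
      rwa [ltAt_glue_iff hwf.2 hg.2, ltAt_glue_iff hg.2 hwf.2]

theorem full_mergeable (hc : IsLadderSystem c) : ∀ α, α < Ordinal.omega 1 → ∀ n,
    Mergeable (Full c α n) := by
  intro α
  induction α using WellFoundedLT.induction with
  | ind α ih =>
  intro hα n
  rcases Ordinal.zero_or_succ_or_isSuccLimit α with rfl | ⟨η, rfl⟩ | hl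
  · intro P u u' hu hu'
    refine ⟨u, hu, fun f hf δ hδ => ?_⟩
    have h1 := hu.mapsTo f hf
    have h2 := hu'.mapsTo f hf
    rw [Full, SPiece, level_zero] at h1 h2
    rw [← zero_unique h1 h2, or_self] at hδ
    exact hδ
  · simp only [Order.succ_eq_add_one] at ih hα ⊢
    have hη : η < η + 1 := lt_add_one η
    have hG := full_good hc (hη.trans hα)
    rw [Full, SPiece, level_succ]
    exact (succ_stepPiece η (level c η) n).mergeable (fun l _ => hG.full l)
      (fun l _ l' _ hll => hG.emb hll) fun l _ => ih η hη (hη.trans hα) l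
  · have hdα := hc.lt α hl hα
    have hG := fun j => full_good hc ((hdα j).trans hα)
    rw [Full, SPiece, level_limit hc hl hα]
    refine (lim_stepPiece (D := fun j => level c (c α j)) rfl rfl (hdα _)
      ((hG _).full _)).mergeable (fun l hl => ?_) (fun l _ l' _ hll => (hG _).emb hll)
      fun l _ => ih _ (hdα _) ((hdα _).trans hα) l
    rw [mem_singleton_iff.1 hl]
    exact (hG _).full _

/-- There is an embedding that splits wherever some embedding splits. -/
theorem exists_generic {F P : Set Node} (hM : Mergeable F) (hF : F.Finite) (hP : P.Finite)
    (hne : ∃ u, IsEmb P F u) :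
    ∃ u₀, IsEmb P F u₀ ∧ ∀ u, IsEmb P F u → ∀ f ∈ P, ∀ δ, SplitsIn F δ (u f) →
      SplitsIn F δ (u₀ f) := by
  classical
  -- Only finitely many pairs of a node and a splitting level matter; merging secures one further
  -- pair at a time without losing the earlier ones.
  have key : ∀ T : Finset (Node × Ordinal.{0}), ∃ u₀, IsEmb P F u₀ ∧ ∀ p ∈ T, p.1 ∈ P →
      ∀ u, IsEmb P F u → SplitsIn F p.2 (u p.1) → SplitsIn F p.2 (u₀ p.1) := by
    intro T
    induction T using Finset.induction_on with
    | empty =>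
      obtain ⟨u, hu⟩ := hne
      exact ⟨u, hu, fun p hp => absurd hp (Finset.notMem_empty p)⟩
    | insert p T _ ih =>
      obtain ⟨u₀, hu₀, h⟩ := ih
      by_cases hex : p.1 ∈ P ∧ ∃ u, IsEmb P F u ∧ SplitsIn F p.2 (u p.1)
      · obtain ⟨hp, u, hu, hsp⟩ := hex
        obtain ⟨w, hw, hws⟩ := hM P u₀ u hu₀ hu
        refine ⟨w, hw, fun q hq hqP v hv hvs => ?_⟩
        rcases Finset.mem_insert.1 hq with rfl | hq
        · exact hws _ hp _ (Or.inr hsp)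
        · exact hws _ hqP _ (Or.inl (h q hq hqP v hv hvs))
      · refine ⟨u₀, hu₀, fun q hq hqP v hv hvs => ?_⟩
        rcases Finset.mem_insert.1 hq with rfl | hq
        · exact absurd ⟨hqP, v, hv, hvs⟩ hex
        · exact h q hq hqP v hv hvs
  obtain ⟨u₀, hu₀, h⟩ := key (hP.prod (splitLevels_finite hF)).toFinset
  refine ⟨u₀, hu₀, fun u hu f hf δ hδ => h (f, δ) ?_ hf u hu hδ⟩
  rw [Set.Finite.mem_toFinset]
  obtain ⟨g, hg, hlt | hlt⟩ := hδ
  · exact ⟨hf, _, hu.mapsTo f hf, g, hg, hlt⟩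
  · exact ⟨hf, g, hg, _, hu.mapsTo f hf, hlt⟩

end RamseySpace

end

/-! ### Trees as copies given by embeddings of maximal nodes -/

noncomputable section

namespace RamseySpace

open Set

/-! ## Embeddings and isomorphisms -/

/-- The tree of all nodes below members of `F`. -/
def treeOf (α : Ordinal.{0}) (F : Set Node) : Set Node :=
  {s | s = Node.empty ∨ ∃ f ∈ F, ∃ β ≤ α, s = f.cut β}

/-- A set of nodes with domain `[0, α]`, any two of which split at some level. -/
structure IsBase (α : Ordinal.{0}) (F : Set Node) : Prop where
  dom : ∀ f ∈ F, f.dom = Iic α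
  tri : ∀ f ∈ F, ∀ g ∈ F, f = g ∨ ∃ δ, LtAt δ f g ∨ LtAt δ g f

theorem treeOf_mono {α : Ordinal.{0}} {F G : Set Node} (h : F ⊆ G) : treeOf α F ⊆ treeOf α G := by
  rintro s (rfl | ⟨f, hf, β, hβ, rfl⟩)
  · exact Or.inl rfl
  · exact Or.inr ⟨f, h hf, β, hβ, rfl⟩

theorem cut_mem_treeOf {α β : Ordinal.{0}} {F : Set Node} {f : Node} (hf : f ∈ F) (hβ : β ≤ α) :
    f.cut β ∈ treeOf α F := Or.inr ⟨f, hf, β, hβ, rfl⟩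

theorem mem_treeOf {α : Ordinal.{0}} {F : Set Node} {f : Node} (hf : f ∈ F) : f ∈ treeOf α F :=
  Or.inr ⟨f, hf, 0, zero_le, (cut_zero f).symm⟩

theorem mem_of_mem_treeOf {α : Ordinal.{0}} {F : Set Node} {f : Node} (hF : ∀ f ∈ F, f.dom = Iic α)
    (hf : f ∈ treeOf α F) (hd : f.dom = Iic α) : f ∈ F := by
  rcases hf with rfl | ⟨g, hg, β, hβ, rfl⟩
  · rw [dom_empty] at hd
    exact absurd hd.symm nonempty_Iic.ne_empty
  · rw [dom_cut (hF g hg)] at hd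
    have : (0 : Ordinal) ∈ Icc β α := hd ▸ mem_Iic.2 zero_le
    rw [le_antisymm this.1 zero_le, cut_zero]
    exact hg

theorem IsEmb.agree_iff {α β : Ordinal.{0}} {F G : Set Node} {u : Node → Node} (hu : IsEmb F G u)
    (hF : IsBase α F) {f g : Node} (hf : f ∈ F) (hg : g ∈ F) :
    Agree β (u f) (u g) ↔ Agree β f g := by
  rcases hF.tri f hf g hg with rfl | ⟨δ, h | h⟩
  · exact iff_of_true (Agree.refl _ _) (Agree.refl _ _)
  · rw [h.agree_iff, (hu.ltAt f hf g hg δ h).agree_iff]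
  · have h1 := h.agree_iff (β := β)
    have h2 := (hu.ltAt g hg f hf δ h).agree_iff (β := β)
    exact ⟨fun h => (h1.2 (h2.1 h.symm)).symm, fun h => (h2.2 (h1.1 h.symm)).symm⟩

theorem IsEmb.ltAt_iff {α δ : Ordinal.{0}} {F G : Set Node} {u : Node → Node} (hu : IsEmb F G u)
    (hF : IsBase α F) {f g : Node} (hf : f ∈ F) (hg : g ∈ F) :
    LtAt δ (u f) (u g) ↔ LtAt δ f g := by
  refine ⟨fun h => ?_, hu.ltAt f hf g hg δ⟩
  rcases hF.tri f hf g hg with rfl | ⟨ε, h' | h'⟩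
  · exact absurd h LtAt.irrefl
  · rwa [h.level_unique (hu.ltAt f hf g hg ε h')]
  · exact absurd (hu.ltAt g hg f hf ε h') h.asymm

theorem sub_cut_iff {α β β' : Ordinal.{0}} {f g : Node} (hf : f.dom = Iic α) (hg : g.dom = Iic α)
    (hβ : β ≤ α) : (f.cut β).Sub (g.cut β') ↔ β' ≤ β ∧ Agree β f g := by
  constructor
  · intro h
    have key : ∀ ξ, β ≤ ξ → ξ ≤ α → β' ≤ ξ ∧ f ξ = g ξ := by
      intro ξ h1 h2
      obtain ⟨x, hx⟩ := Option.ne_none_iff_exists'.1 (ne_none_of_dom hf (mem_Iic.2 h2))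
      have := h ξ x (by rw [cut_apply_of_le h1, hx])
      have h3 : β' ≤ ξ := by
        by_contra h3
        rw [cut_apply_of_lt (not_le.1 h3)] at this
        cases this
      rw [cut_apply_of_le h3] at this
      exact ⟨h3, hx.trans this.symm⟩
    refine ⟨(key β le_rfl hβ).1, fun ξ hξ => ?_⟩
    rcases le_or_gt ξ α with h2 | h2
    · exact (key ξ hξ h2).2
    · rw [eq_none_of_dom hf (by simpa using h2), eq_none_of_dom hg (by simpa using h2)]
  · rintro ⟨h1, h2⟩ ξ x hx
    have h3 : β ≤ ξ := by
      by_contra h3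
      rw [cut_apply_of_lt (not_le.1 h3)] at hx
      cases hx
    rw [cut_apply_of_le h3] at hx
    rw [cut_apply_of_le (h1.trans h3), ← h2 ξ h3, hx]

theorem ltAt_cut_iff {β β' δ : Ordinal.{0}} {f g : Node} :
    LtAt δ (f.cut β) (g.cut β') ↔ β ≤ δ ∧ β' ≤ δ ∧ LtAt δ f g := by
  constructor
  · rintro ⟨x, y, hx, hy, hxy, h⟩
    have h1 : β ≤ δ := by
      by_contra h1
      rw [cut_apply_of_lt (not_le.1 h1)] at hx
      cases hx
    have h2 : β' ≤ δ := by
      by_contra h1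
      rw [cut_apply_of_lt (not_le.1 h1)] at hy
      cases hy
    rw [cut_apply_of_le h1] at hx
    rw [cut_apply_of_le h2] at hy
    refine ⟨h1, h2, x, y, hx, hy, hxy, fun η hη => ?_⟩
    have := h η hη
    rwa [cut_apply_of_le (h1.trans hη.le), cut_apply_of_le (h2.trans hη.le)] at this
  · rintro ⟨h1, h2, x, y, hx, hy, hxy, h⟩
    refine ⟨x, y, by rwa [cut_apply_of_le h1], by rwa [cut_apply_of_le h2], hxy, fun η hη => ?_⟩
    rw [cut_apply_of_le (h1.trans hη.le), cut_apply_of_le (h2.trans hη.le), h η hη]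

theorem lex_iff (s s' : Node) : s.Lex s' ↔ (s.Sub s' ∧ s ≠ s') ∨ ∃ δ, LtAt δ s s' := Iff.rfl

theorem lex_cut_iff {α β β' : Ordinal.{0}} {f g : Node} (hf : f.dom = Iic α) (hg : g.dom = Iic α)
    (hβ : β ≤ α) (hβ' : β' ≤ α) : (f.cut β).Lex (g.cut β') ↔
      (β' < β ∧ Agree β f g) ∨ ∃ δ, β ≤ δ ∧ β' ≤ δ ∧ LtAt δ f g := by
  rw [lex_iff, sub_cut_iff hf hg hβ, Ne, cut_eq_cut_iff hf hg hβ hβ']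
  simp only [ltAt_cut_iff]
  refine or_congr ⟨?_, ?_⟩ Iff.rfl
  · rintro ⟨⟨h1, h2⟩, h3⟩
    exact ⟨lt_of_le_of_ne h1 fun h => h3 ⟨h.symm, h2⟩, h2⟩
  · rintro ⟨h1, h2⟩
    exact ⟨⟨h1.le, h2⟩, fun h => h1.ne' h.1⟩

theorem empty_sub (s : Node) : Node.empty.Sub s := fun ξ x hx => by simp [Node.empty] at hx

theorem sub_empty_iff {s : Node} : s.Sub Node.empty ↔ s = Node.empty := by
  refine ⟨fun h => funext fun ξ => ?_, fun h => h ▸ empty_sub _⟩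
  rcases hs : s ξ with _ | x
  · rfl
  · have := h ξ x hs
    simp [Node.empty] at this

theorem empty_lex_iff {s : Node} : Node.empty.Lex s ↔ s ≠ Node.empty := by
  rw [lex_iff]
  constructor
  · rintro (h | ⟨δ, x, y, hx, -⟩)
    · exact h.2.symm
    · simp [Node.empty] at hx
  · exact fun h => Or.inl ⟨empty_sub s, h.symm⟩

theorem not_lex_empty {s : Node} : ¬ s.Lex Node.empty := by
  rw [lex_iff, sub_empty_iff]
  rintro (h | ⟨δ, x, y, -, hy, -⟩)
  · exact h.2 h.1
  · simp [Node.empty] at hy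

open Classical in
/-- The extension of a map of maximal nodes to all nodes. -/
def extend (α : Ordinal.{0}) (F : Set Node) (u : Node → Node) : Node → Node := fun s =>
  if h : ∃ p : Node × Ordinal.{0}, p.1 ∈ F ∧ p.2 ≤ α ∧ s = p.1.cut p.2 then
    (u h.choose.1).cut h.choose.2 else Node.empty

/-- The choice made in `extend` is immaterial: maximal nodes with a common cut have images with a
common cut, because embeddings preserve splitting levels. -/
theorem extend_cut {α β : Ordinal.{0}} {F G : Set Node} {u : Node → Node} (hF : IsBase α F)
    (hu : IsEmb F G u) {f : Node} (hf : f ∈ F) (hβ : β ≤ α) :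
    extend α F u (f.cut β) = (u f).cut β := by
  have h : ∃ p : Node × Ordinal.{0}, p.1 ∈ F ∧ p.2 ≤ α ∧ f.cut β = p.1.cut p.2 :=
    ⟨(f, β), hf, hβ, rfl⟩
  obtain ⟨h1, h2, h3⟩ := h.choose_spec
  rw [extend, dif_pos h]
  rw [cut_eq_cut_iff (hF.dom f hf) (hF.dom _ h1) hβ h2] at h3
  rw [← h3.1, cut_eq_iff, hu.agree_iff hF h1 hf]
  exact h3.2.symm

theorem extend_empty {α : Ordinal.{0}} {F : Set Node} {u : Node → Node} (hF : IsBase α F) :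
    extend α F u Node.empty = Node.empty := by
  rw [extend, dif_neg]
  rintro ⟨p, h1, h2, h3⟩
  exact cut_ne_empty (hF.dom _ h1) h2 h3.symm

/-- Every nonempty node is a cut of a maximal one, and extension and lexicographic order of cuts are
expressed by agreement and splitting levels, which an embedding preserves and reflects. -/
theorem extend_isIso {α : Ordinal.{0}} {F G : Set Node} {u : Node → Node} (hF : IsBase α F)
    (hG : ∀ f ∈ G, f.dom = Iic α) (hu : IsEmb F G u) :
    IsIso (treeOf α F) (treeOf α (u '' F)) (extend α F u) where
  bijOn := by
    refine ⟨?_, ?_, ?_⟩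
    · rintro s (rfl | ⟨f, hf, β, hβ, rfl⟩)
      · rw [extend_empty hF]; exact Or.inl rfl
      · rw [extend_cut hF hu hf hβ]
        exact cut_mem_treeOf (mem_image_of_mem u hf) hβ
    · rintro s (rfl | ⟨f, hf, β, hβ, rfl⟩) s' (rfl | ⟨g, hg, β', hβ', rfl⟩) h
      · rfl
      · rw [extend_empty hF, extend_cut hF hu hg hβ'] at h
        exact absurd h.symm (cut_ne_empty (hG _ (hu.mapsTo g hg)) hβ')
      · rw [extend_empty hF, extend_cut hF hu hf hβ] at h
        exact absurd h (cut_ne_empty (hG _ (hu.mapsTo f hf)) hβ)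
      · rw [extend_cut hF hu hf hβ, extend_cut hF hu hg hβ', cut_eq_cut_iff
          (hG _ (hu.mapsTo f hf)) (hG _ (hu.mapsTo g hg)) hβ hβ', hu.agree_iff hF hf hg] at h
        rwa [cut_eq_cut_iff (hF.dom f hf) (hF.dom g hg) hβ hβ']
    · rintro s (rfl | ⟨f, ⟨g, hg, rfl⟩, β, hβ, rfl⟩)
      · exact ⟨_, Or.inl rfl, extend_empty hF⟩
      · exact ⟨_, cut_mem_treeOf hg hβ, extend_cut hF hu hg hβ⟩
  dom_eq := by
    rintro s (rfl | ⟨f, hf, β, hβ, rfl⟩)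
    · rw [extend_empty hF]
    · rw [extend_cut hF hu hf hβ, dom_cut (hG _ (hu.mapsTo f hf)), dom_cut (hF.dom f hf)]
  sub_iff := by
    rintro s (rfl | ⟨f, hf, β, hβ, rfl⟩) s' (rfl | ⟨g, hg, β', hβ', rfl⟩)
    · rw [extend_empty hF]
    · rw [extend_empty hF]
      exact iff_of_true (empty_sub _) (empty_sub _)
    · rw [extend_empty hF, extend_cut hF hu hf hβ, sub_empty_iff, sub_empty_iff]
      exact iff_of_false (cut_ne_empty (hG _ (hu.mapsTo f hf)) hβ)
        (cut_ne_empty (hF.dom f hf) hβ)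
    · rw [extend_cut hF hu hf hβ, extend_cut hF hu hg hβ', sub_cut_iff
        (hG _ (hu.mapsTo f hf)) (hG _ (hu.mapsTo g hg)) hβ, hu.agree_iff hF hf hg,
        sub_cut_iff (hF.dom f hf) (hF.dom g hg) hβ]
  lex_iff := by
    rintro s (rfl | ⟨f, hf, β, hβ, rfl⟩) s' (rfl | ⟨g, hg, β', hβ', rfl⟩)
    · rw [extend_empty hF]
    · rw [extend_empty hF, extend_cut hF hu hg hβ', empty_lex_iff, empty_lex_iff]
      exact iff_of_true (cut_ne_empty (hG _ (hu.mapsTo g hg)) hβ')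
        (cut_ne_empty (hF.dom g hg) hβ')
    · rw [extend_empty hF]
      exact iff_of_false not_lex_empty not_lex_empty
    · rw [extend_cut hF hu hf hβ, extend_cut hF hu hg hβ', lex_cut_iff
        (hG _ (hu.mapsTo f hf)) (hG _ (hu.mapsTo g hg)) hβ hβ', hu.agree_iff hF hf hg,
        lex_cut_iff (hF.dom f hf) (hF.dom g hg) hβ hβ']
      simp only [hu.ltAt_iff hF hf hg]

theorem IsIso.subset {A B S : Set Node} {ι : Node → Node} (h : IsIso A B ι) (hS : S ⊆ A) :
    IsIso S (ι '' S) ι where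
  bijOn := ⟨mapsTo_image ι S, h.bijOn.injOn.mono hS, surjOn_image ι S⟩
  dom_eq s hs := h.dom_eq s (hS hs)
  sub_iff s hs s' hs' := h.sub_iff s (hS hs) s' (hS hs')
  lex_iff s hs s' hs' := h.lex_iff s (hS hs) s' (hS hs')

section IsIso

variable {α : Ordinal.{0}} {F B : Set Node} {ι : Node → Node}

theorem IsIso.map_empty (h : IsIso (treeOf α F) B ι) : ι Node.empty = Node.empty := by
  rw [eq_empty_iff, h.dom_eq _ (Or.inl rfl), dom_empty]

theorem IsIso.dom_map (h : IsIso (treeOf α F) B ι) (hF : IsBase α F) {f : Node} (hf : f ∈ F) :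
    (ι f).dom = Iic α := by
  rw [h.dom_eq f (mem_treeOf hf), hF.dom f hf]

/-- The image of a cut is extended by `ι f` and has the prescribed domain, which leaves only one
possibility. -/
theorem IsIso.map_cut (h : IsIso (treeOf α F) B ι) (hF : IsBase α F) {f : Node} (hf : f ∈ F)
    {β : Ordinal.{0}} (hβ : β ≤ α) : ι (f.cut β) = (ι f).cut β := by
  have hd : (ι (f.cut β)).dom = Icc β α := by
    rw [h.dom_eq _ (cut_mem_treeOf hf hβ), dom_cut (hF.dom f hf)]
  have hs : (ι (f.cut β)).Sub (ι f) := by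
    rw [h.sub_iff _ (cut_mem_treeOf hf hβ) _ (mem_treeOf hf)]
    conv_rhs => rw [← cut_zero f]
    rw [sub_cut_iff (hF.dom f hf) (hF.dom f hf) hβ]
    exact ⟨zero_le, Agree.refl _ _⟩
  have hd' := dom_cut (β := β) (h.dom_map hF hf)
  funext ξ
  by_cases hξ : ξ ∈ Icc β α
  · obtain ⟨x, hx⟩ := Option.ne_none_iff_exists'.1 (ne_none_of_dom hd hξ)
    rw [hx, cut_apply_of_le hξ.1, hs ξ x hx]
  · rw [eq_none_of_dom hd hξ, eq_none_of_dom hd' hξ]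

theorem IsIso.agree_iff (h : IsIso (treeOf α F) B ι) (hF : IsBase α F) {f g : Node}
    (hf : f ∈ F) (hg : g ∈ F) {β : Ordinal.{0}} (hβ : β ≤ α) :
    Agree β (ι f) (ι g) ↔ Agree β f g := by
  rw [← cut_eq_iff, ← cut_eq_iff, ← h.map_cut hF hf hβ, ← h.map_cut hF hg hβ]
  exact h.bijOn.injOn.eq_iff (cut_mem_treeOf hf hβ) (cut_mem_treeOf hg hβ)

theorem LtAt.le_of_dom {δ : Ordinal.{0}} {f g : Node} (h : LtAt δ f g) (hf : f.dom = Iic α) :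
    δ ≤ α := by
  obtain ⟨x, y, hx, -⟩ := h
  by_contra hlt
  rw [eq_none_of_dom hf (by simpa using hlt)] at hx
  cases hx

/-- Lexicographic order alone says only that the images split at some level, in the right direction.
Agreement of cuts is preserved as well, and this identifies the level. -/
theorem IsIso.isEmb (h : IsIso (treeOf α F) B ι) (hF : IsBase α F) :
    IsEmb F {s | s ∈ B ∧ s.dom = Iic α} ι where
  mapsTo f hf := ⟨h.bijOn.mapsTo (mem_treeOf hf), h.dom_map hF hf⟩
  ltAt f hf g hg δ hδ := by
    have h1 : (ι f).Lex (ι g) := (h.lex_iff _ (mem_treeOf hf) _ (mem_treeOf hg)).2 (Or.inr ⟨δ, hδ⟩)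
    have hfd := h.dom_map hF hf
    have hgd := h.dom_map hF hg
    rw [← cut_zero (ι f), ← cut_zero (ι g), lex_cut_iff hfd hgd zero_le zero_le] at h1
    rcases h1 with ⟨h1, -⟩ | ⟨ε, -, -, hε⟩
    · exact absurd h1 (lt_irrefl _)
    · have h2 := h.agree_iff hF hf hg (hδ.le_of_dom (hF.dom f hf))
      have h3 := h.agree_iff hF hf hg (hε.le_of_dom hfd)
      rw [hε.agree_iff, hδ.agree_iff] at h2 h3
      have : δ = ε := le_antisymm (not_lt.1 fun hlt => lt_irrefl _ (h2.1 hlt))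
        (not_lt.1 fun hlt => lt_irrefl _ (h3.2 hlt))
      rwa [this]

theorem IsIso.eq_treeOf (h : IsIso (treeOf α F) B ι) (hF : IsBase α F) : B = treeOf α (ι '' F) := by
  rw [← h.bijOn.image_eq]
  ext s
  constructor
  · rintro ⟨s, rfl | ⟨f, hf, β, hβ, rfl⟩, rfl⟩
    · exact Or.inl h.map_empty
    · rw [h.map_cut hF hf hβ]
      exact cut_mem_treeOf (mem_image_of_mem ι hf) hβ
  · rintro (rfl | ⟨f, ⟨g, hg, rfl⟩, β, hβ, rfl⟩)
    · exact ⟨_, Or.inl rfl, h.map_empty⟩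
    · exact ⟨_, cut_mem_treeOf hg hβ, h.map_cut hF hg hβ⟩

end IsIso

/-! ## Trees in `R_α(n)` -/

variable {c : Ordinal.{0} → ℕ → Ordinal.{0}} {α : Ordinal.{0}}

theorem full_isBase (hc : IsLadderSystem c) (hα : α < Ordinal.omega 1) (n : ℕ) :
    IsBase α (Full c α n) :=
  ⟨fun _ hf => hf.2, (full_piece hc hα n).tri⟩

theorem spiece_eq_treeOf (hc : IsLadderSystem c) (hα : α < Ordinal.omega 1) (n : ℕ) :
    SPiece c α n = treeOf α (Full c α n) :=
  Set.ext fun s => (full_piece hc hα n).mem_iff s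

theorem psi_cons (hc : IsLadderSystem c) (hα : α < Ordinal.omega 1) {n : ℕ} {s : Node}
    (hs : s ∈ SPiece c α n) (hne : s ≠ Node.empty) : ∃ t, (level c α).psi s = n :: t := by
  rcases ((full_piece hc hα n).mem_iff s).1 hs with rfl | ⟨f, hf, β, hβ, rfl⟩
  · exact absurd rfl hne
  · exact (psi_piece hc hα n).psi_head f hf β hβ

theorem psi_empty (hc : IsLadderSystem c) (hα : α < Ordinal.omega 1) :
    (level c α).psi Node.empty = [] := (psi_piece hc hα 0).psi_empty

theorem empty_mem_spiece (hc : IsLadderSystem c) (hα : α < Ordinal.omega 1) (n : ℕ) :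
    Node.empty ∈ SPiece c α n := ((full_piece hc hα n).mem_iff _).2 (Or.inl rfl)

theorem tpiece_cons (hc : IsLadderSystem c) (hα : α < Ordinal.omega 1) {n : ℕ} {t : List ℕ}
    (ht : t ∈ TPiece c α n) (hne : t ≠ []) : ∃ t', t = n :: t' := by
  rw [(psi_piece hc hα n).tree_eq] at ht
  obtain ⟨s, hs, rfl⟩ := ht
  exact psi_cons hc hα hs fun h => hne (h ▸ psi_empty hc hα)

/-- The first entry of a nonempty `ψ`-value is the index of the piece, so nonempty nodes of
different pieces never project to the same sequence. -/
theorem psiPreimage_subset (hc : IsLadderSystem c) (hα : α < Ordinal.omega 1) {K : ℕ}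
    {u : Set (List ℕ)} (hu : u ⊆ TPiece c α K) : psiPreimage c α u ⊆ SPiece c α K := by
  rintro s ⟨⟨n, hn⟩, hs⟩
  by_cases hne : s = Node.empty
  · rw [hne]; exact empty_mem_spiece hc hα K
  · obtain ⟨t, ht⟩ := psi_cons hc hα hn hne
    obtain ⟨t', ht'⟩ := tpiece_cons hc hα (hu hs) (by rw [ht]; simp)
    rw [ht] at ht'
    rwa [(List.cons.inj ht').1] at hn

theorem psi_image_psiPreimage (hc : IsLadderSystem c) (hα : α < Ordinal.omega 1) {K : ℕ}
    {u : Set (List ℕ)} (hu : u ⊆ TPiece c α K) : (level c α).psi '' psiPreimage c α u = u := by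
  ext t
  constructor
  · rintro ⟨s, hs, rfl⟩
    exact hs.2
  · intro ht
    have := hu ht
    rw [(psi_piece hc hα K).tree_eq] at this
    obtain ⟨s, hs, rfl⟩ := this
    exact ⟨s, ⟨⟨K, hs⟩, ht⟩, rfl⟩

theorem psi_image_subset (hc : IsLadderSystem c) (hα : α < Ordinal.omega 1) {K : ℕ}
    {F : Set Node} (hF : F ⊆ Full c α K) : (level c α).psi '' treeOf α F ⊆ TPiece c α K := by
  rw [(psi_piece hc hα K).tree_eq, spiece_eq_treeOf hc hα]
  exact image_mono (treeOf_mono hF)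

/-- If `s` projects like a cut of `f ∈ F`, the same maximal nodes pass through both. In particular
`f` passes through `s`, so `s` is itself a cut of `f`. -/
theorem psiPreimage_psi_image (hc : IsLadderSystem c) (hα : α < Ordinal.omega 1) {K : ℕ}
    {F : Set Node} (hF : F ⊆ Full c α K) :
    psiPreimage c α ((level c α).psi '' treeOf α F) = treeOf α F := by
  apply Subset.antisymm
  · intro s hs
    have hsK := psiPreimage_subset hc hα (psi_image_subset hc hα hF) hs
    obtain ⟨-, s', hs', he⟩ := hs
    rcases ((full_piece hc hα K).mem_iff s).1 hsK with rfl | ⟨g, hg, β, hβ, rfl⟩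
    · exact Or.inl rfl
    · rcases hs' with rfl | ⟨f, hf, β', hβ', rfl⟩
      · obtain ⟨t, ht⟩ := (psi_piece hc hα K).psi_head g hg β hβ
        rw [psi_empty hc hα, ht] at he
        cases he
      · rw [(psi_piece hc hα K).psi_eq f (hF hf) g hg β' hβ' β hβ] at he
        rw [cut_eq_iff.2 ((he f (hF hf)).1 (Agree.refl _ _)).symm]
        exact cut_mem_treeOf hf hβ
  · intro s hs
    refine ⟨⟨K, ?_⟩, mem_image_of_mem _ hs⟩
    rw [spiece_eq_treeOf hc hα]
    exact treeOf_mono hF hs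

theorem nil_mem_psi_image (hc : IsLadderSystem c) (hα : α < Ordinal.omega 1) (F : Set Node) :
    [] ∈ (level c α).psi '' treeOf α F := ⟨Node.empty, Or.inl rfl, psi_empty hc hα⟩

/-- To count as a member of `R_α(n)` the copy must be the `n`-th tree of some member of the space.
The other trees are placed by arbitrary embeddings, the first `n` in pieces `0, …, n - 1` and the
later ones in the pieces after `K`. -/
theorem psi_image_mem_rtrees (hc : IsLadderSystem c) (hα : α < Ordinal.omega 1) {n K : ℕ}
    (hn : n ≤ K) {u : Node → Node} (hu : IsEmb (Full c α n) (Full c α K) u) :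
    (level c α).psi '' treeOf α (u '' Full c α n) ∈ RTrees c α n := by
  let idx : ℕ → ℕ := fun i => if i < n then i else K + (i - n)
  have hidx : StrictMono idx := by
    intro i j hij
    simp only [idx]
    split_ifs <;> omega
  have hidxn : idx n = K := by simp [idx]
  have hex : ∀ i, ∃ w, IsEmb (Full c α i) (Full c α (idx i)) w := fun i =>
    exists_isEmb_full hc hα hidx.le_apply
  obtain ⟨w, hw, hwn⟩ : ∃ w : ℕ → Node → Node,
      (∀ i, IsEmb (Full c α i) (Full c α (idx i)) (w i)) ∧ w n = u := by
    choose w hw using hex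
    refine ⟨Function.update w n u, fun i => ?_, Function.update_self ..⟩
    by_cases hi : i = n
    · subst hi; rw [Function.update_self, hidxn]; exact hu
    · rw [Function.update_of_ne hi]; exact hw i
  let Y : ℕ → Set (List ℕ) := fun i => (level c α).psi '' treeOf α (w i '' Full c α i)
  have hsub : ∀ i, w i '' Full c α i ⊆ Full c α (idx i) := by
    rintro i _ ⟨f, hf, rfl⟩
    exact (hw i).mapsTo f hf
  have hYT : ∀ i, Y i ⊆ TPiece c α (idx i) := fun i => psi_image_subset hc hα (hsub i)
  have hhead : ∀ m i t, t ∈ TPiece c α m → t ∈ Y i → t ≠ [] → m = idx i := by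
    intro m i t h1 h2 hne
    obtain ⟨t₁, h1⟩ := tpiece_cons hc hα h1 hne
    obtain ⟨t₂, h2⟩ := tpiece_cons hc hα (hYT i h2) hne
    rw [h1] at h2
    exact (List.cons.inj h2).1
  have hinter : ∀ i, (⋃ i, Y i) ∩ TPiece c α (idx i) = Y i := by
    intro i
    apply Subset.antisymm
    · rintro t ⟨ht, hT⟩
      obtain ⟨j, hj⟩ := mem_iUnion.1 ht
      by_cases hne : t = []
      · rw [hne]; exact nil_mem_psi_image hc hα _
      · rwa [hidx.injective (hhead _ _ t hT hj hne)]
    · exact fun t ht => ⟨mem_iUnion.2 ⟨i, ht⟩, hYT i ht⟩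
  refine ⟨⟨⋃ i, Y i, idx, ?_, hidx, fun m => ⟨?_, ?_⟩, fun i => ?_⟩, ?_⟩
  · exact iUnion_subset fun i => (hYT i).trans (subset_iUnion (fun m => TPiece c α m) (idx i))
  · rintro ⟨t, ⟨ht, hT⟩, hne⟩
    obtain ⟨j, hj⟩ := mem_iUnion.1 ht
    exact ⟨j, hhead _ _ t hT hj hne⟩
  · rintro ⟨i, rfl⟩
    rw [hinter]
    obtain ⟨f, hf⟩ := (full_piece hc hα i).nonempty
    refine ⟨_, mem_image_of_mem _ (cut_mem_treeOf (mem_image_of_mem (w i) hf) (le_refl α)), ?_⟩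
    rw [(psi_piece hc hα (idx i)).psi_top _ ((hw i).mapsTo f hf)]
    simp
  · rw [hinter, psiPreimage_psi_image hc hα (hsub i), spiece_eq_treeOf hc hα]
    exact ⟨_, extend_isIso (full_isBase hc hα i) (fun f hf => hf.2) (hw i)⟩
  · simp only [RSpace.tree]
    rw [hinter, ← hwn]

theorem RSpace.tree_mem (X : RSpace c α) (n : ℕ) : X.tree n ∈ RTrees c α n := ⟨X, rfl⟩

theorem iota_isIso {n : ℕ} {u : Set (List ℕ)} (hu : u ∈ RTrees c α n) :
    IsIso (SPiece c α n) (psiPreimage c α u) (iota c α n u) := by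
  obtain ⟨X, rfl⟩ := hu
  have h : Isomorphic (SPiece c α n) (psiPreimage c α (X.tree n)) := X.iso n
  rw [iota, dif_pos h]
  exact h.choose_spec

/-- The properties of the isomorphism `ι_u`. -/
theorem iota_spec (hc : IsLadderSystem c) (hα : α < Ordinal.omega 1) {n K : ℕ}
    {u : Set (List ℕ)} (hu : u ∈ RTrees c α n) (huK : u ⊆ TPiece c α K) :
    IsEmb (Full c α n) (Full c α K) (iota c α n u) ∧
      psiPreimage c α u = treeOf α (iota c α n u '' Full c α n) ∧
      (level c α).psi '' treeOf α (iota c α n u '' Full c α n) = u ∧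
      iota c α n u Node.empty = Node.empty ∧
      ∀ f ∈ Full c α n, ∀ β ≤ α, iota c α n u (f.cut β) = (iota c α n u f).cut β := by
  have h := iota_isIso hu
  rw [spiece_eq_treeOf hc hα] at h
  have hb := full_isBase hc hα n
  have he := h.eq_treeOf hb
  refine ⟨⟨fun f hf => ?_, (h.isEmb hb).ltAt⟩, he, ?_, h.map_empty, fun f hf β hβ =>
    h.map_cut hb hf hβ⟩
  · have := (h.isEmb hb).mapsTo f hf
    exact ⟨psiPreimage_subset hc hα huK this.1, this.2⟩
  · rw [← he, psi_image_psiPreimage hc hα huK]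

/-- Copies of `𝕊_α(n)` inside `X(m)`. -/
theorem psi_image_mem_rtreesIn (hc : IsLadderSystem c) (hα : α < Ordinal.omega 1) {n m : ℕ}
    (hn : n ≤ m) (X : RSpace c α) {w : Node → Node} (hw : IsEmb (Full c α n) (Full c α m) w) :
    (level c α).psi '' treeOf α ((iota c α m (X.tree m) ∘ w) '' Full c α n) ∈
      RTreesIn c α n (X.tree m) := by
  have hT : X.tree m ⊆ TPiece c α (X.idx m) := inter_subset_right
  obtain ⟨hι, hpre, himg, -⟩ := iota_spec hc hα (X.tree_mem m) hT
  refine ⟨psi_image_mem_rtrees hc hα (hn.trans X.strictMono.le_apply) (hι.comp hw), ?_⟩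
  conv_rhs => rw [← himg]
  refine image_mono (treeOf_mono ?_)
  rintro _ ⟨f, hf, rfl⟩
  exact mem_image_of_mem _ (hw.mapsTo f hf)

end RamseySpace

end

/-! ### Embeddings as increasing tuples -/

noncomputable section

namespace RamseySpace

open Set

/-! ## Coding embeddings by increasing sequences -/

theorem exists_enumeration {A : Type*} (r : A → A → Prop) {N : Set A} (hN : N.Finite)
    (irrefl : ∀ a, ¬ r a a) (trans : ∀ a b c, r a b → r b c → r a c)
    (tri : ∀ a ∈ N, ∀ b ∈ N, a = b ∨ r a b ∨ r b a) :
    ∃ (v : ℕ) (e : Fin v → A), (∀ i, e i ∈ N) ∧ (∀ s ∈ N, ∃ i, e i = s) ∧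
      ∀ i j, i < j → r (e i) (e j) := by
  classical
  let r' : N → N → Prop := fun a b => r a b
  have : IsStrictTotalOrder N r' :=
    { irrefl := fun a => irrefl a
      trans := fun a b c => trans a b c
      trichotomous := fun a b h1 h2 => by
        rcases tri a a.2 b b.2 with h | h | h
        · exact Subtype.ext h
        · exact absurd h h1
        · exact absurd h h2 }
  let : LinearOrder N := linearOrderOfSTO r'
  have : Fintype N := hN.fintype
  let φ := Fintype.orderIsoFinOfCardEq N rfl
  refine ⟨Fintype.card N, fun i => φ i, fun i => (φ i).2, fun s hs => ⟨φ.symm ⟨s, hs⟩, by simp⟩,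
    fun i j hij => ?_⟩
  exact φ.strictMono hij

/-- The order in which the nodes of a tree are labelled: by levels from the top, and from left to
right on each level. -/
def Pre (s s' : Node) : Prop := s.dom ⊂ s'.dom ∨ (s.dom = s'.dom ∧ ∃ δ, LtAt δ s s')

theorem Pre.irrefl (s : Node) : ¬ Pre s s := by
  rintro (h | ⟨-, δ, h⟩)
  · exact ssubset_irrefl _ h
  · exact LtAt.irrefl h

theorem Pre.trans {s s' s'' : Node} (h : Pre s s') (h' : Pre s' s'') : Pre s s'' := by
  rcases h with h | ⟨h, δ, hδ⟩ <;> rcases h' with h' | ⟨h', ε, hε⟩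
  · exact Or.inl (h.trans h')
  · exact Or.inl (h' ▸ h)
  · exact Or.inl (h ▸ h')
  · exact Or.inr ⟨h.trans h', _, hδ.trans hε⟩

/-- The nodes below members of `F` on the levels in `D`. -/
def nodesOf (F : Set Node) (D : Finset Ordinal.{0}) : Set Node :=
  {s | ∃ f ∈ F, ∃ d ∈ D, s = f.cut d}

theorem nodesOf_finite {F : Set Node} (hF : F.Finite) (D : Finset Ordinal.{0}) :
    (nodesOf F D).Finite := by
  refine ((hF.prod D.finite_toSet).image fun p : Node × Ordinal.{0} => p.1.cut p.2).subset ?_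
  rintro s ⟨f, hf, d, hd, rfl⟩
  exact ⟨(f, d), ⟨hf, hd⟩, rfl⟩

variable {α : Ordinal.{0}}

theorem pre_cut_iff {f g : Node} (hf : f.dom = Iic α) (hg : g.dom = Iic α) {d d' : Ordinal.{0}}
    (hd : d ≤ α) (hd' : d' ≤ α) :
    Pre (f.cut d) (g.cut d') ↔ d' < d ∨ (d = d' ∧ ∃ δ, d ≤ δ ∧ LtAt δ f g) := by
  rw [Pre, dom_cut hf, dom_cut hg]
  refine or_congr ⟨fun h => ?_, fun h => ?_⟩ ⟨?_, ?_⟩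
  · have h1 := (Icc_subset_Icc_iff hd).1 h.1
    refine lt_of_le_of_ne h1.1 ?_
    rintro rfl
    exact ssubset_irrefl _ h
  · refine ⟨Icc_subset_Icc_left h.le, fun h' => ?_⟩
    exact not_le.2 h (h' (left_mem_Icc.2 hd')).1
  · rintro ⟨h, δ, hδ⟩
    have := Icc_left_injective hd hd' h
    rw [ltAt_cut_iff] at hδ
    exact ⟨this, δ, hδ.1, hδ.2.2⟩
  · rintro ⟨rfl, δ, h1, h2⟩
    exact ⟨rfl, δ, ltAt_cut_iff.2 ⟨h1, h1, h2⟩⟩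

theorem pre_tri {F : Set Node} (hF : IsBase α F) {D : Finset Ordinal.{0}} (hD : ∀ d ∈ D, d < α) :
    ∀ s ∈ nodesOf F D, ∀ s' ∈ nodesOf F D, s = s' ∨ Pre s s' ∨ Pre s' s := by
  rintro _ ⟨f, hf, d, hd, rfl⟩ _ ⟨g, hg, d', hd', rfl⟩
  have h1 := (hD d hd).le
  have h2 := (hD d' hd').le
  rw [pre_cut_iff (hF.dom f hf) (hF.dom g hg) h1 h2, pre_cut_iff (hF.dom g hg) (hF.dom f hf) h2 h1,
    cut_eq_cut_iff (hF.dom f hf) (hF.dom g hg) h1 h2]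
  rcases lt_trichotomy d d' with h | rfl | h
  · exact Or.inr (Or.inr (Or.inl h))
  · rcases hF.tri f hf g hg with rfl | ⟨δ, h | h⟩
    · exact Or.inl ⟨rfl, Agree.refl _ _⟩
    · by_cases hδ : d ≤ δ
      · exact Or.inr (Or.inl (Or.inr ⟨rfl, δ, hδ, h⟩))
      · exact Or.inl ⟨rfl, h.agree (not_le.1 hδ)⟩
    · by_cases hδ : d ≤ δ
      · exact Or.inr (Or.inr (Or.inr ⟨rfl, δ, hδ, h⟩))
      · exact Or.inl ⟨rfl, (h.agree (not_le.1 hδ)).symm⟩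
  · exact Or.inr (Or.inl (Or.inl h))

open Classical in
/-- The label of `s`: the number `a i` if `s` is the `i`-th node in the enumeration `e`. -/
def label {v : ℕ} (e : Fin v → Node) (a : Fin v → ℕ) (s : Node) : ℕ :=
  if h : ∃ i, e i = s then a h.choose else 0

/-- `e` enumerates `N` increasingly. -/
structure IsEnum (N : Set Node) {v : ℕ} (e : Fin v → Node) : Prop where
  mem : ∀ i, e i ∈ N
  surj : ∀ s ∈ N, ∃ i, e i = s
  lt : ∀ i j, i < j → Pre (e i) (e j)

namespace IsEnum

variable {N : Set Node} {v : ℕ} {e : Fin v → Node}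

theorem injective (h : IsEnum N e) : Function.Injective e := by
  intro i j hij
  rcases lt_trichotomy i j with hlt | rfl | hlt
  · exact absurd (hij ▸ h.lt i j hlt) (Pre.irrefl _)
  · rfl
  · exact absurd (hij ▸ h.lt j i hlt) (Pre.irrefl _)

theorem lt_of_pre (h : IsEnum N e) {i j : Fin v} (hij : Pre (e i) (e j)) : i < j := by
  rcases lt_trichotomy i j with hlt | rfl | hlt
  · exact hlt
  · exact absurd hij (Pre.irrefl _)
  · exact absurd (hij.trans (h.lt j i hlt)) (Pre.irrefl _)

theorem label_apply (h : IsEnum N e) (a : Fin v → ℕ) (i : Fin v) : label e a (e i) = a i := by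
  have hex : ∃ j, e j = e i := ⟨i, rfl⟩
  rw [label, dif_pos hex, h.injective hex.choose_spec]

end IsEnum

open Classical in
/-- The map of maximal nodes given by the labels `a` of the nodes. -/
def copyMap (θ : (Ordinal.{0} → ℕ) → Node) (D : Finset Ordinal.{0}) {v : ℕ} (e : Fin v → Node)
    (a : Fin v → ℕ) (f : Node) : Node :=
  θ fun d => if d ∈ D then label e a (f.cut d) else 0

/-- If `f` and `g` split at `δ`, their cuts at higher levels coincide and get equal labels, while at
`δ` the cut of `f` precedes that of `g` in the enumeration and gets the smaller label. -/
theorem copyMap_isEmb {F G : Set Node} (hF : IsBase α F) {D : Finset Ordinal.{0}}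
    (hD : ∀ d ∈ D, d < α) (hFD : splitLevels F ⊆ D) {v : ℕ} {e : Fin v → Node}
    (he : IsEnum (nodesOf F D) e) {t : ℕ} {θ : (Ordinal.{0} → ℕ) → Node} (hθ : ∀ x, θ x ∈ G)
    (hθlt : ∀ x y, ∀ δ ∈ D, x δ < y δ → y δ < t → (∀ d ∈ D, δ < d → x d = y d) →
      LtAt δ (θ x) (θ y))
    {a : Fin v → ℕ} (ha : StrictMono a) (hat : ∀ i, a i < t) :
    IsEmb F G (copyMap θ D e a) where
  mapsTo f _ := hθ _
  ltAt f hf g hg δ hδ := by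
    have hδD : δ ∈ D := hFD ⟨f, hf, g, hg, hδ⟩
    obtain ⟨i, hi⟩ := he.surj (f.cut δ) ⟨f, hf, δ, hδD, rfl⟩
    obtain ⟨j, hj⟩ := he.surj (g.cut δ) ⟨g, hg, δ, hδD, rfl⟩
    have hij : i < j := by
      apply he.lt_of_pre
      rw [hi, hj, pre_cut_iff (hF.dom f hf) (hF.dom g hg) (hD δ hδD).le (hD δ hδD).le]
      exact Or.inr ⟨rfl, δ, le_rfl, hδ⟩
    refine hθlt _ _ δ hδD ?_ ?_ fun d hd hlt => ?_
    · simp only [hδD, if_true]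
      rw [← hi, ← hj, he.label_apply, he.label_apply]
      exact ha hij
    · simp only [hδD, if_true]
      rw [← hj, he.label_apply]
      exact hat j
    · simp only [hd, if_true]
      rw [cut_eq_iff.2 (hδ.agree hlt)]

variable {c : Ordinal.{0} → ℕ → Ordinal.{0}}

theorem splitLevels_lt (hc : IsLadderSystem c) (hα : α < Ordinal.omega 1) (n : ℕ) :
    ∀ δ ∈ splitLevels (Full c α n), δ < α := by
  rintro δ ⟨f, hf, g, hg, h⟩
  refine lt_of_le_of_ne (h.le_of_dom hf.2) ?_
  rintro rfl
  exact h.ne (((full_piece hc hα n).top f hf).trans ((full_piece hc hα n).top g hg).symm)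

/-- Embeddings of `𝕊_α(n)` in `𝕊_α(k)` are coded by increasing sequences of natural numbers, in such
a way that arbitrary increasing sequences give rise to embeddings in `𝕊_α(m)` for large `m`. -/
theorem exists_coding (hc : IsLadderSystem c) (hα : α < Ordinal.omega 1) (n k : ℕ) :
    ∃ (v N : ℕ) (f : Fin v → Node) (d : Fin v → Ordinal.{0}) (code : (Node → Node) → Fin v → ℕ),
      (∀ i, f i ∈ Full c α n ∧ d i ≤ α) ∧
      (∀ w, IsEmb (Full c α n) (Full c α k) w → StrictMono (code w) ∧ ∀ i, code w i < N) ∧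
      (∀ w w', IsEmb (Full c α n) (Full c α k) w → IsEmb (Full c α n) (Full c α k) w' →
        ∀ i, code w i = code w' i ↔ Agree (d i) (w (f i)) (w' (f i))) ∧
      ∀ t : ℕ, ∃ m₀, ∀ m ≥ m₀, ∃ U : (Fin v → ℕ) → Node → Node,
        (∀ a, StrictMono a → (∀ i, a i < t) → IsEmb (Full c α n) (Full c α m) (U a)) ∧
        ∀ h : ℕ → ℕ, StrictMono h → (∀ x < N, h x < t) →
          ∃ Y, IsEmb (Full c α k) (Full c α m) Y ∧
            ∀ w, IsEmb (Full c α n) (Full c α k) w → ∀ x ∈ Full c α n, U (h ∘ code w) x = Y (w x) := by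
  classical
  have hP := full_isBase hc hα n
  have hQ := full_isBase hc hα k
  have hPf := (full_piece hc hα n).finite
  have hQf := (full_piece hc hα k).finite
  -- One set of levels serves for both pieces, so that an embedding carries the chosen nodes of
  -- `𝕊_α(n)` to chosen nodes of `𝕊_α(k)`.
  let D : Finset Ordinal.{0} := (splitLevels_finite hPf).toFinset ∪ (splitLevels_finite hQf).toFinset
  have hPD : splitLevels (Full c α n) ⊆ D := fun δ hδ => Finset.mem_coe.2
    (Finset.mem_union_left _ ((Set.Finite.mem_toFinset _).2 hδ))
  have hQD : splitLevels (Full c α k) ⊆ D := fun δ hδ => Finset.mem_coe.2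
    (Finset.mem_union_right _ ((Set.Finite.mem_toFinset _).2 hδ))
  have hD : ∀ d ∈ D, d < α := by
    intro d hd
    rcases Finset.mem_union.1 hd with h | h
    · exact splitLevels_lt hc hα n d ((Set.Finite.mem_toFinset _).1 h)
    · exact splitLevels_lt hc hα k d ((Set.Finite.mem_toFinset _).1 h)
  obtain ⟨v, e, he1, he2, he3⟩ := exists_enumeration Pre (nodesOf_finite hPf D) Pre.irrefl
    (fun _ _ _ => Pre.trans) (pre_tri hP hD)
  obtain ⟨N, e', he1', he2', he3'⟩ := exists_enumeration Pre (nodesOf_finite hQf D) Pre.irrefl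
    (fun _ _ _ => Pre.trans) (pre_tri hQ hD)
  have he : IsEnum (nodesOf (Full c α n) D) e := ⟨he1, he2, he3⟩
  have he' : IsEnum (nodesOf (Full c α k) D) e' := ⟨he1', he2', he3'⟩
  choose f hf d hd hfd using he1
  -- Entry `i` of the code is the position, among the chosen nodes of `𝕊_α(k)`, of the image of the
  -- `i`-th chosen node. It increases with `i` because an embedding preserves `Pre`.
  let code : (Node → Node) → Fin v → ℕ := fun w i => label e' (fun j => (j : ℕ)) ((w (f i)).cut (d i))
  have hcode : ∀ w, IsEmb (Full c α n) (Full c α k) w → ∀ i, ∃ j : Fin N,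
      e' j = (w (f i)).cut (d i) ∧ code w i = j := by
    intro w hw i
    obtain ⟨j, hj⟩ := he'.surj ((w (f i)).cut (d i)) ⟨_, hw.mapsTo _ (hf i), _, hd i, rfl⟩
    refine ⟨j, hj, ?_⟩
    simp only [code]
    rw [← hj, he'.label_apply]
  refine ⟨v, N, f, d, code, fun i => ⟨hf i, (hD _ (hd i)).le⟩, fun w hw => ⟨fun i j hij => ?_,
    fun i => ?_⟩, fun w w' hw hw' i => ?_, fun t => ?_⟩
  · obtain ⟨i', hi', hci⟩ := hcode w hw i
    obtain ⟨j', hj', hcj⟩ := hcode w hw j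
    rw [hci, hcj]
    refine he'.lt_of_pre ?_
    have h1 := he.lt i j hij
    rw [hfd i, hfd j, pre_cut_iff (hP.dom _ (hf i)) (hP.dom _ (hf j)) (hD _ (hd i)).le
      (hD _ (hd j)).le] at h1
    rw [hi', hj', pre_cut_iff (hQ.dom _ (hw.mapsTo _ (hf i))) (hQ.dom _ (hw.mapsTo _ (hf j)))
      (hD _ (hd i)).le (hD _ (hd j)).le]
    exact h1.imp_right fun h => ⟨h.1, h.2.imp fun δ hδ => ⟨hδ.1, hw.ltAt _ (hf i) _ (hf j) δ hδ.2⟩⟩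
  · obtain ⟨i', hi', hci⟩ := hcode w hw i
    rw [hci]; exact i'.2
  · obtain ⟨i₁, hi₁, h₁⟩ := hcode w hw i
    obtain ⟨i₂, hi₂, h₂⟩ := hcode w' hw' i
    rw [h₁, h₂, ← cut_eq_iff, ← hi₁, ← hi₂, he'.injective.eq_iff]
    exact ⟨fun h => Fin.ext h, fun h => congrArg _ h⟩
  · obtain ⟨m₀, hm₀⟩ := exists_universal hc D α hα hD t
    refine ⟨m₀, fun m hm => ?_⟩
    obtain ⟨θ, hθ, hθlt⟩ := hm₀ m hm
    refine ⟨copyMap θ D e, fun a ha hat => copyMap_isEmb hP hD hPD he hθ hθlt ha hat,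
      fun h hh hhN => ⟨copyMap θ D e' fun j => h j, copyMap_isEmb hQ hD hQD he' hθ hθlt
        (fun i j hij => hh hij) (fun j => hhN j j.2), fun w hw x hx => ?_⟩⟩
    -- Both sides apply `θ` to the same labels: at `δ` each uses the value of `h` at the position of
    -- `(w x).cut δ`.
    simp only [copyMap]
    congr 1
    funext δ
    by_cases hδ : δ ∈ D
    · simp only [hδ, if_true]
      obtain ⟨i, hi⟩ := he.surj (x.cut δ) ⟨x, hx, δ, hδ, rfl⟩
      rw [← hi, he.label_apply]
      obtain ⟨j, hj, hcj⟩ := hcode w hw i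
      have h1 : (w x).cut δ = e' j := by
        rw [hfd i, cut_eq_cut_iff (hP.dom _ (hf i)) (hP.dom x hx) (hD _ (hd i)).le (hD δ hδ).le] at hi
        rw [hj, ← hi.1, cut_eq_iff, hw.agree_iff hP hx (hf i)]
        exact hi.2.symm
      rw [h1, he'.label_apply]
      simp only [Function.comp]
      rw [hcj]
    · simp only [hδ, if_false]

end RamseySpace

end

/-! ### From coordinates of the code to projections, and back -/

noncomputable section

namespace RamseySpace

open Set

variable {c : Ordinal.{0} → ℕ → Ordinal.{0}} {α : Ordinal.{0}}

/-! ## The canonical projections -/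

/-- The nodes of `𝕊_α(n)` at which any two `R`-related embeddings in `𝕊_α(k)` agree. -/
def determined (c : Ordinal.{0} → ℕ → Ordinal.{0}) (α : Ordinal.{0}) (n k : ℕ)
    (R : (Node → Node) → (Node → Node) → Prop) : Set Node :=
  {s | s = Node.empty ∨ ∃ g ∈ Full c α n, ∃ β ≤ α, s = g.cut β ∧
    ∀ w w', IsEmb (Full c α n) (Full c α k) w → IsEmb (Full c α n) (Full c α k) w' → R w w' →
      Agree β (w g) (w' g)}

/-- Membership does not depend on the maximal node used to represent the cut, since embeddings keep
its representatives in agreement from `β` on. -/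
theorem cut_mem_determined_iff (hc : IsLadderSystem c) (hα : α < Ordinal.omega 1) {n k : ℕ}
    {R : (Node → Node) → (Node → Node) → Prop} {g : Node} (hg : g ∈ Full c α n)
    {β : Ordinal.{0}} (hβ : β ≤ α) :
    g.cut β ∈ determined c α n k R ↔ ∀ w w', IsEmb (Full c α n) (Full c α k) w →
      IsEmb (Full c α n) (Full c α k) w' → R w w' → Agree β (w g) (w' g) := by
  have hb := full_isBase hc hα n
  constructor
  · rintro (h | ⟨g', hg', β', hβ', he, h⟩)
    · exact absurd h (cut_ne_empty hg.2 hβ)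
    · rw [cut_eq_cut_iff hg.2 hg'.2 hβ hβ'] at he
      obtain ⟨rfl, he⟩ := he
      intro w w' hw hw' hR
      have h1 := (hw.agree_iff hb hg hg').2 he
      have h2 := (hw'.agree_iff hb hg hg').2 he
      exact h1.trans ((h w w' hw hw' hR).trans h2.symm)
  · exact fun h => Or.inr ⟨g, hg, β, hβ, rfl, h⟩

theorem determined_subset (c : Ordinal.{0} → ℕ → Ordinal.{0}) (α : Ordinal.{0}) (n k : ℕ)
    (R : (Node → Node) → (Node → Node) → Prop) :
    determined c α n k R ⊆ treeOf α (Full c α n) := by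
  rintro s (h | ⟨g, hg, β, hβ, he, -⟩)
  · exact Or.inl h
  · exact Or.inr ⟨g, hg, β, hβ, he⟩

theorem cut_mem_determined_mono (hc : IsLadderSystem c) (hα : α < Ordinal.omega 1) {n k : ℕ}
    {R : (Node → Node) → (Node → Node) → Prop} {g : Node} (hg : g ∈ Full c α n)
    {β β' : Ordinal.{0}} (hβ : β ≤ β') (hβ' : β' ≤ α) (h : g.cut β ∈ determined c α n k R) :
    g.cut β' ∈ determined c α n k R := by
  rw [cut_mem_determined_iff hc hα hg (hβ.trans hβ')] at h
  rw [cut_mem_determined_iff hc hα hg hβ']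
  exact fun w w' hw hw' hR => (h w w' hw hw' hR).mono hβ

theorem cut_restrict_Icc {f : Node} (hf : f.dom = Iic α) {β γ : Ordinal.{0}} (h : β ≤ γ) :
    (f.cut β).restrict (Icc γ α) = f.cut γ := by
  conv_rhs => rw [← restrict_Icc hf]
  funext ξ
  by_cases hξ : ξ ∈ Icc γ α
  · simp only [Node.restrict, hξ, if_true]
    exact cut_apply_of_le (h.trans hξ.1) f
  · simp only [Node.restrict, hξ, if_false]

theorem determined_mem_downSets (hc : IsLadderSystem c) (hα : α < Ordinal.omega 1) (n k : ℕ)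
    (R : (Node → Node) → (Node → Node) → Prop) :
    determined c α n k R ∈ downSets c α n := by
  refine ⟨?_, Or.inl rfl, ?_⟩
  · rw [spiece_eq_treeOf hc hα]
    exact determined_subset c α n k R
  · intro s hs β hd γ hγ
    rcases determined_subset c α n k R hs with rfl | ⟨g, hg, β', hβ', rfl⟩
    · rw [dom_empty] at hd
      rw [← hd] at hγ
      exact absurd hγ (notMem_empty γ)
    · rw [dom_cut hg.2] at hd
      obtain rfl := Icc_left_injective hβ' (hγ.1.trans hγ.2) hd
      rw [cut_restrict_Icc hg.2 hγ.1]
      exact cut_mem_determined_mono hc hα hg hγ.1 hγ.2 hs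

/-- The witnesses are the copy given by a generic embedding `u₀` and the projection of the image of
`determined`. The point is that `ψ` must not identify a node of that image with one outside it. It
could do so only across an interval of levels where the image of `g` does not split, and by
genericity no embedding splits `g` there, so the node on the far side is determined too. -/
theorem determined_mem_downSetsIn (hc : IsLadderSystem c) (hα : α < Ordinal.omega 1) {n k : ℕ}
    (hnk : n ≤ k) (R : (Node → Node) → (Node → Node) → Prop) :
    determined c α n k R ∈ downSetsIn c α n k := by
  refine ⟨determined_mem_downSets hc hα n k R, ?_⟩
  have hP := full_isBase hc hα n
  have hQ := full_isBase hc hα k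
  have hψ := psi_piece hc hα k
  obtain ⟨u₀, hu₀, hgen⟩ := exists_generic (full_mergeable hc α hα k) (full_piece hc hα k).finite
    (full_piece hc hα n).finite (exists_isEmb_full hc hα hnk)
  have hsub : u₀ '' Full c α n ⊆ Full c α k := by
    rintro _ ⟨f, hf, rfl⟩
    exact hu₀.mapsTo f hf
  have hiso := extend_isIso hP hQ.dom hu₀
  have hext := fun {g : Node} (hg : g ∈ Full c α n) {β : Ordinal.{0}} (hβ : β ≤ α) =>
    extend_cut hP hu₀ hg hβ
  have h0 := extend_empty (u := u₀) hP
  have hvu : (level c α).psi '' (extend α (Full c α n) u₀ '' determined c α n k R) ⊆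
      (level c α).psi '' treeOf α (u₀ '' Full c α n) := by
    rw [← hiso.bijOn.image_eq]
    exact image_mono (image_mono (determined_subset c α n k R))
  have hnil : [] ∈ (level c α).psi '' (extend α (Full c α n) u₀ '' determined c α n k R) :=
    ⟨_, ⟨_, Or.inl rfl, h0⟩, psi_empty hc hα⟩
  refine ⟨_, ⟨psi_image_mem_rtrees hc hα hnk hu₀, psi_image_subset hc hα hsub⟩, _, hvu,
    ⟨_, hnil⟩, ?_, ?_⟩
  · rintro _ ⟨_, ⟨s, hs, rfl⟩, rfl⟩ t' ht'
    by_cases hne : t' = []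
    · rw [hne]; exact hnil
    rcases determined_subset c α n k R hs with rfl | ⟨g, hg, β, hβ, rfl⟩
    · rw [h0, psi_empty hc hα, List.prefix_nil] at ht'
      exact absurd ht' hne
    · rw [hext hg hβ] at ht'
      obtain ⟨β', h1, h2, rfl⟩ := hψ.psi_prefix _ (hu₀.mapsTo g hg) β hβ t' ht' hne
      exact ⟨_, ⟨g.cut β', cut_mem_determined_mono hc hα hg h1 h2 hs, rfl⟩, by rw [hext hg h2]⟩
  · have key : psiPreimage c α ((level c α).psi ''
        (extend α (Full c α n) u₀ '' determined c α n k R)) =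
          extend α (Full c α n) u₀ '' determined c α n k R := by
      apply Subset.antisymm
      · intro s hs
        have hsk := psiPreimage_subset hc hα (hvu.trans (psi_image_subset hc hα hsub)) hs
        obtain ⟨-, _, ⟨s₁, hs₁, rfl⟩, he⟩ := hs
        rcases ((full_piece hc hα k).mem_iff s).1 hsk with rfl | ⟨q, hq, β, hβ, rfl⟩
        · exact ⟨_, Or.inl rfl, h0⟩
        rcases determined_subset c α n k R hs₁ with rfl | ⟨g, hg, β₁, hβ₁, rfl⟩
        · obtain ⟨t, ht⟩ := hψ.psi_head q hq β hβ
          rw [h0, psi_empty hc hα, ht] at he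
          cases he
        · have hu₀g := hu₀.mapsTo g hg
          rw [hext hg hβ₁, hψ.psi_eq _ hu₀g q hq β₁ hβ₁ β hβ] at he
          have hagr : Agree β (u₀ g) q := (he _ hu₀g).1 (Agree.refl _ _)
          refine ⟨g.cut β, ?_, by rw [hext hg hβ]; exact cut_eq_iff.2 hagr⟩
          rcases le_or_gt β₁ β with hle | hlt
          · exact cut_mem_determined_mono hc hα hg hle hβ hs₁
          · rw [cut_mem_determined_iff hc hα hg hβ₁] at hs₁
            rw [cut_mem_determined_iff hc hα hg hβ]
            intro w w' hw hw' hR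
            have h1 := hs₁ w w' hw hw' hR
            by_contra hna
            -- If `g.cut β` were not determined, two related embeddings would disagree on `g` at
            -- some `δ` in `[β, β₁)`. Then `u₀ g` also splits at `δ` from some `h`, which passes
            -- through the cut at `β₁` but not through the cut at `β`; so `ψ` tells the two cuts
            -- apart.
            obtain ⟨δ, hβδ, hδβ₁, hsp⟩ : ∃ δ, β ≤ δ ∧ δ < β₁ ∧ SplitsIn (Full c α k) δ (w g) := by
              rcases hQ.tri _ (hw.mapsTo g hg) _ (hw'.mapsTo g hg) with heq | ⟨δ, h | h⟩
              · rw [heq] at hna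
                exact absurd (Agree.refl _ _) hna
              · exact ⟨δ, not_lt.1 fun hlt => hna (h.agree hlt), h.agree_iff.1 h1, _,
                  hw'.mapsTo g hg, Or.inl h⟩
              · exact ⟨δ, not_lt.1 fun hlt => hna (h.agree hlt).symm, h.agree_iff.1 h1.symm, _,
                  hw'.mapsTo g hg, Or.inr h⟩
            obtain ⟨h, hh, hor⟩ := hgen w hw g hg δ hsp
            have h2 : Agree β₁ h (u₀ g) := by
              rcases hor with h' | h'
              · exact (h'.agree hδβ₁).symm
              · exact h'.agree hδβ₁
            have h3 : Agree β h (u₀ g) := ((he h hh).1 h2).trans hagr.symm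
            rcases hor with h' | h'
            · exact h'.not_agree hβδ h3.symm
            · exact h'.not_agree hβδ h3
      · intro s hs
        refine ⟨⟨k, ?_⟩, mem_image_of_mem _ hs⟩
        obtain ⟨s, hs, rfl⟩ := hs
        rcases determined_subset c α n k R hs with rfl | ⟨g, hg, β, hβ, rfl⟩
        · rw [h0]; exact empty_mem_spiece hc hα k
        · rw [hext hg hβ]
          exact ((full_piece hc hα k).mem_iff _).2 (Or.inr ⟨_, hu₀.mapsTo g hg, β, hβ, rfl⟩)
    rw [key]
    exact ⟨_, hiso.subset (determined_subset c α n k R)⟩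

theorem LtAt.congr_left {δ : Ordinal.{0}} {f f' g : Node} (h : LtAt δ f g) (hf : Agree δ f' f) :
    LtAt δ f' g := by
  obtain ⟨x, y, hx, hy, hxy, ha⟩ := h
  exact ⟨x, y, by rw [hf δ le_rfl, hx], hy, hxy, fun η hη => (hf η hη.le).trans (ha η hη)⟩

/-- The cut of `ι g` at `δ` must project like a cut at some `β` of some `ι' g₁`. If `β ≤ δ`, then
`g₁` splits to the left of `g` at `δ`, where `ι` and `ι'` already agree, so `ι g₁` and `ι g` agree
at `δ`, which is impossible. If `δ < β`, then `ι' g` passes through the second cut but not through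
the first. -/
theorem not_ltAt_of_psi_image_eq (hc : IsLadderSystem c) (hα : α < Ordinal.omega 1) {n K : ℕ}
    {S : Set Node} (hS : S ⊆ treeOf α (Full c α n))
    (hdown : ∀ g ∈ Full c α n, ∀ β β', β ≤ β' → β' ≤ α → g.cut β ∈ S → g.cut β' ∈ S)
    {ι ι' : Node → Node} (hι : IsEmb (Full c α n) (Full c α K) ι)
    (hι' : IsEmb (Full c α n) (Full c α K) ι') (h0' : ι' Node.empty = Node.empty)
    (hcut : ∀ f ∈ Full c α n, ∀ β ≤ α, ι (f.cut β) = (ι f).cut β)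
    (hcut' : ∀ f ∈ Full c α n, ∀ β ≤ α, ι' (f.cut β) = (ι' f).cut β)
    (himg : (level c α).psi '' (ι '' S) = (level c α).psi '' (ι' '' S))
    {g : Node} (hg : g ∈ Full c α n) {δ : Ordinal.{0}} (hδ : δ ≤ α) (hgS : g.cut δ ∈ S)
    (hmin : ∀ g₁ ∈ Full c α n, g₁.cut δ ∈ S → LtAt δ g₁ g → Agree δ (ι g₁) (ι' g₁)) :
    ¬ LtAt δ (ι g) (ι' g) := by
  intro hlt
  have hP := full_isBase hc hα n
  have hψ := psi_piece hc hα K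
  have h1 : (level c α).psi ((ι g).cut δ) ∈ (level c α).psi '' (ι' '' S) := by
    rw [← himg]
    exact ⟨_, ⟨_, hgS, rfl⟩, by rw [hcut g hg δ hδ]⟩
  obtain ⟨_, ⟨s, hs, rfl⟩, he⟩ := h1
  rcases hS hs with rfl | ⟨g₁, hg₁, β, hβ, rfl⟩
  · obtain ⟨t, ht⟩ := hψ.psi_head _ (hι.mapsTo g hg) δ hδ
    rw [h0', psi_empty hc hα, ht] at he
    cases he
  · rw [hcut' g₁ hg₁ β hβ, hψ.psi_eq _ (hι'.mapsTo g₁ hg₁) _ (hι.mapsTo g hg) β hβ δ hδ] at he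
    have h2 : Agree δ (ι' g₁) (ι g) := (he _ (hι'.mapsTo g₁ hg₁)).1 (Agree.refl _ _)
    rcases le_or_gt β δ with hβδ | hβδ
    · have h3 : LtAt δ g₁ g := (hι'.ltAt_iff hP hg₁ hg).1 (hlt.congr_left h2)
      have h4 := hmin g₁ hg₁ (hdown g₁ hg₁ β δ hβδ hδ hs) h3
      have h5 : Agree δ g₁ g := (hι.agree_iff hP hg₁ hg).1 (h4.trans h2)
      exact h3.not_agree le_rfl h5
    · have h3 : Agree β (ι' g) (ι' g₁) := (hlt.agree hβδ).symm.trans (h2.mono hβδ.le).symm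
      exact hlt.not_agree le_rfl ((he _ (hι'.mapsTo g hg)).1 h3).symm

/-- Equality of the projected sets forces equality node by node. Choose a leftmost maximal node with
a disagreement inside `S`; by symmetry of `ι` and `ι'` the preceding lemma excludes both directions.
-/
theorem agree_of_psi_image_eq (hc : IsLadderSystem c) (hα : α < Ordinal.omega 1) {n K : ℕ}
    {S : Set Node} (hS : S ⊆ treeOf α (Full c α n))
    (hdown : ∀ g ∈ Full c α n, ∀ β β', β ≤ β' → β' ≤ α → g.cut β ∈ S → g.cut β' ∈ S)
    {ι ι' : Node → Node} (hι : IsEmb (Full c α n) (Full c α K) ι)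
    (hι' : IsEmb (Full c α n) (Full c α K) ι') (h0 : ι Node.empty = Node.empty)
    (h0' : ι' Node.empty = Node.empty)
    (hcut : ∀ f ∈ Full c α n, ∀ β ≤ α, ι (f.cut β) = (ι f).cut β)
    (hcut' : ∀ f ∈ Full c α n, ∀ β ≤ α, ι' (f.cut β) = (ι' f).cut β)
    (himg : (level c α).psi '' (ι '' S) = (level c α).psi '' (ι' '' S))
    {g : Node} (hg : g ∈ Full c α n) {β : Ordinal.{0}} (hβS : g.cut β ∈ S) :
    Agree β (ι g) (ι' g) := by
  have hQ := full_isBase hc hα K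
  have hbad : ∀ g ∈ Full c α n, ∀ β, g.cut β ∈ S → ¬ Agree β (ι g) (ι' g) →
      ∃ δ ≤ α, g.cut δ ∈ S ∧ (LtAt δ (ι g) (ι' g) ∨ LtAt δ (ι' g) (ι g)) := by
    intro g hg β hβS hna
    rcases hQ.tri _ (hι.mapsTo g hg) _ (hι'.mapsTo g hg) with he | ⟨δ, h | h⟩
    · rw [he] at hna
      exact absurd (Agree.refl _ _) hna
    · have hδ := h.le_of_dom (hι.mapsTo g hg).2
      exact ⟨δ, hδ, hdown g hg β δ (not_lt.1 fun hlt => hna (h.agree hlt)) hδ hβS, Or.inl h⟩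
    · have hδ := h.le_of_dom (hι'.mapsTo g hg).2
      exact ⟨δ, hδ, hdown g hg β δ (not_lt.1 fun hlt => hna (h.agree hlt).symm) hδ hβS, Or.inr h⟩
  by_contra hna
  let r : Full c α n → Full c α n → Prop := fun a b => ∃ ε, LtAt ε a.1 b.1
  have : Finite (Full c α n) := (full_piece hc hα n).finite
  have : IsTrans _ r := ⟨fun _ _ _ ⟨_, h⟩ ⟨_, h'⟩ => ⟨_, h.trans h'⟩⟩
  have : Std.Irrefl r := ⟨fun _ ⟨_, h⟩ => LtAt.irrefl h⟩
  have hwf : WellFounded r := Finite.wellFounded_of_trans_of_irrefl r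
  obtain ⟨⟨a, ha⟩, ⟨δ, hδ, haS, hlt⟩, hmin⟩ := hwf.has_min {a : Full c α n | ∃ δ ≤ α,
    a.1.cut δ ∈ S ∧ (LtAt δ (ι a.1) (ι' a.1) ∨ LtAt δ (ι' a.1) (ι a.1))}
    ⟨⟨g, hg⟩, hbad g hg β hβS hna⟩
  have hmin' : ∀ g₁ ∈ Full c α n, g₁.cut δ ∈ S → LtAt δ g₁ a → Agree δ (ι g₁) (ι' g₁) := by
    intro g₁ hg₁ hg₁S hlt
    by_contra h
    exact hmin ⟨g₁, hg₁⟩ (hbad g₁ hg₁ δ hg₁S h) ⟨δ, hlt⟩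
  rcases hlt with hlt | hlt
  · exact not_ltAt_of_psi_image_eq hc hα hS hdown hι hι' h0' hcut hcut' himg ha hδ haS hmin' hlt
  · exact not_ltAt_of_psi_image_eq hc hα hS hdown hι' hι h0 hcut' hcut himg.symm ha hδ haS
      (fun g₁ h1 h2 h3 => (hmin' g₁ h1 h2 h3).symm) hlt

/-! ## The canonization theorem -/

/-- A copy of `𝕊_α(n)` inside a copy of `𝕊_α(k)` comes from an embedding in `𝕊_α(k)`. -/
theorem exists_factor (hc : IsLadderSystem c) (hα : α < Ordinal.omega 1) {n k K : ℕ}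
    {Y : Node → Node} (hY : IsEmb (Full c α k) (Full c α K) Y) {u : Set (List ℕ)}
    (hu : u ∈ RTrees c α n) (huy : u ⊆ (level c α).psi '' treeOf α (Y '' Full c α k)) :
    ∃ w, IsEmb (Full c α n) (Full c α k) w ∧ ∀ x ∈ Full c α n, iota c α n u x = Y (w x) := by
  have hsub : Y '' Full c α k ⊆ Full c α K := by
    rintro _ ⟨f, hf, rfl⟩
    exact hY.mapsTo f hf
  obtain ⟨hι, hpre, -⟩ := iota_spec hc hα hu (huy.trans (psi_image_subset hc hα hsub))
  have hex : ∀ x ∈ Full c α n, ∃ q ∈ Full c α k, Y q = iota c α n u x := by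
    intro x hx
    have h1 : iota c α n u x ∈ psiPreimage c α u := by
      rw [hpre]
      exact mem_treeOf (mem_image_of_mem _ hx)
    have h2 : iota c α n u x ∈ treeOf α (Y '' Full c α k) := by
      rw [← psiPreimage_psi_image hc hα hsub]
      exact ⟨h1.1, huy h1.2⟩
    exact mem_of_mem_treeOf (fun f hf => (hsub hf).2) h2 (hι.mapsTo x hx).2
  choose! w hw hYw using hex
  refine ⟨w, ⟨hw, fun f hf g hg δ hδ => ?_⟩, fun x hx => (hYw x hx).symm⟩
  rw [← hY.ltAt_iff (full_isBase hc hα k) (hw f hf) (hw g hg), hYw f hf, hYw g hg]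
  exact hι.ltAt f hf g hg δ hδ

/-- The nodes numbered by `I` are determined by construction, so equal projections give agreement on
`I`. Conversely, agreement on `I` is the relation from which `S` was defined, so the two images of
`S` coincide. -/
theorem proj_determined_eq_iff (hc : IsLadderSystem c) (hα : α < Ordinal.omega 1) {n k K v : ℕ}
    {f : Fin v → Node} {d : Fin v → Ordinal.{0}} (hfd : ∀ i, f i ∈ Full c α n ∧ d i ≤ α)
    (I : Set (Fin v)) {Y : Node → Node} (hY : IsEmb (Full c α k) (Full c α K) Y)
    {u u' : Set (List ℕ)} (hu : u ∈ RTrees c α n) (hu' : u' ∈ RTrees c α n)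
    (huK : u ⊆ TPiece c α K) (huK' : u' ⊆ TPiece c α K) {w w' : Node → Node}
    (hw : IsEmb (Full c α n) (Full c α k) w) (hw' : IsEmb (Full c α n) (Full c α k) w')
    (huw : ∀ x ∈ Full c α n, iota c α n u x = Y (w x))
    (huw' : ∀ x ∈ Full c α n, iota c α n u' x = Y (w' x)) :
    proj c α n
          (determined c α n k fun w w' => ∀ i ∈ I, Agree (d i) (w (f i)) (w' (f i))) u =
        proj c α n
          (determined c α n k fun w w' => ∀ i ∈ I, Agree (d i) (w (f i)) (w' (f i))) u' ↔
      ∀ i ∈ I, Agree (d i) (w (f i)) (w' (f i)) := by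
  set S := determined c α n k fun w w' => ∀ i ∈ I, Agree (d i) (w (f i)) (w' (f i))
  have hQ := full_isBase hc hα k
  obtain ⟨hι, -, -, h0, hcut⟩ := iota_spec hc hα hu huK
  obtain ⟨hι', -, -, h0', hcut'⟩ := iota_spec hc hα hu' huK'
  constructor
  · intro h i hi
    have hmem : (f i).cut (d i) ∈ S :=
      (cut_mem_determined_iff hc hα (hfd i).1 (hfd i).2).2 fun _ _ _ _ hR => hR i hi
    have := agree_of_psi_image_eq hc hα (determined_subset c α n k _)
      (fun g hg β β' hβ hβ' h => cut_mem_determined_mono hc hα hg hβ hβ' h) hι hι' h0 h0' hcut hcut' h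
      (hfd i).1 hmem
    rwa [huw _ (hfd i).1, huw' _ (hfd i).1, hY.agree_iff hQ (hw.mapsTo _ (hfd i).1)
      (hw'.mapsTo _ (hfd i).1)] at this
  · intro h
    have himg : iota c α n u '' S = iota c α n u' '' S := by
      refine image_congr fun s hs => ?_
      rcases determined_subset c α n k _ hs with rfl | ⟨g, hg, β, hβ, rfl⟩
      · rw [h0, h0']
      · rw [hcut g hg β hβ, hcut' g hg β hβ, cut_eq_iff, huw g hg, huw' g hg,
          hY.agree_iff hQ (hw.mapsTo g hg) (hw'.mapsTo g hg)]
        exact (cut_mem_determined_iff hc hα hg hβ).1 hs w w' hw hw' h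
    rw [proj, proj, himg]

end RamseySpace

end

/-! ### Finite canonization by transfer from tuples -/

theorem mainTheorem5 (c : Ordinal.{0} → ℕ → Ordinal.{0}) (hc : RamseySpace.IsLadderSystem c)
    (α : Ordinal.{0}) (hα₁ : 1 ≤ α) (hα : α < Ordinal.omega 1)
    (n k : ℕ) (hnk : n ≤ k) (X : RamseySpace.RSpace c α) :
    ∃ m : ℕ,
      (∀ E : Setoid (RamseySpace.RTreesIn c α n (X.tree m)),
        ∃ y ∈ RamseySpace.RTreesIn c α k (X.tree m),
          RamseySpace.IsCanonicalOn c α n k E y) ∧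
      (∀ f : RamseySpace.RTreesIn c α n (X.tree m) → Fin 2,
        ∃ y ∈ RamseySpace.RTreesIn c α k (X.tree m),
          ∀ u v : RamseySpace.RTreesIn c α n (X.tree m), u.1 ⊆ y → v.1 ⊆ y → f u = f v) := by
  classical
  obtain ⟨v, N, f, d, code, hfd, hcode, hagree, huniv⟩ := RamseySpace.exists_coding hc hα n k
  obtain ⟨t₁, ht₁⟩ := RamseySpace.finite_erdos_rado v N
  obtain ⟨t₂, ht₂⟩ := RamseySpace.finite_ramsey_two v N
  obtain ⟨m₀, hm₀⟩ := huniv (max t₁ t₂)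
  -- The term `k` ensures that copies of `𝕊_α(k)` in `X(m)` belong to `R_α(k)`; the bound `max t₁
  -- t₂` lets one `m` serve both assertions.
  set m := max m₀ k with hm
  obtain ⟨U, hU, hcopy⟩ := hm₀ m (le_max_left _ _)
  have hkm : k ≤ m := le_max_right _ _
  have hnm : n ≤ m := hnk.trans hkm
  have hT : X.tree m ⊆ RamseySpace.TPiece c α (X.idx m) := Set.inter_subset_right
  have hι := (RamseySpace.iota_spec hc hα (X.tree_mem m) hT).1
  set ι := RamseySpace.iota c α m (X.tree m) with hιdef
  let V : (Fin v → ℕ) → Prop := fun a => StrictMono a ∧ ∀ i, a i < max t₁ t₂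
  let tr : ∀ a, V a → RamseySpace.RTreesIn c α n (X.tree m) := fun a ha =>
    ⟨_, RamseySpace.psi_image_mem_rtreesIn hc hα hnm X (hU a ha.1 ha.2)⟩
  -- Every member of `R_α(n)` inside the copy `y` given by `h` is the tree attached to a tuple `h ∘
  -- code w`, so statements about tuples transfer to all of them.
  have main : ∀ h : ℕ → ℕ, StrictMono h → (∀ x < N, h x < max t₁ t₂) →
      ∃ y ∈ RamseySpace.RTreesIn c α k (X.tree m), ∃ Y,
        RamseySpace.IsEmb (RamseySpace.Full c α k) (RamseySpace.Full c α (X.idx m)) Y ∧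
        ∀ u : RamseySpace.RTreesIn c α n (X.tree m), u.1 ⊆ y → ∃ w,
          RamseySpace.IsEmb (RamseySpace.Full c α n) (RamseySpace.Full c α k) w ∧
          (∀ x ∈ RamseySpace.Full c α n, RamseySpace.iota c α n u.1 x = Y (w x)) ∧
          ∃ hV : V (h ∘ code w), tr (h ∘ code w) hV = u := by
    intro h hh hhN
    obtain ⟨Y, hY, hYU⟩ := hcopy h hh hhN
    refine ⟨_, RamseySpace.psi_image_mem_rtreesIn hc hα hkm X hY, ι ∘ Y, hι.comp hY,
      fun u hu => ?_⟩
    obtain ⟨w, hw, huw⟩ := RamseySpace.exists_factor hc hα (hι.comp hY) u.2.1 hu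
    have hV : V (h ∘ code w) :=
      ⟨hh.comp (hcode w hw).1, fun i => hhN _ ((hcode w hw).2 i)⟩
    refine ⟨w, hw, huw, hV, Subtype.ext ?_⟩
    have himg : (ι ∘ U (h ∘ code w)) '' RamseySpace.Full c α n =
        RamseySpace.iota c α n u.1 '' RamseySpace.Full c α n :=
      Set.image_congr fun x hx => by
        rw [huw x hx, Function.comp, Function.comp, hYU w hw x hx]
    change (RamseySpace.level c α).psi '' RamseySpace.treeOf α
      ((ι ∘ U (h ∘ code w)) '' RamseySpace.Full c α n) = u.1
    rw [himg]
    exact (RamseySpace.iota_spec hc hα u.2.1 (u.2.2.trans hT)).2.2.1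
  refine ⟨m, fun E => ?_, fun χ => ?_⟩
  -- Tuples that code no tree are thrown into the extra class `none`. They play no role, since only
  -- tuples `h ∘ code w` are compared later.
  · let G : (Fin v → ℕ) → Option (Quotient E) := fun a =>
      if ha : V a then some (Quotient.mk E (tr a ha)) else none
    obtain ⟨h, hh, hhN, I, hI⟩ := ht₁ (Setoid.ker G)
    obtain ⟨y, hy, Y, hY, hYw⟩ := main h hh fun x hx => lt_max_of_lt_left (hhN x hx)
    refine ⟨y, hy, _, RamseySpace.determined_mem_downSetsIn hc hα hnk
      (fun w w' => ∀ i ∈ I, RamseySpace.Agree (d i) (w (f i)) (w' (f i))), fun u u' huy huy' => ?_⟩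
    obtain ⟨w, hw, huw, hV, htr⟩ := hYw u huy
    obtain ⟨w', hw', huw', hV', htr'⟩ := hYw u' huy'
    rw [RamseySpace.proj_determined_eq_iff hc hα hfd I hY u.2.1 u'.2.1 (u.2.2.trans hT)
      (u'.2.2.trans hT) hw hw' huw huw']
    have h1 : Setoid.ker G (h ∘ code w) (h ∘ code w') ↔ E u u' := by
      rw [Setoid.ker_def]
      simp only [G, dif_pos hV, dif_pos hV', htr, htr', Option.some.injEq]
      exact Quotient.eq
    rw [← h1, hI _ _ (hcode w hw).1 (hcode w' hw').1 (hcode w hw).2 (hcode w' hw').2]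
    exact forall₂_congr fun i _ => hagree w w' hw hw' i
  · obtain ⟨h, hh, hhN, hI⟩ := ht₂ fun a => if ha : V a then χ (tr a ha) else 0
    obtain ⟨y, hy, Y, hY, hYw⟩ := main h hh fun x hx => lt_max_of_lt_right (hhN x hx)
    refine ⟨y, hy, fun u u' huy huy' => ?_⟩
    obtain ⟨w, hw, huw, hV, htr⟩ := hYw u huy
    obtain ⟨w', hw', huw', hV', htr'⟩ := hYw u' huy'
    have := hI _ _ (hcode w hw).1 (hcode w' hw').1 (hcode w hw).2 (hcode w' hw').2
    rwa [dif_pos hV, dif_pos hV', htr, htr'] at this
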